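/- Let $X$ be a smooth scheme of finite type over $\mathbb{C}$ and let $Y=\bigcup_{i=1}^{l}Y_i$ be a strict normal crossing divisor on $X$ with irreducible components $Y_1,\dots,Y_l$; that is, the $Y_i$ are integral closed subschemes, every scheme-theoretic intersection $Y_\Theta=\bigcap_{i\in\Theta}Y_i$ ($\Theta\subset\{1,\dots,l\}$, $Y_\emptyset=X$) is smooth over $\mathbb{C}$, and étale locally at each point $x$ of $X$ there is an isomorphism over $\mathbb{C}$ of $X$ with $\mathbb{A}^n$ (for some $n$) under which those $Y_i$ that contain $x$ are distinct coordinate hyperplanes. For a scheme $V$ and an effective Cartier divisor $W\subset V$, the deformation to the normal cone of $W$ in $V$ is the open complement $V'$ of the image of the canonical lift $V\times\{0\}\to\mathrm{Bl}$ in the blow-up $\mathrm{Bl}$ of $V\times\mathbb{A}^1$ along $W\times\{0\}$, together with the morphism $V'\to V\times\mathbb{A}^1$; write $T$ for the coordinate of $\mathbb{A}^1$ and its pull-back to $V'$. A closed subscheme $Z\subset V$ induces a closed subscheme of $V'$, the scheme-theoretic closure of the inverse image of $Z\times\mathbb{C}^\times$. Starting with $\mathcal{X}^{(0)}=X$ and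 $\mathcal{Y}^{(0)}_i=Y_i$, let $\mathcal{X}^{(k)}$ be the deformation to the normal cone of $\mathcal{Y}^{(k-1)}_k$ in $\mathcal{X}^{(k-1)}$, with parameter $T_k$, and let $\mathcal{Y}^{(k)}_i\subset\mathcal{X}^{(k)}$ be the closed subscheme induced by $\mathcal{Y}^{(k-1)}_i$. Put $\mathcal{X}=\mathcal{X}^{(l)}$, let $q\colon\mathcal{X}\to X$ be the structure morphism and $f=(T_1,\dots,T_l)\colon\mathcal{X}\to\mathbb{A}^l$. Then this construction can be carried out (the blow-ups and the lifts exist), and the following hold. (1) Let $U=\operatorname{Spec}A\subset X$ be an affine open subscheme (for instance $U=X$ if $X$ is affine) and let $I_i\subset A$ be the ideal of $Y_i\cap U$. There is an isomorphism over $U$ $$q^{-1}(U)\simeq\operatorname{Spec}\bigoplus_{\underline n\in\mathbb{Z}^l}I_1^{-n_1}\cdots I_l^{-n_l}\,T_1^{n_1}\cdots T_l^{n_l},$$ where $I_i^{k}=A$ for $k\le 0$ and the ring on the right is regarded as a subring of $A[T_1^{\pm1},\dots,T_l^{\pm1}]$, under which the function $T_i$ on $\mathcal{X}$ corresponds to the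 variable $T_i$. (2) For $\Theta\subset\{1,\dots,l\}$ with complement $\Theta^c$, let $\mathcal{X}_\Theta=f^{-1}((\mathbb{C}^\times)^\Theta\times\{0\}^{\Theta^c})$ be the scheme-theoretic inverse image. Then there is an isomorphism $$\mathcal{X}_\Theta\simeq C_{Y_{\Theta^c}}(X)\times(\mathbb{C}^\times)^\Theta$$ compatible with the morphisms of both sides to $X$ and to $(\mathbb{C}^\times)^\Theta$. Here $C_{Z}(X)=\operatorname{\mathbf{Spec}}\bigoplus_{k\ge0}\mathcal{I}^k/\mathcal{I}^{k+1}$ is the normal cone of the closed subscheme $Z\subset X$ with ideal sheaf $\mathcal{I}$. -/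

import Mathlib

open CategoryTheory CategoryTheory.Limits AlgebraicGeometry

noncomputable section

/-! ### Graded rings attached to ideals -/

section Rings

variable {A B C : Type} [CommRing A] [CommRing B] [CommRing C]

/-- The exponent `max (-n) 0`, so that `I ^ negExp n` is the power `I ^ (-n)` with the convention
that `I ^ k = A` for `k ≤ 0`. -/
def negExp (n : ℤ) : ℕ := (-n).toNat

/-- The subring `⨁_{n ∈ ℤ^l} I₁^{-n₁} ⋯ I_l^{-n_l} T^n` of the Laurent polynomial ring
`A[T₁^{±1}, …, T_l^{±1}]` (the group algebra of `ℤ^l`), where `I^k = A` for `k ≤ 0`. -/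
def extendedRees {l : ℕ} (I : Fin l → Ideal A) :
    Subalgebra A (AddMonoidAlgebra A (Fin l → ℤ)) where
  carrier := {p | ∀ n, p.coeff n ∈ ∏ i, I i ^ negExp (n i)}
  mul_mem' {p q} hp hq n := by
    classical
    rw [AddMonoidAlgebra.coeff_mul]
    refine Ideal.sum_mem _ fun a _ ↦ Ideal.sum_mem _ fun b _ ↦ ?_
    dsimp only
    split_ifs with h
    · subst h
      refine (?_ : (∏ i, I i ^ negExp (a i)) * ∏ i, I i ^ negExp (b i) ≤ _)
        (Ideal.mul_mem_mul (hp a) (hq b))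
      rw [← Finset.prod_mul_distrib]
      refine Finset.prod_le_prod' fun i _ ↦ ?_
      rw [← pow_add]
      refine Ideal.pow_le_pow_right ?_
      simp only [negExp, Pi.add_apply]
      lia
    · exact Ideal.zero_mem _
  add_mem' {p q} hp hq n := by
    rw [AddMonoidAlgebra.coeff_add, Finsupp.add_apply]
    exact Ideal.add_mem _ (hp n) (hq n)
  algebraMap_mem' r n := by
    classical
    rw [AddMonoidAlgebra.coe_algebraMap]
    simp only [Function.comp_apply, AddMonoidAlgebra.coeff_single, Finsupp.single_apply]
    split_ifs with h
    · subst h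
      simp [negExp, Ideal.top_pow]
    · exact Ideal.zero_mem _

/-- The variable `T_i`, as an element of `⨁_n I^{-n} T^n`. -/
def extendedRees.T {l : ℕ} (I : Fin l → Ideal A) (i : Fin l) : extendedRees I :=
  ⟨AddMonoidAlgebra.single (Pi.single i 1) 1, fun n ↦ by
    classical
    simp only [AddMonoidAlgebra.coeff_single, Finsupp.single_apply]
    split_ifs with h
    · subst h
      have : ∀ j, negExp ((Pi.single i 1 : Fin l → ℤ) j) = 0 := fun j ↦ by
        by_cases hj : j = i
        · subst hj; simp [negExp]
        · simp [negExp, hj]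
      simp [this, Ideal.top_pow]
    · exact Ideal.zero_mem _⟩

/-- The associated graded ring `⨁_{k ≥ 0} I^k / I^{k+1}`, as the quotient of the Rees algebra
`⨁_{k ≥ 0} I^k t^k` by the ideal `⨁_{k ≥ 0} I^{k+1} t^k` generated by `I`. -/
def AssocGraded (I : Ideal A) : Type :=
  reesAlgebra I ⧸ I.map (algebraMap A (reesAlgebra I))

instance (I : Ideal A) : CommRing (AssocGraded I) :=
  inferInstanceAs (CommRing (reesAlgebra I ⧸ I.map (algebraMap A (reesAlgebra I))))

instance (I : Ideal A) : Algebra A (AssocGraded I) :=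
  inferInstanceAs (Algebra A (reesAlgebra I ⧸ I.map (algebraMap A (reesAlgebra I))))

/-- The map of Rees algebras induced by a ring homomorphism carrying `I` into `J`. -/
def reesMap (φ : A →+* B) (I : Ideal A) (J : Ideal B) (h : I.map φ ≤ J) :
    reesAlgebra I →+* reesAlgebra J :=
  (Polynomial.mapRingHom φ).restrict (reesAlgebra I) (reesAlgebra J) fun p hp i ↦ by
    rw [Polynomial.coe_mapRingHom, Polynomial.coeff_map]
    refine Ideal.pow_right_mono h i ?_
    rw [← Ideal.map_pow]
    exact Ideal.mem_map_of_mem φ (hp i)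

theorem reesMap_algebraMap (φ : A →+* B) (I : Ideal A) (J : Ideal B) (h : I.map φ ≤ J) (a : A) :
    reesMap φ I J h (algebraMap A _ a) = algebraMap B _ (φ a) :=
  Subtype.ext (Polynomial.map_C φ)

theorem map_reesMap_le (φ : A →+* B) (I : Ideal A) (J : Ideal B) (h : I.map φ ≤ J) :
    (I.map (algebraMap A (reesAlgebra I))).map (reesMap φ I J h) ≤
      J.map (algebraMap B (reesAlgebra J)) := by
  rw [Ideal.map_map, show (reesMap φ I J h).comp (algebraMap A (reesAlgebra I)) =
    (algebraMap B (reesAlgebra J)).comp φ from RingHom.ext (reesMap_algebraMap φ I J h),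
    ← Ideal.map_map]
  exact Ideal.map_mono h

/-- The map of associated graded rings induced by a ring homomorphism carrying `I` into `J`. -/
def AssocGraded.map (φ : A →+* B) (I : Ideal A) (J : Ideal B) (h : I.map φ ≤ J) :
    AssocGraded I →+* AssocGraded J :=
  Ideal.quotientMap _ (reesMap φ I J h) (Ideal.map_le_iff_le_comap.mp (map_reesMap_le φ I J h))

theorem AssocGraded.map_algebraMap (φ : A →+* B) (I : Ideal A) (J : Ideal B) (h : I.map φ ≤ J)
    (a : A) : AssocGraded.map φ I J h (algebraMap A _ a) = algebraMap B _ (φ a) :=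
  congrArg (Ideal.Quotient.mk _) (reesMap_algebraMap φ I J h a)

theorem AssocGraded.map_congr (φ ψ : A →+* B) (I : Ideal A) (J : Ideal B) (h : I.map φ ≤ J)
    (e : φ = ψ) : AssocGraded.map φ I J h = AssocGraded.map ψ I J (e ▸ h) := by
  subst e; rfl

theorem AssocGraded.map_id (I : Ideal A) (h : I.map (RingHom.id A) ≤ I) :
    AssocGraded.map (RingHom.id A) I I h = RingHom.id _ := by
  refine Ideal.Quotient.ringHom_ext (RingHom.ext fun p ↦ ?_)
  refine congrArg (Ideal.Quotient.mk _) (Subtype.ext ?_)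
  exact Polynomial.map_id

theorem AssocGraded.map_comp (φ : A →+* B) (ψ : B →+* C) (I : Ideal A) (J : Ideal B) (K : Ideal C)
    (h : I.map φ ≤ J) (h' : J.map ψ ≤ K) (h'' : I.map (ψ.comp φ) ≤ K) :
    AssocGraded.map (ψ.comp φ) I K h'' =
      (AssocGraded.map ψ J K h').comp (AssocGraded.map φ I J h) := by
  refine Ideal.Quotient.ringHom_ext (RingHom.ext fun p ↦ ?_)
  refine congrArg (Ideal.Quotient.mk _) (Subtype.ext ?_)
  exact (Polynomial.map_map φ ψ _).symm

theorem reesMap_isLocalization [Algebra A B] (f : A) [IsLocalization.Away f B] (I : Ideal A) :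
    letI := (reesMap (algebraMap A B) I (I.map (algebraMap A B)) le_rfl).toAlgebra
    IsLocalization.Away (algebraMap A (reesAlgebra I) f)
      (reesAlgebra (I.map (algebraMap A B))) := by
  set J := I.map (algebraMap A B)
  let φ := reesMap (algebraMap A B) I J le_rfl
  let := φ.toAlgebra
  have hφ : ∀ x, algebraMap (reesAlgebra I) (reesAlgebra J) x = φ x := fun _ ↦ rfl
  have hf : ∀ k, φ (algebraMap A _ f ^ k) = algebraMap B _ (algebraMap A B (f ^ k)) := fun k ↦ by
    rw [← map_pow, reesMap_algebraMap]
  have key : ∀ p : Polynomial B, (∀ i, p.coeff i ∈ J ^ i) →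
      ∃ (q : reesAlgebra I) (k : ℕ),
        p * Polynomial.C (algebraMap A B (f ^ k)) = ((φ q : reesAlgebra J) : Polynomial B) := by
    intro p hp
    rw [p.as_sum_support]
    generalize p.support = s
    induction s using Finset.induction_on with
    | empty => exact ⟨0, 0, by simp⟩
    | insert i s hi ih =>
      obtain ⟨q, k, hq⟩ := ih
      have hpi := hp i
      rw [← Ideal.map_pow, IsLocalization.mem_map_algebraMap_iff (Submonoid.powers f)] at hpi
      obtain ⟨⟨⟨a, ha⟩, ⟨_, m, rfl⟩⟩, h⟩ := hpi
      refine ⟨q * algebraMap A _ (f ^ m) +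
        ⟨Polynomial.monomial i a, reesAlgebra.monomial_mem.mpr ha⟩ * algebraMap A _ (f ^ k),
        k + m, ?_⟩
      rw [map_add, map_mul, map_mul, reesMap_algebraMap, reesMap_algebraMap,
        Finset.sum_insert hi, add_mul, add_comm]
      have e1 : ((φ ⟨Polynomial.monomial i a, reesAlgebra.monomial_mem.mpr ha⟩ :
          reesAlgebra J) : Polynomial B) = Polynomial.monomial i (algebraMap A B a) :=
        Polynomial.map_monomial _
      have e2 : ∀ (u v : reesAlgebra J) (b c : B),
          ((u * algebraMap B _ b + v * algebraMap B _ c : reesAlgebra J) : Polynomial B) =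
            (u : Polynomial B) * Polynomial.C b + (v : Polynomial B) * Polynomial.C c :=
        fun _ _ _ _ ↦ rfl
      dsimp only at h
      rw [e2, e1, ← hq, ← h, ← Polynomial.monomial_mul_C, pow_add, map_mul, map_mul]
      ring
  refine ⟨(fun y ↦ ?_), (fun z ↦ ?_), (fun {x y} h ↦ ?_)⟩
  · obtain ⟨_, k, rfl⟩ := y
    rw [hφ, hf]
    exact (IsLocalization.map_units B (⟨f ^ k, k, rfl⟩ : Submonoid.powers f)).map _
  · obtain ⟨q, k, h⟩ := key z.1 z.2
    refine ⟨⟨q, ⟨_, k, rfl⟩⟩, Subtype.ext ?_⟩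
    rw [hφ, hφ, ← h]
    dsimp only
    rw [hf]
    rfl
  · have : ∀ i, ∃ k : ℕ, f ^ k * x.1.coeff i = f ^ k * y.1.coeff i := fun i ↦ by
      have h1 : algebraMap A B (x.1.coeff i) = algebraMap A B (y.1.coeff i) := by
        have := congrArg (fun z : reesAlgebra J ↦ z.1.coeff i) h
        exact (Polynomial.coeff_map _ _).symm.trans (this.trans (Polynomial.coeff_map _ _))
      obtain ⟨⟨_, k, rfl⟩, hk⟩ := (IsLocalization.eq_iff_exists (Submonoid.powers f) B).mp h1
      exact ⟨k, hk⟩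
    choose k hk using this
    let N := (x.1.support ∪ y.1.support).sup k
    refine ⟨⟨_, N, rfl⟩, Subtype.ext (Polynomial.ext fun i ↦ ?_)⟩
    have e : ∀ z : reesAlgebra I,
        ((algebraMap A (reesAlgebra I) f ^ N * z : reesAlgebra I) : Polynomial A).coeff i =
          f ^ N * z.1.coeff i := fun z ↦ by
      rw [← map_pow]
      exact Polynomial.coeff_C_mul _
    dsimp only
    rw [e, e]
    by_cases hi : i ∈ x.1.support ∪ y.1.support
    · obtain ⟨d, hd⟩ := Nat.exists_eq_add_of_le (Finset.le_sup (f := k) hi)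
      rw [show N = k i + d from hd, add_comm, pow_add, mul_assoc, mul_assoc, hk]
    · rw [Finset.mem_union, not_or, Polynomial.notMem_support_iff,
        Polynomial.notMem_support_iff] at hi
      rw [hi.1, hi.2]

theorem AssocGraded.map_isLocalization [Algebra A B] (f : A) [IsLocalization.Away f B]
    (I : Ideal A) (J : Ideal B) (hJ : I.map (algebraMap A B) = J) :
    letI := (AssocGraded.map (algebraMap A B) I J hJ.le).toAlgebra
    IsLocalization.Away (algebraMap A (AssocGraded I) f) (AssocGraded J) := by
  subst hJ
  let := (reesMap (algebraMap A B) I (I.map (algebraMap A B)) le_rfl).toAlgebra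
  let := (AssocGraded.map (algebraMap A B) I (I.map (algebraMap A B)) le_rfl).toAlgebra
  have h1 : IsLocalization.Away (algebraMap A (reesAlgebra I) f)
    (reesAlgebra (I.map (algebraMap A B))) := reesMap_isLocalization (B := B) f I
  let g₁ : reesAlgebra I →+* AssocGraded I := Ideal.Quotient.mk _
  let g₂ : reesAlgebra (I.map (algebraMap A B)) →+* AssocGraded (I.map (algebraMap A B)) :=
    Ideal.Quotient.mk _
  have k₁ : RingHom.ker g₁ = I.map (algebraMap A (reesAlgebra I)) := Ideal.mk_ker
  have k₂ : RingHom.ker g₂ = (I.map (algebraMap A B)).map (algebraMap B _) := Ideal.mk_ker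
  have := IsLocalization.of_surjective
    (Submonoid.powers (algebraMap A (reesAlgebra I) f))
    (reesAlgebra (I.map (algebraMap A B)))
    g₁ Ideal.Quotient.mk_surjective g₂ Ideal.Quotient.mk_surjective
    (RingHom.ext fun _ ↦ rfl) (by
      rw [k₁, k₂, Ideal.map_map, Ideal.map_map]
      refine (congrArg (fun g ↦ Ideal.map g I) (RingHom.ext fun a ↦ ?_)).le
      exact (reesMap_algebraMap _ _ _ le_rfl a).symm)
  rw [Submonoid.map_powers] at this
  exact this

theorem AssocGraded.map_isLocalization' (φ : A →+* B) (f : A)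
    (hf : letI := φ.toAlgebra; IsLocalization.Away f B)
    (I : Ideal A) (J : Ideal B) (hJ : I.map φ = J) :
    letI := (AssocGraded.map φ I J hJ.le).toAlgebra
    IsLocalization.Away (algebraMap A (AssocGraded I) f) (AssocGraded J) := by
  let := φ.toAlgebra
  exact AssocGraded.map_isLocalization (B := B) f I J hJ

end Rings

/-! ### The normal cone -/

section NormalCone

variable {X : Scheme.{0}}

theorem IdealSheaf_map_le (I : X.IdealSheafData) {U V : X.AffineZariskiSite} (h : U ≤ V) :
    (I.ideal V).map
      (X.presheaf.map (homOfLE (Scheme.AffineZariskiSite.toOpens_mono h)).op).hom ≤ I.ideal U :=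
  (I.map_ideal (U := U) (V := V) (Scheme.AffineZariskiSite.toOpens_mono h)).le

/-- The `𝒪_X`-algebra `U ↦ ⨁_{k ≥ 0} I(U)^k / I(U)^{k+1}` on affine opens. -/
def normalConeAlgebra (I : X.IdealSheafData) : X.AffineZariskiSiteᵒᵖ ⥤ CommRingCat.{0} where
  obj U := .of (AssocGraded (I.ideal U.unop))
  map {U V} i := CommRingCat.ofHom <| AssocGraded.map
    (X.presheaf.map (homOfLE (Scheme.AffineZariskiSite.toOpens_mono i.unop.le)).op).hom
    (I.ideal U.unop) (I.ideal V.unop) (IdealSheaf_map_le I i.unop.le)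
  map_id U := by
    refine CommRingCat.hom_ext ((AssocGraded.map_congr _ _ _ _ _ ?_).trans
      (AssocGraded.map_id (I.ideal U.unop) (Ideal.map_id _).le))
    exact congrArg CommRingCat.Hom.hom (X.presheaf.map_id _)
  map_comp {U V W} i j := by
    refine CommRingCat.hom_ext ((AssocGraded.map_congr _ _ _ _ _ ?_).trans
      (AssocGraded.map_comp _ _ (I.ideal U.unop) (I.ideal V.unop) (I.ideal W.unop)
        (IdealSheaf_map_le I i.unop.le) (IdealSheaf_map_le I j.unop.le) ?_))
    · exact congrArg CommRingCat.Hom.hom (X.presheaf.map_comp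
        (homOfLE (Scheme.AffineZariskiSite.toOpens_mono i.unop.le)).op
        (homOfLE (Scheme.AffineZariskiSite.toOpens_mono j.unop.le)).op)
    · rw [← Ideal.map_map]
      exact (Ideal.map_mono (IdealSheaf_map_le I i.unop.le)).trans (IdealSheaf_map_le I j.unop.le)

/-- The structure map from `𝒪_X`. -/
def normalConeAlgebraMap (I : X.IdealSheafData) :
    (Scheme.AffineZariskiSite.toOpensFunctor X).op ⋙ X.presheaf ⟶ normalConeAlgebra I where
  app U := CommRingCat.ofHom (algebraMap Γ(X, U.unop.toOpens) (AssocGraded (I.ideal U.unop)))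
  naturality {_ _} i := CommRingCat.hom_ext <| RingHom.ext fun a ↦
    (AssocGraded.map_algebraMap _ _ _ (IdealSheaf_map_le I i.unop.le) a).symm

theorem coequifibered_normalConeAlgebraMap (I : X.IdealSheafData) :
    (normalConeAlgebraMap I).Coequifibered := by
  refine Scheme.AffineZariskiSite.coequifibered_iff_forall_isLocalizationAway.mpr fun U f ↦ ?_
  exact AssocGraded.map_isLocalization' (X.presheaf.map (homOfLE (X.basicOpen_le f)).op).hom f
    (U.2.isLocalization_basicOpen f) (I.ideal U)
    (I.ideal (U.basicOpen f)) (I.map_ideal_basicOpen U f)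

/-- The normal cone `C_Y(X) = Spec_X ⨁_{k ≥ 0} I^k / I^{k+1}` of the closed subscheme `Y` of `X`
with ideal sheaf `I`: the gluing of the schemes `Spec ⨁_{k ≥ 0} I(U)^k / I(U)^{k+1}`, for `U` an
affine open of `X`. -/
def normalCone (I : X.IdealSheafData) : Scheme.{0} :=
  (Scheme.AffineZariskiSite.relativeGluingData (coequifibered_normalConeAlgebraMap I)).glued

/-- The canonical morphism `C_Y(X) ⟶ X` (it factors through `Y`). -/
def normalConeToBase (I : X.IdealSheafData) : normalCone I ⟶ X :=
  (Scheme.AffineZariskiSite.relativeGluingData (coequifibered_normalConeAlgebraMap I)).toBase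

end NormalCone

/-! ### Blow-ups and the deformation to the normal cone -/

section Deformation

/-- A closed subscheme, given by its ideal sheaf, is an effective Cartier divisor if its ideal is
locally generated by one nonzerodivisor. -/
def IsEffectiveCartier {Z : Scheme.{0}} (I : Z.IdealSheafData) : Prop :=
  ∀ z : Z, ∃ U : Z.affineOpens, z ∈ U.1 ∧
    ∃ a ∈ nonZeroDivisors Γ(Z, U.1), I.ideal U = Ideal.span {a}

/-- `b : B ⟶ Z` is the blow-up of `Z` along the closed subscheme with ideal sheaf `I`: the inverse
image of the subscheme is an effective Cartier divisor, and `b` is universal for this property. -/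
structure IsBlowup {B Z : Scheme.{0}} (I : Z.IdealSheafData) (b : B ⟶ Z) : Prop where
  isEffectiveCartier : IsEffectiveCartier (I.comap b)
  existsUnique_lift : ∀ (W : Scheme.{0}) (g : W ⟶ Z), IsEffectiveCartier (I.comap g) →
    ∃! h : W ⟶ B, h ≫ b = g

/-- The closed immersion `X ≅ X × {0} ⟶ X × 𝔸¹`. -/
def zeroSection (X : Scheme.{0}) : X ⟶ 𝔸(Fin 1; X) :=
  AffineSpace.homOfVector (𝟙 X) 0

/-- `p : D ⟶ X × 𝔸¹` is the deformation to the normal cone of an effective Cartier divisor `Y` of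
`X` with ideal sheaf `I`: in the blow-up `b : B ⟶ X × 𝔸¹` along `Y × {0}`, the scheme `D` is the
open complement of the image of the morphism `X × {0} ⟶ B` lifting `X × {0} ⟶ X × 𝔸¹` (which is
unique, by the universal property of `B`). -/
def IsDeformation {X D : Scheme.{0}} (I : X.IdealSheafData) (p : D ⟶ 𝔸(Fin 1; X)) : Prop :=
  ∃ (B : Scheme.{0}) (b : B ⟶ 𝔸(Fin 1; X)) (σ : X ⟶ B) (j : D ⟶ B),
    IsBlowup (I.map (zeroSection X)) b ∧ σ ≫ b = zeroSection X ∧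
    IsOpenImmersion j ∧ Set.range j = (Set.range σ)ᶜ ∧ j ≫ b = p

/-- The parameter `T` on a scheme over `X × 𝔸¹`. -/
def parameter {X D : Scheme.{0}} (p : D ⟶ 𝔸(Fin 1; X)) : Γ(D, ⊤) :=
  p.appTop (AffineSpace.coord X 0)

/-- The closed subscheme of `D` attached to a closed subscheme `Z` of `X`, given by its ideal sheaf:
the (scheme-theoretic) closure in `D` of the inverse image of `Z × ℂˣ`. -/
def strictTransform {X D : Scheme.{0}} (p : D ⟶ 𝔸(Fin 1; X)) (Z : X.IdealSheafData) :
    D.IdealSheafData :=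
  (Z.comap ((D.basicOpen (parameter p)).ι ≫ p ≫ 𝔸(Fin 1; X) ↘ X)).map
    (D.basicOpen (parameter p)).ι

/-- `D`, with `q : D ⟶ X` and the functions `T₁, …, T_l` on it (that is, with the morphism
`(q, T) : D ⟶ X × 𝔸^l`), is the iterated deformation to the normal cone along `Y₁, …, Y_l`: for
`l = 0` it is `X`; otherwise, let `X'` be the deformation along `Y₁`, with parameter `T₁`; then `D`
is the iterated deformation of `X'` along the strict transforms in `X'` of `Y₂, …, Y_l`. -/
def IsIteratedDeformation : (l : ℕ) → (X : Scheme.{0}) → (Fin l → X.IdealSheafData) →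
    (D : Scheme.{0}) → (D ⟶ X) → (Fin l → Γ(D, ⊤)) → Prop
  | 0, _, _, _, q, _ => IsIso q
  | l + 1, X, Y, D, q, T =>
    ∃ (X' : Scheme.{0}) (p : X' ⟶ 𝔸(Fin 1; X)) (q' : D ⟶ X'),
      IsDeformation (Y 0) p ∧
      q' ≫ p ≫ 𝔸(Fin 1; X) ↘ X = q ∧
      q'.appTop (parameter p) = T 0 ∧
      IsIteratedDeformation l X' (fun i ↦ strictTransform p (Y i.succ)) D q' (fun i ↦ T i.succ)

end Deformation

/-! ### Strict normal crossings, strata of `𝔸^l` -/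

section Strata

/-- `Spec ℂ`. -/
abbrev SpecC : Scheme.{0} := Spec (.of ℂ)

/-- The hyperplane `T_j = 0` of `𝔸^n` over `ℂ`. -/
def coordinateHyperplane (n : ℕ) (j : Fin n) : 𝔸(Fin n; SpecC).IdealSheafData :=
  .ofIdealTop (Ideal.span {AffineSpace.coord SpecC j})

/-- The scheme-theoretic intersection of the `Y_i`, `i ∈ Θ` (it is `X` if `Θ = ∅`). -/
def intersection {X : Scheme.{0}} {l : ℕ} (Y : Fin l → X.IdealSheafData) (Θ : Finset (Fin l)) :
    X.IdealSheafData :=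
  ⨆ i ∈ Θ, Y i

/-- The closed subschemes `Y₁, …, Y_l` of `X` are the irreducible components of a strict normal
crossing divisor: they are integral, the intersections of some of them are smooth over `ℂ`, and
étale locally at each point `x` of `X` there is an isomorphism (over `ℂ`) of `X` with `𝔸^n` under
which the `Y_i` that contain `x` are given by distinct coordinate hyperplanes. -/
structure IsStrictNormalCrossing {X : Scheme.{0}} (s : X ⟶ SpecC) {l : ℕ}
    (Y : Fin l → X.IdealSheafData) : Prop where
  isIntegral : ∀ i, IsIntegral (Y i).subscheme
  smooth : ∀ Θ, Smooth ((intersection Y Θ).subschemeι ≫ s)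
  exists_chart : ∀ x : X, ∃ (U : Scheme.{0}) (n : ℕ) (g : U ⟶ X) (h : U ⟶ 𝔸(Fin n; SpecC))
    (σ : {i // x ∈ (Y i).support} → Fin n),
    Etale g ∧ Etale h ∧ g ≫ s = h ≫ 𝔸(Fin n; SpecC) ↘ SpecC ∧ x ∈ Set.range g ∧
    Function.Injective σ ∧ ∀ i, (Y i.1).comap g = (coordinateHyperplane n (σ i)).comap h

/-- The torus `(ℂˣ)^Θ`, as an open subscheme of `𝔸^Θ`. -/
def torus {l : ℕ} (Θ : Finset (Fin l)) : 𝔸(Θ; SpecC).Opens :=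
  ⨅ i : Θ, 𝔸(Θ; SpecC).basicOpen (AffineSpace.coord SpecC i)

/-- The structure morphism of `(ℂˣ)^Θ`. -/
def torusToSpecC {l : ℕ} (Θ : Finset (Fin l)) : (torus Θ).toScheme ⟶ SpecC :=
  (torus Θ).ι ≫ 𝔸(Θ; SpecC) ↘ SpecC

open Classical in
/-- The immersion `(ℂˣ)^Θ ≅ (ℂˣ)^Θ × {0}^{Θᶜ} ⟶ 𝔸^l`. -/
def stratum {l : ℕ} (Θ : Finset (Fin l)) : (torus Θ).toScheme ⟶ 𝔸(Fin l; SpecC) :=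
  AffineSpace.homOfVector (torusToSpecC Θ) fun i ↦
    if h : i ∈ Θ then (torus Θ).ι.appTop (AffineSpace.coord SpecC ⟨i, h⟩) else 0

/-- The morphism `f = (T₁, …, T_l) : D ⟶ 𝔸^l` over `ℂ`. -/
def familyMap {X D : Scheme.{0}} (s : X ⟶ SpecC) {l : ℕ} (q : D ⟶ X) (T : Fin l → Γ(D, ⊤)) :
    D ⟶ 𝔸(Fin l; SpecC) :=
  AffineSpace.homOfVector (q ≫ s) T

end Strata

end

/-! ### Gluing of morphisms and of sections -/

section Gluing

/-! The iterated deformation represents a functor: a morphism from `W` to it is a morphism `g : W ⟶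
X` together with regular functions `t_1, …, t_l` on `W` such that the ideal of `Y_i` pulls back into
`(t_i)` (`IsUniversal`). Both assertions of the theorem are read off from this.

For a single step, let `Y` be given locally by `a = 0`. The blow-up of `X × 𝔸¹` along `Y × {0}` is
covered by a chart where `T` divides `a` and a chart where `a` divides `T`. The lift of `X × {0}` is
the locus `T/a = 0` in the second chart, which is exactly the complement of the first
(`exists_deformation_chart`). So the deformation is the first chart, and its universal property is
that of the blow-up together with the divisibility of `a` by `T`
(`IsDeformation.existsUnique_lift`).

To iterate, strict transforms must agree with inverse images. This holds because `T` is a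
nonzerodivisor modulo the inverse image of `J` as soon as `I ⊓ J ≤ I * J`, a computation in `⨁
(a)^{-n} T^n` (`mem_map_of_T_mul_mem`, `IsDeformation.strictTransform_eq`). Proper intersection and
the Cartier property are inherited by the next stage, so the universal properties compose
(`IsIteratedDeformation.isUniversal`). The spectrum of the extended Rees algebra has the same
universal property (`isUniversal_Spec`), which gives (1).

For (2), a point of the fibre is locally a homomorphism `ψ` on the extended Rees algebra with
`ψ(T_i)` a unit for `i ∈ Θ` and `0` otherwise. The `ℤ^l`-grading allows rescaling the units to `1`
(`twist`). Specialization at these values maps onto the graded ring of `J = ∑_{i ∉ Θ} I_i`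
(`toAssocGraded`), and `ψ` must kill its kernel: if a sum of `a_n T^n` has zero class, the
coefficients of a given degree `d` add up to an element of `J^{d+1}`, and the inclusion
`prod_inf_iSup_le_of_hasMonomialChart` forces each of them into `J` times its own piece, which `ψ`
kills since `I_i ⊆ (T_i)`. The resulting bijection on points is independent of the affine chart and
glues (`IsUniversal.Corresponds`).

Normal crossings enter only through flatness. A local ring of an étale chart is flat over the ring
of `X` and over `ℂ[x_1, …, x_n]`, and in it the `I_i` become distinct variables or the unit ideal
(`IsStrictNormalCrossing.hasMonomialChart`). Inclusions of ideals are then checked on exponents of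
monomials and descend (`le_of_flat`); so does local principality
(`RingHom.Flat.exists_isLocalization_span_singleton`). -/

theorem exists_hom_of_local {W B : Scheme.{0}} (Q : ∀ N : W.Opens, (N.toScheme ⟶ B) → Prop)
    (res : ∀ {N N' : W.Opens} (h : N' ≤ N) (f : N.toScheme ⟶ B), Q N f → Q N' (W.homOfLE h ≫ f))
    (uniq : ∀ (N : W.Opens) (f f' : N.toScheme ⟶ B), Q N f → Q N f' → f = f')
    (loc : ∀ w : W, ∃ N : W.Opens, w ∈ N ∧ ∃ f, Q N f) :
    ∃ f : W ⟶ B, (∀ N f', Q N f' → N.ι ≫ f = f') ∧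
      ∀ w : W, ∃ N : W.Opens, w ∈ N ∧ Q N (N.ι ≫ f) := by
  choose N hN f hf using loc
  let 𝒰 : W.OpenCover := W.openCoverOfIsOpenCover N
    (top_le_iff.mp fun w _ ↦ TopologicalSpace.Opens.mem_iSup.mpr ⟨w, hN w⟩)
  have key : ∀ (N₁ N₂ : W.Opens) (f₁ : N₁.toScheme ⟶ B) (f₂ : N₂.toScheme ⟶ B), Q N₁ f₁ → Q N₂ f₂ →
      pullback.fst N₁.ι N₂.ι ≫ f₁ = pullback.snd N₁.ι N₂.ι ≫ f₂ := by
    intro N₁ N₂ f₁ f₂ h₁ h₂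
    -- The fibre product of two open subschemes is their intersection, where uniqueness applies.
    have h := uniq (N₁ ⊓ N₂) _ _ (res inf_le_left _ h₁) (res inf_le_right _ h₂)
    have e := (isPullback_opens_inf N₁ N₂)
    rw [← cancel_epi e.isoPullback.hom]
    simpa using h
  suffices ∃ g : W ⟶ B, ∀ N f', Q N f' → N.ι ≫ g = f' by
    obtain ⟨g, hg⟩ := this
    exact ⟨g, hg, fun w ↦ ⟨N w, hN w, by rw [hg _ _ (hf w)]; exact hf w⟩⟩
  refine ⟨𝒰.glueMorphisms f fun x y ↦ key _ _ _ _ (hf x) (hf y), fun N' f' h' ↦ ?_⟩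
  refine Scheme.Cover.hom_ext (𝒰.pullback₁ N'.ι) _ _ fun w ↦ ?_
  have := key N' (N w) f' (f w) h' (hf w)
  change pullback.fst N'.ι (N w).ι ≫ _ = pullback.fst N'.ι (N w).ι ≫ _
  rw [this, pullback.condition_assoc]
  congr 1
  exact 𝒰.ι_glueMorphisms _ _ w

/-- Local lifts that are unique on every open subscheme agree on overlaps and glue, so universal
properties of blow-ups may be verified locally on the test scheme. -/
theorem existsUnique_lift_of_local {W B Z : Scheme.{0}} (g : W ⟶ Z) (b : B ⟶ Z)
    (uniq : ∀ (N : W.Opens) (f f' : N.toScheme ⟶ B), f ≫ b = N.ι ≫ g → f' ≫ b = N.ι ≫ g → f = f')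
    (loc : ∀ w : W, ∃ N : W.Opens, w ∈ N ∧ ∃ f : N.toScheme ⟶ B, f ≫ b = N.ι ≫ g) :
    ∃! f : W ⟶ B, f ≫ b = g := by
  obtain ⟨f, hf, -⟩ := exists_hom_of_local (fun N h ↦ h ≫ b = N.ι ≫ g)
    (fun h f hf ↦ by rw [Category.assoc, hf, Scheme.homOfLE_ι_assoc]) uniq loc
  refine ⟨f, ?_, fun f' hf' ↦ ?_⟩
  · refine Scheme.hom_ext_of_forall _ _ fun w ↦ ?_
    obtain ⟨N, hw, f', hf'⟩ := loc w
    exact ⟨N, hw, by rw [← Category.assoc, hf N f' hf', hf']⟩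
  · refine Scheme.hom_ext_of_forall _ _ fun w ↦ ?_
    obtain ⟨N, hw, f₁, hf₁⟩ := loc w
    exact ⟨N, hw, by rw [hf N f₁ hf₁]; exact uniq _ _ _ (by rw [Category.assoc, hf']) hf₁⟩

theorem appTop_comp_apply {U V W : Scheme.{0}} (f : U ⟶ V) (g : V ⟶ W) (t : Γ(W, ⊤)) :
    (f ≫ g).appTop t = f.appTop (g.appTop t) := by
  rw [Scheme.Hom.comp_appTop, CommRingCat.comp_apply]

theorem ι_appTop_topIso_hom {W : Scheme.{0}} (U : W.Opens) :
    U.ι.appTop ≫ U.topIso.hom = W.presheaf.map (homOfLE le_top).op := by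
  rw [Scheme.Opens.ι_appTop]
  exact (W.presheaf.map_comp _ _).symm

theorem section_eq_of_local {W : Scheme.{0}} {x y : Γ(W, ⊤)}
    (h : ∀ w : W, ∃ (N : Scheme.{0}) (j : N ⟶ W) (_ : IsOpenImmersion j), w ∈ Set.range j ∧
      j.appTop x = j.appTop y) : x = y := by
  choose N j hj hw e using h
  let 𝒰 : W.OpenCover :=
  { I₀ := W, X := N, f := j, mem₀ := by
      rw [Scheme.presieve₀_mem_precoverage_iff]
      exact ⟨fun x ↦ ⟨x, hw x⟩, hj⟩ }
  exact 𝒰.ext_elem x y e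

/-- A global section whose restrictions to all open subschemes are nonzerodivisors. -/
def IsRegularSection {W : Scheme.{0}} (t : Γ(W, ⊤)) : Prop :=
  ∀ (N : Scheme.{0}) (j : N ⟶ W) [IsOpenImmersion j], j.appTop t ∈ nonZeroDivisors Γ(N, ⊤)

variable {W : Scheme.{0}} {t : Γ(W, ⊤)}

theorem IsRegularSection.mem (h : IsRegularSection t) : t ∈ nonZeroDivisors Γ(W, ⊤) := by
  simpa using h W (𝟙 W)

theorem IsRegularSection.comap (h : IsRegularSection t) {N : Scheme.{0}} (j : N ⟶ W)
    [IsOpenImmersion j] : IsRegularSection (j.appTop t) := fun M k _ ↦ by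
  rw [← appTop_comp_apply]
  exact h M (k ≫ j)

theorem isRegularSection_of_local
    (h : ∀ w : W, ∃ (N : Scheme.{0}) (j : N ⟶ W) (_ : IsOpenImmersion j), w ∈ Set.range j ∧
      IsRegularSection (j.appTop t)) : IsRegularSection t := by
  intro M k _
  rw [mem_nonZeroDivisors_iff_right]
  intro x hx
  refine section_eq_of_local fun m ↦ ?_
  obtain ⟨N, j, _, hm, ht⟩ := h (k m)
  obtain ⟨n, hn⟩ := hm
  obtain ⟨p, hp, -⟩ := Scheme.Pullback.exists_preimage_pullback (f := k) (g := j) m n hn.symm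
  refine ⟨pullback k j, pullback.fst k j, inferInstance, ⟨p, hp⟩, ?_⟩
  have h1 := ht _ (pullback.snd k j)
  rw [mem_nonZeroDivisors_iff_right] at h1
  rw [map_zero]
  apply h1
  have h2 : (pullback.snd k j).appTop (j.appTop t) = (pullback.fst k j).appTop (k.appTop t) := by
    rw [← appTop_comp_apply, ← appTop_comp_apply, pullback.condition]
  rw [h2, ← map_mul, hx, map_zero]

/-- Basic opens of `W` form a basis, and localization preserves nonzerodivisors, so on an affine
scheme the condition on all open subschemes reduces to a single ring. -/
theorem isRegularSection_of_isAffine [IsAffine W] (h : t ∈ nonZeroDivisors Γ(W, ⊤)) :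
    IsRegularSection t := by
  intro N j _
  rw [mem_nonZeroDivisors_iff_right]
  intro x hx
  refine section_eq_of_local fun n ↦ ?_
  obtain ⟨_, ⟨_, ⟨r, rfl⟩, rfl⟩, hr, hrN⟩ := (isBasis_basicOpen W).exists_subset_of_mem_open
    (show j n ∈ j.opensRange from ⟨n, rfl⟩) j.opensRange.2
  let k : (W.basicOpen r).toScheme ⟶ N := IsOpenImmersion.lift j (W.basicOpen r).ι (by
    simpa using hrN)
  have hk : k ≫ j = (W.basicOpen r).ι := IsOpenImmersion.lift_fac _ _ _
  refine ⟨_, k, inferInstance, ⟨⟨j n, hr⟩, j.isOpenEmbedding.injective ?_⟩, ?_⟩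
  · exact congrArg (fun f : (W.basicOpen r).toScheme ⟶ W ↦ f ⟨j n, hr⟩) hk
  rw [map_zero]
  have hloc : IsLocalization.Away r Γ(W, W.basicOpen r) :=
    (isAffineOpen_top W).isLocalization_basicOpen r
  have h1 := IsLocalization.map_nonZeroDivisors_le (Submonoid.powers r) Γ(W, W.basicOpen r)
    (Submonoid.mem_map_of_mem _ h)
  have h2 : (W.basicOpen r).ι.appTop t ∈ nonZeroDivisors Γ(W.basicOpen r, ⊤) := by
    refine mem_nonZeroDivisors_of_injective (f := (W.basicOpen r).topIso.hom.hom)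
      (W.basicOpen r).topIso.commRingCatIsoToRingEquiv.injective ?_
    have e : (W.basicOpen r).ι.appTop ≫ (W.basicOpen r).topIso.hom =
        W.presheaf.map (homOfLE le_top).op := ι_appTop_topIso_hom _
    have e' := congrArg (fun f ↦ f.hom t) e
    exact (congrArg (· ∈ nonZeroDivisors _) e').mpr h1
  rw [mem_nonZeroDivisors_iff_right] at h2
  apply h2
  rw [← hk, appTop_comp_apply, ← map_mul, hx, map_zero]

/-- The local quotients are unique because `t` is regular, hence they glue. A section is treated as
a morphism to the affine line, so that `exists_hom_of_local` does the gluing. -/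
theorem IsRegularSection.dvd_of_local (ht : IsRegularSection t) {x : Γ(W, ⊤)}
    (h : ∀ w : W, ∃ (N : Scheme.{0}) (j : N ⟶ W) (_ : IsOpenImmersion j), w ∈ Set.range j ∧
      j.appTop t ∣ j.appTop x) : t ∣ x := by
  let c := AffineSpace.coord W (0 : Fin 1)
  obtain ⟨f, -, hf⟩ := exists_hom_of_local (W := W) (B := 𝔸(Fin 1; W))
    (fun N h ↦ h ≫ 𝔸(Fin 1; W) ↘ W = N.ι ∧ N.ι.appTop t * h.appTop c = N.ι.appTop x)
    (fun {N N'} h f hf ↦ ⟨by rw [Category.assoc, hf.1, Scheme.homOfLE_ι], by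
      rw [← Scheme.homOfLE_ι _ h, appTop_comp_apply, appTop_comp_apply, appTop_comp_apply,
        ← map_mul, hf.2]⟩)
    (fun N f f' hf hf' ↦ AffineSpace.hom_ext (hf.1.trans hf'.1.symm) fun i ↦ by
      obtain rfl := Subsingleton.elim i 0
      exact (mul_cancel_left_mem_nonZeroDivisors (ht N N.ι)).mp (hf.2.trans hf'.2.symm))
    (fun w ↦ by
      obtain ⟨N, j, _, hw, y, hy⟩ := h w
      refine ⟨j.opensRange, hw, AffineSpace.homOfVector j.opensRange.ι
        (fun _ ↦ j.isoOpensRange.inv.appTop y), by simp, ?_⟩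
      have e : j.opensRange.ι = j.isoOpensRange.inv ≫ j := by simp
      rw [e, AffineSpace.homOfVector_appTop_coord, appTop_comp_apply, appTop_comp_apply,
        ← map_mul, hy])
  refine ⟨f.appTop c, section_eq_of_local fun w ↦ ?_⟩
  obtain ⟨N, hw, -, e⟩ := hf w
  refine ⟨N, N.ι, inferInstance, ⟨⟨w, hw⟩, rfl⟩, ?_⟩
  rw [← e, map_mul, appTop_comp_apply]

end Gluing

/-! ### Ideal sheaves -/

section IdealSheaf

open Scheme IdealSheafData

variable {V W Z : Scheme.{0}}

/-- The ideal sheaf generated by a global section. -/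
abbrev principal (t : Γ(W, ⊤)) : W.IdealSheafData := ofIdealTop (Ideal.span {t})

/-- An ideal sheaf generated by global sections can be tested on these sections. Vanishing on the
preimages of all affine opens gives vanishing on `V` by the sheaf property. -/
theorem ofIdealTop_le_ker_iff (K : Ideal Γ(W, ⊤)) (h : V ⟶ W) :
    ofIdealTop K ≤ h.ker ↔ ∀ x ∈ K, h.appTop x = 0 := by
  have nat : ∀ (U : W.Opens) (x : Γ(W, ⊤)), h.app U (W.presheaf.map (homOfLE le_top).op x) =
      V.presheaf.map (homOfLE le_top).op (h.appTop x) := fun U x ↦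
    congrArg (fun f ↦ f.hom x) (h.naturality (homOfLE (le_top (a := U))).op)
  unfold Scheme.Hom.ker
  rw [le_ofIdeals_iff]
  constructor
  · intro H x hx
    refine V.sheaf.eq_of_locally_eq' (fun U : W.affineOpens ↦ h ⁻¹ᵁ U.1) ⊤
      (fun _ ↦ homOfLE le_top) ?_ _ _ fun U ↦ ?_
    · rw [← Scheme.Hom.preimage_iSup, iSup_affineOpens_eq_top]; rfl
    · have h1 := H U (Ideal.mem_map_of_mem _ hx)
      rw [RingHom.mem_ker] at h1
      have h2 := (nat U.1 x).symm.trans h1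
      exact h2.trans (map_zero _).symm
  · intro H U
    rw [ofIdealTop_ideal, Ideal.map_le_iff_le_comap]
    intro x hx
    rw [Ideal.mem_comap, RingHom.mem_ker]
    exact (nat U.1 x).trans (by rw [H x hx, map_zero])

theorem ofIdealTop_le_iff (K : Ideal Γ(W, ⊤)) (J : W.IdealSheafData) :
    ofIdealTop K ≤ J ↔ ∀ x ∈ K, J.subschemeι.appTop x = 0 := by
  rw [← ofIdealTop_le_ker_iff, ker_subschemeι]

theorem ofIdealTop_comap (K : Ideal Γ(W, ⊤)) (f : V ⟶ W) :
    (ofIdealTop K).comap f = ofIdealTop (K.map f.appTop.hom) := by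
  refine eq_of_forall_ge_iff fun J ↦ ?_
  rw [← le_map_iff_comap_le, IdealSheafData.map, ofIdealTop_le_ker_iff, ofIdealTop_le_iff]
  trans K.map f.appTop.hom ≤ RingHom.ker J.subschemeι.appTop.hom
  · rw [Ideal.map_le_iff_le_comap]
    refine forall₂_congr fun x _ ↦ ?_
    rw [Ideal.mem_comap, RingHom.mem_ker, appTop_comp_apply]
  · rfl

theorem principal_comap (t : Γ(W, ⊤)) (f : V ⟶ W) :
    (principal t).comap f = principal (f.appTop t) := by
  rw [ofIdealTop_comap, Ideal.map_span, Set.image_singleton]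

theorem ideal_comap_top [IsAffine V] [IsAffine W] (f : V ⟶ W) (I : W.IdealSheafData) :
    (I.comap f).ideal ⟨⊤, isAffineOpen_top V⟩ =
      (I.ideal ⟨⊤, isAffineOpen_top W⟩).map f.appTop.hom := by
  have h : I = ofIdealTop (I.ideal ⟨⊤, isAffineOpen_top W⟩) :=
    (equivOfIsAffine.symm_apply_apply I).symm
  conv_lhs => rw [h, ofIdealTop_comap]
  simp

theorem ideal_comap_ι_top (U : W.affineOpens) (I : W.IdealSheafData) :
    (I.comap U.1.ι).ideal ⟨⊤, have := U.2; isAffineOpen_top U.1⟩ =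
      (I.ideal U).map U.1.topIso.inv.hom := by
  have h1 : U.1 = U.1.ι ''ᵁ ⊤ := by simp
  have h2 : (I.ideal U).map U.1.topIso.inv.hom = I.ideal ⟨U.1.ι ''ᵁ ⊤, h1 ▸ U.2⟩ :=
    I.map_ideal' (U := ⟨U.1.ι ''ᵁ ⊤, h1 ▸ U.2⟩) (V := U) (eqToHom h1.symm).op
  rw [ideal_comap_of_isOpenImmersion, h2, Scheme.Opens.ι_appIso]
  exact Ideal.comap_id (I.ideal ⟨U.1.ι ''ᵁ ⊤, h1 ▸ U.2⟩)

/-- Restricting `f` to a morphism `U' ⟶ U` reduces this to affine schemes, where `ideal_comap_top`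
applies. -/
theorem ideal_comap (f : V ⟶ W) (I : W.IdealSheafData) (U : W.affineOpens) (U' : V.affineOpens)
    (e : U'.1 ≤ f ⁻¹ᵁ U.1) :
    (I.comap f).ideal U' = (I.ideal U).map (f.appLE U.1 U'.1 e).hom := by
  have := U.2
  have := U'.2
  have h : (I.comap U.1.ι).comap (f.resLE _ _ e) = (I.comap f).comap U'.1.ι := by
    rw [← comap_comp, ← comap_comp, Scheme.Hom.resLE_comp_ι]
  have h1 := congrArg (fun J ↦ (IdealSheafData.ideal J ⟨⊤, isAffineOpen_top U'.1⟩).map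
    U'.1.topIso.hom.hom) h
  dsimp only at h1
  rw [ideal_comap_ι_top, ideal_comap_top, ideal_comap_ι_top, Ideal.map_map, Ideal.map_map,
    Ideal.map_map, ← CommRingCat.hom_comp, ← CommRingCat.hom_comp, ← CommRingCat.hom_comp,
    Iso.inv_hom_id] at h1
  refine ((Ideal.map_id _).symm.trans h1.symm).trans ?_
  refine congrArg (fun g : Γ(W, U.1) ⟶ Γ(V, U'.1) ↦ Ideal.map g.hom (I.ideal U)) ?_
  rw [Scheme.Hom.appTop, Scheme.Hom.resLE_app_top]
  simp only [Category.assoc, Iso.inv_hom_id, Iso.inv_hom_id_assoc, Category.comp_id]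

theorem le_of_local {I J : W.IdealSheafData}
    (h : ∀ w : W, ∃ (N : Scheme.{0}) (j : N ⟶ W) (_ : IsOpenImmersion j), w ∈ Set.range j ∧
      I.comap j ≤ J.comap j) : I ≤ J := by
  choose N j hj hw e using h
  let ι := Σ w : W, (N w).affineOpens
  refine le_of_iSup_eq_top (ι := ι)
    (fun i ↦ ⟨j i.1 ''ᵁ i.2.1, i.2.2.image_of_isOpenImmersion _⟩) ?_ fun i ↦ ?_
  · refine top_le_iff.mp fun w _ ↦ ?_
    obtain ⟨n, hn⟩ := hw w
    obtain ⟨U, hU⟩ := TopologicalSpace.Opens.mem_iSup.mp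
      ((iSup_affineOpens_eq_top (N w)).ge (Set.mem_univ n))
    exact TopologicalSpace.Opens.mem_iSup.mpr ⟨⟨w, U⟩, n, hU, hn⟩
  · have := e i.1 i.2
    rw [ideal_comap_of_isOpenImmersion, ideal_comap_of_isOpenImmersion] at this
    exact (Ideal.comap_le_comap_iff_of_surjective _
      ((j i.1).appIso i.2.1).symm.commRingCatIsoToRingEquiv.surjective _ _).mp this

theorem mul_comap_of_isOpenImmersion (I J : W.IdealSheafData) (j : V ⟶ W) [IsOpenImmersion j] :
    (I * J).comap j = I.comap j * J.comap j := by
  ext U : 2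
  rw [ideal_mul, Pi.mul_apply]
  simp only [ideal_comap_of_isOpenImmersion, ideal_mul, Pi.mul_apply]
  exact (Ideal.map_symm (j.appIso U.1).symm.commRingCatIsoToRingEquiv).symm.trans
    ((Ideal.map_mul _ _ _).trans (congrArg₂ _ (Ideal.map_symm _) (Ideal.map_symm _)))

theorem inf_comap_of_isOpenImmersion (I J : W.IdealSheafData) (j : V ⟶ W) [IsOpenImmersion j] :
    (I ⊓ J).comap j = I.comap j ⊓ J.comap j := by
  ext U : 2
  simp only [ideal_comap_of_isOpenImmersion, ideal_inf, Pi.inf_apply, Ideal.comap_inf]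

theorem eq_principal_of_isAffine [IsAffine W] {I : W.IdealSheafData} {a : Γ(W, ⊤)}
    (h : I.ideal ⟨⊤, isAffineOpen_top W⟩ = Ideal.span {a}) : I = principal a :=
  ext_of_isAffine (by simp [h])

theorem isRegularSection_iff_res (t : Γ(W, ⊤)) : IsRegularSection t ↔ ∀ w : W,
    ∃ U : W.affineOpens, w ∈ U.1 ∧ W.presheaf.map (homOfLE le_top).op t ∈
      nonZeroDivisors Γ(W, U.1) := by
  have key : ∀ U : W.Opens, U.ι.appTop t ∈ nonZeroDivisors Γ(U, ⊤) ↔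
      W.presheaf.map (homOfLE le_top).op t ∈ nonZeroDivisors Γ(W, U) := fun U ↦ by
    have e : W.presheaf.map (homOfLE le_top).op t = U.topIso.hom (U.ι.appTop t) :=
      congrArg (fun f ↦ f.hom t) (ι_appTop_topIso_hom U).symm
    rw [e]
    exact ⟨fun h ↦ mem_nonZeroDivisors_of_injective (f := U.topIso.inv.hom)
        U.topIso.symm.commRingCatIsoToRingEquiv.injective
          (by rwa [← CommRingCat.comp_apply, Iso.hom_inv_id]),
      fun h ↦ mem_nonZeroDivisors_of_injective (f := U.topIso.hom.hom)
        U.topIso.commRingCatIsoToRingEquiv.injective h⟩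
  constructor
  · intro h w
    obtain ⟨U, hU⟩ := TopologicalSpace.Opens.mem_iSup.mp
      ((iSup_affineOpens_eq_top W).ge (Set.mem_univ w))
    exact ⟨U, hU, (key U.1).mp (h U.1 U.1.ι)⟩
  · intro h
    refine isRegularSection_of_local fun w ↦ ?_
    obtain ⟨U, hU, ht⟩ := h w
    have := U.2
    exact ⟨U.1, U.1.ι, inferInstance, ⟨⟨w, hU⟩, rfl⟩, isRegularSection_of_isAffine ((key U.1).mpr ht)⟩

theorem IsEffectiveCartier.exists_regular {I : W.IdealSheafData} (h : IsEffectiveCartier I)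
    (w : W) : ∃ U : W.affineOpens, w ∈ U.1 ∧ ∃ a : Γ(U.1, ⊤), IsRegularSection a ∧
      I.comap U.1.ι = principal a := by
  obtain ⟨U, hU, a, ha, e⟩ := h w
  have := U.2
  refine ⟨U, hU, U.1.topIso.inv a, isRegularSection_of_isAffine ?_, eq_principal_of_isAffine ?_⟩
  · refine mem_nonZeroDivisors_of_injective (f := U.1.topIso.hom.hom)
      U.1.topIso.commRingCatIsoToRingEquiv.injective ?_
    rwa [← CommRingCat.comp_apply, Iso.inv_hom_id]
  · rw [ideal_comap_ι_top, e, Ideal.map_span, Set.image_singleton]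

theorem isEffectiveCartier_of_local {I : W.IdealSheafData}
    (h : ∀ w : W, ∃ (N : Scheme.{0}) (j : N ⟶ W) (_ : IsOpenImmersion j), w ∈ Set.range j ∧
      IsEffectiveCartier (I.comap j)) : IsEffectiveCartier I := by
  intro w
  obtain ⟨N, j, _, ⟨n, rfl⟩, hN⟩ := h w
  obtain ⟨U, hU, a, ha, e⟩ := hN n
  refine ⟨⟨j ''ᵁ U.1, U.2.image_of_isOpenImmersion _⟩, ⟨n, hU, rfl⟩, (j.appIso U.1).inv a, ?_, ?_⟩
  · refine mem_nonZeroDivisors_of_injective (f := (j.appIso U.1).hom.hom)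
      (j.appIso U.1).commRingCatIsoToRingEquiv.injective ?_
    rwa [← CommRingCat.comp_apply, Iso.inv_hom_id]
  · rw [ideal_comap_of_isOpenImmersion] at e
    refine Ideal.comap_injective_of_surjective (j.appIso U.1).inv.hom
      (j.appIso U.1).symm.commRingCatIsoToRingEquiv.surjective ?_
    refine e.trans ?_
    have h1 := Ideal.map_symm (I := Ideal.span {(j.appIso U.1).inv a})
      (j.appIso U.1).symm.commRingCatIsoToRingEquiv
    refine Eq.trans ?_ h1
    rw [Ideal.map_span, Set.image_singleton]
    exact congrArg (fun x ↦ Ideal.span {x})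
      (congrArg (fun f ↦ f.hom a) (j.appIso U.1).inv_hom_id).symm

theorem isEffectiveCartier_principal {t : Γ(W, ⊤)} (ht : IsRegularSection t) :
    IsEffectiveCartier (principal t) := by
  intro w
  obtain ⟨U, hU, h⟩ := (isRegularSection_iff_res t).mp ht w
  refine ⟨U, hU, _, h, ?_⟩
  rw [ofIdealTop_ideal, Ideal.map_span, Set.image_singleton]

theorem IsEffectiveCartier.comap_of_isOpenImmersion {I : W.IdealSheafData}
    (h : IsEffectiveCartier I) (j : V ⟶ W) [IsOpenImmersion j] :
    IsEffectiveCartier (I.comap j) := by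
  refine isEffectiveCartier_of_local fun v ↦ ?_
  obtain ⟨U, hU, a, ha, e⟩ := h.exists_regular (j v)
  refine ⟨(j ⁻¹ᵁ U.1).toScheme, (j ⁻¹ᵁ U.1).ι, inferInstance, ⟨⟨v, hU⟩, rfl⟩, ?_⟩
  rw [← comap_comp, ← morphismRestrict_ι, comap_comp, e, principal_comap]
  exact isEffectiveCartier_principal (ha.comap _)

/-- A local nonzerodivisor generating `(t)` is a multiple of `t`, and a factor of a nonzerodivisor
is a nonzerodivisor. -/
theorem isRegularSection_of_isEffectiveCartier {t : Γ(W, ⊤)}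
    (h : IsEffectiveCartier (principal t)) : IsRegularSection t := by
  rw [isRegularSection_iff_res]
  intro w
  obtain ⟨U, hU, a, ha, e⟩ := h w
  refine ⟨U, hU, ?_⟩
  rw [ofIdealTop_ideal, Ideal.map_span, Set.image_singleton] at e
  obtain ⟨b, hb⟩ := Ideal.mem_span_singleton.mp (e.ge (Ideal.mem_span_singleton_self a))
  rw [hb] at ha
  exact (mul_mem_nonZeroDivisors.mp ha).1

theorem principal_le_principal_of_dvd {s t : Γ(W, ⊤)} (h : t ∣ s) : principal s ≤ principal t := by
  intro U
  simp only [ofIdealTop_ideal]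
  exact Ideal.map_mono (Ideal.span_singleton_le_span_singleton.mpr h)

theorem ideal_principal_top [IsAffine W] (x : Γ(W, ⊤)) :
    (principal x).ideal ⟨⊤, isAffineOpen_top W⟩ = Ideal.span {x} := by
  simp

theorem IsRegularSection.dvd_of_le {s t : Γ(W, ⊤)} (ht : IsRegularSection t)
    (h : principal s ≤ principal t) : t ∣ s := by
  refine ht.dvd_of_local fun w ↦ ?_
  obtain ⟨U, hU⟩ := TopologicalSpace.Opens.mem_iSup.mp
      ((iSup_affineOpens_eq_top W).ge (Set.mem_univ w))
  have := U.2
  refine ⟨U.1, U.1.ι, inferInstance, ⟨⟨w, hU⟩, rfl⟩, ?_⟩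
  have h1 := comap_mono U.1.ι h
  simp only [principal_comap] at h1
  have h2 := h1 ⟨⊤, isAffineOpen_top U.1⟩
  rw [ideal_principal_top, ideal_principal_top, Ideal.span_singleton_le_span_singleton] at h2
  exact h2

end IdealSheaf

/-! ### Charts of the blow-up of an ideal with two generators -/

section ChartRing

open Polynomial

variable {R G : Type} [CommRing R] [CommRing G]

/-- The evaluation of polynomials at the fraction `g / f` of `R[1/f]`. -/
noncomputable def fracEval (f g : R) : R[X] →+* Localization.Away f :=
  eval₂RingHom (algebraMap R _) (algebraMap R _ g * IsLocalization.Away.invSelf f)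

/-- The ideal of polynomials vanishing at the fraction `g / f` of `R[1/f]`. -/
noncomputable abbrev chartIdeal (f g : R) : Ideal R[X] := RingHom.ker (fracEval f g)

/-- The subring `R[g/f]` of `R[1/f]`, as a quotient of a polynomial ring. -/
abbrev ChartRing (f g : R) : Type := R[X] ⧸ chartIdeal f g

/-- The fraction `g / f`, as an element of `R[g/f]`. -/
noncomputable def ChartRing.frac (f g : R) : ChartRing f g := Ideal.Quotient.mk _ X

theorem ChartRing.mul_frac (f g : R) :
    algebraMap R (ChartRing f g) f * frac f g = algebraMap R (ChartRing f g) g := by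
  refine (Ideal.Quotient.eq (x := C f * X) (y := C g)).mpr ?_
  have h := IsLocalization.Away.mul_invSelf (S := Localization.Away f) f
  rw [chartIdeal, RingHom.mem_ker, map_sub, map_mul]
  simp only [fracEval, coe_eval₂RingHom, eval₂_C, eval₂_X]
  linear_combination algebraMap R (Localization.Away f) g * h

theorem ChartRing.mem_nonZeroDivisors (f g : R) :
    algebraMap R (ChartRing f g) f ∈ nonZeroDivisors (ChartRing f g) := by
  refine mem_nonZeroDivisors_of_injective (f := RingHom.kerLift (fracEval f g))
    (RingHom.kerLift_injective _) ?_
  have : RingHom.kerLift (fracEval f g) (algebraMap R (ChartRing f g) f) =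
      algebraMap R (Localization.Away f) f :=
    (RingHom.kerLift_mk _ (C f)).trans (eval₂_C _ _)
  rw [this]
  exact (IsLocalization.Away.algebraMap_isUnit f).mem_nonZeroDivisors

theorem ChartRing.exists_eq_add (f g : R) (c : ChartRing f g) :
    ∃ (r : R) (d : ChartRing f g), c = algebraMap R _ r + frac f g * d := by
  obtain ⟨p, rfl⟩ := Ideal.Quotient.mk_surjective c
  refine ⟨p.coeff 0, Ideal.Quotient.mk _ p.divX, ?_⟩
  conv_lhs => rw [← p.divX_mul_X_add, map_add, map_mul]
  rw [add_comm, mul_comm]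
  rfl

/-- Since `f` times the fraction equals `g`, the value at the fraction is forced once the image of
`f` can be cancelled. -/
theorem ChartRing.hom_ext {f g : R} {ψ ψ' : ChartRing f g →+* G}
    (h : ψ.comp (algebraMap R _) = ψ'.comp (algebraMap R _))
    (hf : ψ (algebraMap R _ f) ∈ nonZeroDivisors G) : ψ = ψ' := by
  refine Ideal.Quotient.ringHom_ext (Polynomial.ringHom_ext (fun a ↦ DFunLike.congr_fun h a) ?_)
  have hh : ∀ a, ψ (algebraMap R _ a) = ψ' (algebraMap R _ a) := fun a ↦ DFunLike.congr_fun h a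
  refine (mul_cancel_left_mem_nonZeroDivisors hf).mp ?_
  change _ * ψ (frac f g) = _ * ψ' (frac f g)
  rw [← map_mul, mul_frac, hh, hh, ← map_mul, mul_frac]

/-- The fraction goes to the quotient `y` of `φ g` by `φ f`. A polynomial vanishing at `g / f` also
vanishes at `y`: regularity embeds `G` in its localization at `φ f`, where `y` is the image of `g /
f`. -/
theorem ChartRing.exists_hom (f g : R) (φ : R →+* G) (hf : φ f ∈ nonZeroDivisors G)
    (h : φ f ∣ φ g) : ∃ ψ : ChartRing f g →+* G, ψ.comp (algebraMap R _) = φ := by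
  obtain ⟨y, hy⟩ := h
  refine ⟨Ideal.Quotient.lift _ (eval₂RingHom φ y) fun p hp ↦ ?_, RingHom.ext fun a ↦ ?_⟩
  · rw [chartIdeal, RingHom.mem_ker] at hp
    let G' := Localization.Away (φ f)
    have inj : Function.Injective (algebraMap G G') :=
      IsLocalization.injective G' (Submonoid.powers_le.mpr hf)
    have hu : IsUnit ((algebraMap G G').comp φ f) := IsLocalization.Away.algebraMap_isUnit (φ f)
    let μ : Localization.Away f →+* G' := IsLocalization.Away.lift f hu
    apply inj
    rw [map_zero, ← map_zero μ, ← hp]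
    have hμ : μ.comp (algebraMap R (Localization.Away f)) = (algebraMap G G').comp φ :=
      IsLocalization.Away.lift_comp f hu
    have hμ' : ∀ r, μ (algebraMap R _ r) = algebraMap G G' (φ r) := fun r ↦
      DFunLike.congr_fun hμ r
    have e : μ (algebraMap R _ g * IsLocalization.Away.invSelf f) = algebraMap G G' y := by
      refine hu.mul_left_cancel ?_
      have h1 := congrArg μ (IsLocalization.Away.mul_invSelf (S := Localization.Away f) f)
      rw [map_mul, map_one, hμ'] at h1
      rw [map_mul, hμ', hy, map_mul, RingHom.comp_apply]
      linear_combination algebraMap G G' (φ f) * algebraMap G G' y * h1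
    change algebraMap G G' (eval₂ φ y p) = μ (eval₂ (algebraMap R _) _ p)
    rw [hom_eval₂, hom_eval₂, e, hμ]
  · exact eval₂_C _ _

theorem ChartRing.frac_swap_mul {f g : R} (φ : ChartRing f g →+* G) (ψ : ChartRing g f →+* G)
    (h : φ.comp (algebraMap R _) = ψ.comp (algebraMap R _))
    (hf : φ (algebraMap R _ f) ∈ nonZeroDivisors G) : φ (frac f g) * ψ (frac g f) = 1 := by
  refine (mul_cancel_left_mem_nonZeroDivisors hf).mp ?_
  have hh : ∀ a, φ (algebraMap R _ a) = ψ (algebraMap R _ a) := fun a ↦ DFunLike.congr_fun h a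
  rw [← mul_assoc, ← map_mul, mul_frac, hh, ← map_mul, mul_frac, hh, mul_one]

/-- The overlap of the two charts. -/
abbrev ChartOverlap (f g : R) : Type := Localization.Away (ChartRing.frac f g)

theorem ChartOverlap.mem_left (f g : R) :
    algebraMap (ChartRing f g) (ChartOverlap f g) (algebraMap R _ f) ∈
      nonZeroDivisors (ChartOverlap f g) :=
  IsLocalization.map_nonZeroDivisors_le (Submonoid.powers (ChartRing.frac f g)) _
    (Submonoid.mem_map_of_mem _ (ChartRing.mem_nonZeroDivisors f g))

theorem ChartOverlap.mem_right (f g : R) :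
    algebraMap (ChartRing f g) (ChartOverlap f g) (algebraMap R _ g) ∈
      nonZeroDivisors (ChartOverlap f g) := by
  rw [← ChartRing.mul_frac, map_mul]
  exact mul_mem (mem_left f g) (IsLocalization.Away.algebraMap_isUnit _).mem_nonZeroDivisors

theorem ChartOverlap.exists_swap (f g : R) : ∃ ψ : ChartRing g f →+* ChartOverlap f g,
    ψ.comp (algebraMap R _) =
      (algebraMap (ChartRing f g) (ChartOverlap f g)).comp (algebraMap R _) := by
  refine ChartRing.exists_hom g f _ (mem_right f g) ?_
  rw [RingHom.comp_apply, RingHom.comp_apply, ← ChartRing.mul_frac, map_mul]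
  exact (IsLocalization.Away.algebraMap_isUnit (ChartRing.frac f g)).mul_right_dvd.mpr dvd_rfl

/-- The inclusion of the other chart into the overlap. -/
noncomputable def ChartOverlap.swap (f g : R) : ChartRing g f →+* ChartOverlap f g := (exists_swap f g).choose

theorem ChartOverlap.swap_comp (f g : R) : (swap f g).comp (algebraMap R _) =
    (algebraMap (ChartRing f g) (ChartOverlap f g)).comp (algebraMap R _) :=
  (exists_swap f g).choose_spec

/-- Both overlaps are `R[g/f, f/g]`. On either of them the two fractions are inverse to each other,
so each `swap` extends to the localization, and the two extensions are mutually inverse by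
`ChartRing.hom_ext`. -/
theorem ChartOverlap.isLocalization_swap (f g : R) : letI := (swap f g).toAlgebra
    IsLocalization.Away (ChartRing.frac g f) (ChartOverlap f g) := by
  have key : ∀ f g : R, ∃ α : ChartOverlap f g →+* ChartOverlap g f,
      α.comp (algebraMap (ChartRing f g) (ChartOverlap f g)) = swap g f := fun f g ↦ by
    have hu : IsUnit (swap g f (ChartRing.frac f g)) := .of_mul_eq_one _ <|
      ChartRing.frac_swap_mul (swap g f) (algebraMap (ChartRing g f) (ChartOverlap g f))
      (swap_comp g f) (by
        have := DFunLike.congr_fun (swap_comp g f) f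
        rw [RingHom.comp_apply] at this
        rw [this]
        exact mem_right g f)
    exact ⟨IsLocalization.Away.lift _ hu, IsLocalization.Away.lift_comp _ hu⟩
  have key2 : ∀ (f g : R) (α : ChartOverlap f g →+* ChartOverlap g f)
      (β : ChartOverlap g f →+* ChartOverlap f g),
      α.comp (algebraMap (ChartRing f g) (ChartOverlap f g)) = swap g f →
      β.comp (algebraMap (ChartRing g f) (ChartOverlap g f)) = swap f g →
      β.comp α = RingHom.id _ := fun f g α β hα hβ ↦ by
    refine IsLocalization.ringHom_ext (Submonoid.powers (ChartRing.frac f g)) ?_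
    have e : ((β.comp α).comp (algebraMap (ChartRing f g) (ChartOverlap f g))).comp
        (algebraMap R _) =
        (algebraMap (ChartRing f g) (ChartOverlap f g)).comp (algebraMap R _) := by
      refine RingHom.ext fun r ↦ ?_
      have h1 := DFunLike.congr_fun hα (algebraMap R _ r)
      have h2 := DFunLike.congr_fun hβ (algebraMap R _ r)
      have h3 := DFunLike.congr_fun (swap_comp g f) r
      have h4 := DFunLike.congr_fun (swap_comp f g) r
      simp only [RingHom.comp_apply] at h1 h2 h3 h4 ⊢
      rw [h1, h3, h2, h4]
    refine ChartRing.hom_ext e ?_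
    have := DFunLike.congr_fun e f
    rw [RingHom.comp_apply] at this
    rw [this]
    exact mem_left f g
  obtain ⟨α, hα⟩ := key f g
  obtain ⟨β, hβ⟩ := key g f
  let e : ChartOverlap g f ≃+* ChartOverlap f g :=
    RingEquiv.ofRingHom β α (key2 f g α β hα hβ) (key2 g f β α hβ hα)
  let := (swap f g).toAlgebra
  exact IsLocalization.isLocalization_of_algEquiv (Submonoid.powers (ChartRing.frac g f))
    (AlgEquiv.ofRingEquiv (f := e) fun x ↦ DFunLike.congr_fun hβ x)

end ChartRing

/-! ### The extended Rees algebra -/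

section ExtendedRees

namespace extendedRees

variable {A G : Type} [CommRing A] [CommRing G] {l : ℕ} (I : Fin l → Ideal A)

/-- The coefficient ideal of `T ^ n` in the extended Rees algebra. -/
noncomputable abbrev piece (n : Fin l → ℤ) : Ideal A := ∏ i, I i ^ negExp (n i)

variable {I}

theorem mul_mem_piece {n m : Fin l → ℤ} {a b : A} (ha : a ∈ piece I n) (hb : b ∈ piece I m) :
    a * b ∈ piece I (n + m) := by
  refine (?_ : piece I n * piece I m ≤ _) (Ideal.mul_mem_mul ha hb)
  rw [← Finset.prod_mul_distrib]
  refine Finset.prod_le_prod' fun i _ ↦ ?_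
  rw [← pow_add]
  refine Ideal.pow_le_pow_right ?_
  simp only [negExp, Pi.add_apply]
  lia

theorem piece_eq_top {n : Fin l → ℤ} (h : 0 ≤ n) : piece I n = ⊤ := by
  refine (Finset.prod_eq_one (M := Ideal A) fun i _ ↦ ?_).trans Ideal.one_eq_top
  rw [negExp, Int.toNat_eq_zero.mpr (neg_nonpos.mpr (h i)), pow_zero]

theorem mem_piece {n : Fin l → ℤ} (h : 0 ≤ n) (a : A) : a ∈ piece I n := by
  rw [piece_eq_top h]; trivial

/-- The monomial `a T ^ n`. -/
noncomputable def single (n : Fin l → ℤ) (a : piece I n) : extendedRees I :=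
  ⟨AddMonoidAlgebra.single n a, fun m ↦ by
    classical
    rw [AddMonoidAlgebra.coeff_single, Finsupp.single_apply]
    split_ifs with h
    · subst h; exact a.2
    · exact Ideal.zero_mem _⟩

theorem single_add (n : Fin l → ℤ) (a b : piece I n) : single n (a + b) = single n a + single n b :=
  Subtype.ext (AddMonoidAlgebra.single_add n a.1 b.1)

theorem single_zero (n : Fin l → ℤ) : single n (0 : piece I n) = 0 :=
  Subtype.ext (AddMonoidAlgebra.single_zero n)

theorem single_mul_single {n m : Fin l → ℤ} (a : piece I n) (b : piece I m) :
    single n a * single m b = single (n + m) ⟨a.1 * b.1, mul_mem_piece a.2 b.2⟩ :=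
  Subtype.ext (AddMonoidAlgebra.single_mul_single ..)

theorem algebraMap_eq_single (a : A) :
    algebraMap A (extendedRees I) a = single 0 ⟨a, mem_piece le_rfl a⟩ := rfl

theorem algebraMap_mul_single (x : A) {n : Fin l → ℤ} (y : piece I n) :
    algebraMap A (extendedRees I) x * single n y =
      single n ⟨x * y.1, Ideal.mul_mem_left _ x y.2⟩ := by
  rw [algebraMap_eq_single, single_mul_single]
  refine Subtype.ext ?_
  simp only [single, zero_add]

theorem T_eq_single (i : Fin l) :
    T I i = single (Pi.single i 1) ⟨1, mem_piece (by simp) 1⟩ :=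
  rfl

theorem prod_T_pow (k : Fin l → ℕ) :
    ∏ i, T I i ^ k i = single (fun i ↦ (k i : ℤ)) ⟨1, mem_piece (fun _ ↦ Int.natCast_nonneg _) 1⟩ := by
  classical
  have h1 : ∀ i (m : ℕ), T I i ^ m = single (Pi.single i (m : ℤ)) ⟨1, mem_piece (by simp) 1⟩ := by
    intro i m
    induction m with
    | zero => exact Subtype.ext (by simp [single]; rfl)
    | succ m ih =>
      rw [pow_succ, ih, T_eq_single, single_mul_single]
      refine Subtype.ext ?_
      simp only [single, mul_one, ← Pi.single_add, Nat.cast_succ]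
  have h2 : ∀ s : Finset (Fin l), ((∏ i ∈ s, T I i ^ k i : extendedRees I) : AddMonoidAlgebra A _) =
      AddMonoidAlgebra.single (∑ i ∈ s, Pi.single i (k i : ℤ)) 1 := fun s ↦ by
    induction s using Finset.induction_on with
    | empty => rfl
    | insert i s hi ih =>
      rw [Finset.prod_insert hi, Finset.sum_insert hi, h1]
      refine (congrArg (_ * ·) ih).trans ?_
      simp only [single]
      rw [AddMonoidAlgebra.single_mul_single, mul_one]
  refine Subtype.ext ((h2 _).trans ?_)
  rw [Finset.univ_sum_single]
  rfl

theorem induction {P : extendedRees I → Prop} (zero : P 0) (add : ∀ p q, P p → P q → P (p + q))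
    (hP : ∀ n a, P (single n a)) (p : extendedRees I) : P p := by
  classical
  have h : ∀ s : Finset (Fin l → ℤ), P (∑ n ∈ s, single n ⟨p.1.coeff n, p.2 n⟩) := fun s ↦ by
    induction s using Finset.induction_on with
    | empty => exact zero
    | insert n s hn ih => rw [Finset.sum_insert hn]; exact add _ _ (hP _ _) ih
  convert h p.1.coeff.support
  refine Subtype.ext ?_
  rw [AddSubmonoidClass.coe_finsetSum]
  exact (AddMonoidAlgebra.sum_coeff_single p.1).symm

theorem addHom_ext {M : Type} [AddMonoid M] {f g : extendedRees I →+ M}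
    (h : ∀ n a, f (single n a) = g (single n a)) : f = g :=
  AddMonoidHom.ext fun p ↦ induction (P := fun p ↦ f p = g p) (by simp)
    (fun p q hp hq ↦ by rw [map_add, map_add, hp, hq]) h p

/-- An additive map out of the extended Rees algebra. -/
noncomputable def liftAddHom (F : ∀ n, piece I n →+ G) : extendedRees I →+ G where
  toFun p := ∑ᶠ n, F n ⟨p.1.coeff n, p.2 n⟩
  map_zero' := finsum_eq_zero_of_forall_eq_zero fun n ↦ (F n).map_zero
  map_add' p q := by
    have hfin : ∀ p : extendedRees I, (Function.support fun n ↦ F n ⟨p.1.coeff n, p.2 n⟩).Finite :=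
      fun p ↦ p.1.coeff.hasFiniteSupport.subset fun n hn h ↦ hn <| by
        simp only [h]; exact (F n).map_zero
    rw [← finsum_add_distrib (hfin p) (hfin q)]
    exact finsum_congr fun n ↦ (F n).map_add ⟨p.1.coeff n, p.2 n⟩ ⟨q.1.coeff n, q.2 n⟩

theorem liftAddHom_single (F : ∀ n, piece I n →+ G) (n : Fin l → ℤ) (a : piece I n) :
    liftAddHom F (single n a) = F n a := by
  refine (finsum_eq_single _ n fun m hm ↦ ?_).trans (congrArg (F n) (Subtype.ext ?_))
  · convert (F m).map_zero
    exact Finsupp.single_eq_of_ne hm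
  · exact Finsupp.single_eq_same

/-- A ring homomorphism out of the extended Rees algebra. -/
noncomputable def liftRingHom (F : ∀ n, piece I n →+ G) (one : F 0 ⟨1, mem_piece le_rfl 1⟩ = 1)
    (mul : ∀ n m (a : piece I n) (b : piece I m),
      F (n + m) ⟨a.1 * b.1, mul_mem_piece a.2 b.2⟩ = F n a * F m b) : extendedRees I →+* G :=
  { liftAddHom F with
    map_one' := (liftAddHom_single F 0 ⟨1, mem_piece le_rfl 1⟩).trans one
    map_mul' := by
      have : (AddMonoidHom.mul.compr₂ (liftAddHom F)) =
          (AddMonoidHom.mul.compl₂ (liftAddHom F)).comp (liftAddHom F) := by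
        refine addHom_ext fun n a ↦ addHom_ext fun m b ↦ ?_
        change liftAddHom F (single n a * single m b) =
          liftAddHom F (single n a) * liftAddHom F (single m b)
        rw [single_mul_single, liftAddHom_single, liftAddHom_single, liftAddHom_single, mul]
      exact fun p q ↦ DFunLike.congr_fun (DFunLike.congr_fun this p) q }

theorem liftRingHom_single (F : ∀ n, piece I n →+ G) (one mul) (n : Fin l → ℤ) (a : piece I n) :
    liftRingHom F one mul (single n a) = F n a :=
  liftAddHom_single F n a

/-- Clearing the negative exponents expresses every monomial through coefficients and variables. A
homomorphism making the `T_i` regular is therefore determined by its values on these. -/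
theorem prod_T_pow_mul_single (n : Fin l → ℤ) (a : piece I n) :
    (∏ i, T I i ^ negExp (n i)) * single n a =
      algebraMap A _ a * ∏ i, T I i ^ (n i).toNat := by
  rw [prod_T_pow, prod_T_pow, algebraMap_eq_single, single_mul_single, single_mul_single]
  refine Subtype.ext ?_
  simp only [single]
  congr 1
  · funext i; simp only [Pi.add_apply, negExp, Pi.zero_apply]; lia
  · rw [mul_comm]

theorem hom_ext {ψ ψ' : extendedRees I →+* G}
    (h : ψ.comp (algebraMap A _) = ψ'.comp (algebraMap A _))
    (hT : ∀ i, ψ (T I i) = ψ' (T I i)) (hreg : ∀ i, ψ (T I i) ∈ nonZeroDivisors G) : ψ = ψ' := by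
  refine RingHom.ext fun p ↦ ?_
  refine induction (P := fun p ↦ ψ p = ψ' p) (by simp)
    (fun p q hp hq ↦ by rw [map_add, map_add, hp, hq]) (fun n a ↦ ?_) p
  have hu : ψ (∏ i, T I i ^ negExp (n i)) ∈ nonZeroDivisors G := by
    rw [map_prod]
    exact prod_mem fun i _ ↦ by rw [map_pow]; exact pow_mem (hreg i) _
  have hP : ∀ k : Fin l → ℕ, ψ (∏ i, T I i ^ k i) = ψ' (∏ i, T I i ^ k i) := fun k ↦ by
    rw [map_prod, map_prod]
    exact Finset.prod_congr rfl fun i _ ↦ by rw [map_pow, map_pow, hT]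
  refine (mul_cancel_left_mem_nonZeroDivisors hu).mp ?_
  rw [← map_mul, prod_T_pow_mul_single, map_mul, hP, hP, ← map_mul ψ', prod_T_pow_mul_single,
    map_mul ψ']
  exact congrArg (· * _) (DFunLike.congr_fun h a.1)

/-- By hypothesis `φ` maps the coefficients of `T ^ n` to multiples of the product of the `t_i`
raised to the negative parts of `n`. The quotient `c` is unique by regularity, and this uniqueness
makes the assignment additive and multiplicative. -/
theorem exists_hom (φ : A →+* G) (t : Fin l → G) (ht : ∀ i, t i ∈ nonZeroDivisors G)
    (h : ∀ i, (I i).map φ ≤ Ideal.span {t i}) :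
    ∃ ψ : extendedRees I →+* G, ψ.comp (algebraMap A _) = φ ∧ ∀ i, ψ (T I i) = t i := by
  have hu : ∀ k : Fin l → ℕ, ∏ i, t i ^ k i ∈ nonZeroDivisors G := fun k ↦
    prod_mem fun i _ ↦ pow_mem (ht i) _
  have hdvd : ∀ n (a : piece I n), ∃ c, φ a.1 = (∏ i, t i ^ negExp (n i)) * c := by
    intro n a
    refine Ideal.mem_span_singleton.mp ((?_ : (piece I n).map φ ≤ _) (Ideal.mem_map_of_mem φ a.2))
    rw [piece, ← Ideal.mapHom_apply, map_prod, ← Ideal.prod_span_singleton]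
    refine Finset.prod_le_prod' fun i _ ↦ ?_
    rw [Ideal.mapHom_apply, Ideal.map_pow, ← Ideal.span_singleton_pow]
    exact Ideal.pow_right_mono (h i) _
  choose c hc using hdvd
  let F : ∀ n, piece I n →+ G := fun n ↦
  { toFun a := c n a * ∏ i, t i ^ (n i).toNat
    map_zero' := by
      have : c n 0 = 0 := by
        refine (mul_cancel_left_mem_nonZeroDivisors (hu _)).mp ((hc n 0).symm.trans ?_)
        rw [mul_zero]; exact map_zero φ
      rw [this, zero_mul]
    map_add' a b := by
      have : c n (a + b) = c n a + c n b := by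
        refine (mul_cancel_left_mem_nonZeroDivisors (hu _)).mp ((hc n _).symm.trans ?_)
        rw [mul_add, ← hc, ← hc]
        exact map_add φ _ _
      rw [this, add_mul] }
  have key : ∀ n (a : piece I n), (∏ i, t i ^ negExp (n i)) * F n a =
      φ a.1 * ∏ i, t i ^ (n i).toNat := fun n a ↦ by
    rw [hc n a, mul_assoc]; rfl
  have hF0 : ∀ n (hn : 0 ≤ n) (a : A), F n ⟨a, mem_piece hn a⟩ = φ a * ∏ i, t i ^ (n i).toNat :=
    fun n hn a ↦ by
      rw [← key n ⟨a, mem_piece hn a⟩]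
      have : ∀ i, negExp (n i) = 0 := fun i ↦ Int.toNat_eq_zero.mpr (neg_nonpos.mpr (hn i))
      simp [this]
  refine ⟨liftRingHom F ?_ ?_, RingHom.ext fun a ↦ ?_, fun i ↦ ?_⟩
  · rw [hF0 0 le_rfl 1]; simp
  · intro n m a b
    refine (mul_cancel_left_mem_nonZeroDivisors (hu fun i ↦ negExp ((n + m) i))).mp ?_
    refine (mul_cancel_left_mem_nonZeroDivisors (hu fun i ↦ negExp (n i) + negExp (m i))).mp ?_
    rw [key]
    have e1 : ∏ i, t i ^ (negExp (n i) + negExp (m i)) =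
        (∏ i, t i ^ negExp (n i)) * ∏ i, t i ^ negExp (m i) := by
      rw [← Finset.prod_mul_distrib]; exact Finset.prod_congr rfl fun i _ ↦ pow_add _ _ _
    have e2 : (∏ i, t i ^ negExp ((n + m) i)) * (∏ i, t i ^ (n i).toNat) * ∏ i, t i ^ (m i).toNat =
        (∏ i, t i ^ negExp (n i)) * (∏ i, t i ^ negExp (m i)) * ∏ i, t i ^ ((n + m) i).toNat := by
      rw [← Finset.prod_mul_distrib, ← Finset.prod_mul_distrib, ← Finset.prod_mul_distrib,
        ← Finset.prod_mul_distrib]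
      refine Finset.prod_congr rfl fun i _ ↦ ?_
      rw [← pow_add, ← pow_add, ← pow_add, ← pow_add]
      congr 1
      simp only [negExp, Pi.add_apply]
      lia
    have k1 := key n a
    have k2 := key m b
    rw [e1, map_mul]
    linear_combination (-φ a.1 * φ b.1) * e2 - (∏ i, t i ^ negExp ((n + m) i)) *
      ((∏ i, t i ^ negExp (m i)) * F m b) * k1 - (∏ i, t i ^ negExp ((n + m) i)) *
        (φ a.1 * ∏ i, t i ^ (n i).toNat) * k2
  · rw [RingHom.comp_apply, algebraMap_eq_single, liftRingHom_single, hF0 0 le_rfl]; simp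
  · classical
    rw [T_eq_single, liftRingHom_single, hF0 _ (by simp), map_one, one_mul,
      Finset.prod_eq_single i]
    · simp
    · intro j _ hj; simp [hj]
    · simp

theorem algebraMap_mul_coeff (a : A) (p : extendedRees I) (n : Fin l → ℤ) :
    (algebraMap A (extendedRees I) a * p).1.coeff n = a * p.1.coeff n :=
  (AddMonoidAlgebra.coeff_single_mul_apply _ _ _ _).trans (by simp)

theorem T_mul_coeff (i : Fin l) (p : extendedRees I) (n : Fin l → ℤ) :
    (T I i * p).1.coeff n = p.1.coeff (n - Pi.single i 1) :=
  (AddMonoidAlgebra.coeff_single_mul_apply _ _ _ _).trans (by rw [one_mul, sub_eq_neg_add])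

theorem algebraMap_mem_nonZeroDivisors {b : A} (hb : b ∈ nonZeroDivisors A) :
    algebraMap A (extendedRees I) b ∈ nonZeroDivisors (extendedRees I) := by
  rw [mem_nonZeroDivisors_iff_right]
  refine fun p hp ↦ Subtype.ext (AddMonoidAlgebra.coeff_injective (Finsupp.ext fun n ↦ ?_))
  refine (mem_nonZeroDivisors_iff_right.mp hb) _ ?_
  rw [mul_comm, ← algebraMap_mul_coeff, mul_comm, hp]
  rfl

theorem T_mem_nonZeroDivisors (i : Fin l) : T I i ∈ nonZeroDivisors (extendedRees I) := by
  rw [mem_nonZeroDivisors_iff_right]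
  refine fun p hp ↦ Subtype.ext (AddMonoidAlgebra.coeff_injective (Finsupp.ext fun n ↦ ?_))
  have := T_mul_coeff i p (n + Pi.single i 1)
  rw [add_sub_cancel_right, mul_comm, hp] at this
  exact this.symm

/-- An ideal extended from `A` is generated in degree zero, hence homogeneous, and membership is a
condition on coefficients. -/
theorem mem_map_iff (J : Ideal A) (p : extendedRees I) :
    p ∈ J.map (algebraMap A (extendedRees I)) ↔ ∀ n, p.1.coeff n ∈ J * piece I n := by
  constructor
  · intro hp
    induction hp using Submodule.span_induction with
    | mem x hx =>
      obtain ⟨a, ha, rfl⟩ := hx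
      intro n
      rw [← mul_one (algebraMap A _ a), algebraMap_mul_coeff]
      exact Ideal.mul_mem_mul ha ((1 : extendedRees I).2 n)
    | zero => exact fun n ↦ zero_mem _
    | add x y _ _ hx hy => exact fun n ↦ add_mem (hx n) (hy n)
    | smul q x _ hx =>
      intro n
      classical
      refine (congrArg (· ∈ J * piece I n) (AddMonoidAlgebra.coeff_mul q.1 x.1 n)).mpr ?_
      refine Ideal.sum_mem _ fun a _ ↦ Ideal.sum_mem _ fun b _ ↦ ?_
      dsimp only
      split_ifs with h
      · subst h
        have h1 : piece I a * (J * piece I b) ≤ J * piece I (a + b) := by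
          rw [mul_left_comm]
          exact Ideal.mul_mono le_rfl (Ideal.mul_le.mpr fun _ hr _ hs ↦ mul_mem_piece hr hs)
        exact h1 (Ideal.mul_mem_mul (q.2 a) (hx b))
      · exact zero_mem _
  · intro h
    have key : ∀ n (a : piece I n), a.1 ∈ J * piece I n →
        single n a ∈ J.map (algebraMap A (extendedRees I)) := by
      rintro n ⟨a, ha'⟩ ha
      dsimp only at ha
      suffices ∃ h : a ∈ piece I n, single n ⟨a, h⟩ ∈ J.map (algebraMap A (extendedRees I)) from
        this.choose_spec
      refine Submodule.mul_induction_on (C := fun a ↦ ∃ h : a ∈ piece I n,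
        single n ⟨a, h⟩ ∈ J.map (algebraMap A (extendedRees I))) ha (fun x hx y hy ↦ ?_) ?_
      · refine ⟨Ideal.mul_mem_left _ x hy, ?_⟩
        rw [← algebraMap_mul_single x ⟨y, hy⟩]
        exact Ideal.mul_mem_right _ _ (Ideal.mem_map_of_mem _ hx)
      · rintro x y ⟨hx, h1⟩ ⟨hy, h2⟩
        refine ⟨add_mem hx hy, ?_⟩
        have := single_add n (⟨x, hx⟩ : piece I n) ⟨y, hy⟩
        exact (congrArg (· ∈ _) this).mpr (add_mem h1 h2)
    classical
    have e : p = ∑ n ∈ p.1.coeff.support, single n ⟨p.1.coeff n, p.2 n⟩ := by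
      refine Subtype.ext ?_
      rw [AddSubmonoidClass.coe_finsetSum]
      exact (AddMonoidAlgebra.sum_coeff_single p.1).symm
    rw [e]
    exact sum_mem fun n _ ↦ key n _ (h n)

end extendedRees

end ExtendedRees

/-! ### Blow-ups -/

section Blowup

open Scheme IdealSheafData

variable {Z O B B' W : Scheme.{0}}

theorem IsBlowup.hom_ext {I : Z.IdealSheafData} {b : B ⟶ Z} (hb : IsBlowup I b) {h h' : W ⟶ B}
    (e : h ≫ b = h' ≫ b) (hc : IsEffectiveCartier (I.comap (h ≫ b))) : h = h' :=
  (hb.existsUnique_lift W (h ≫ b) hc).unique rfl e.symm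

theorem IsBlowup.of_isPullback {I : Z.IdealSheafData} {b : B ⟶ Z} (hb : IsBlowup I b)
    {j : O ⟶ Z} [IsOpenImmersion j] {m : B' ⟶ B} {b' : B' ⟶ O} (h : IsPullback m b' b j) :
    IsBlowup (I.comap j) b' := by
  have : IsOpenImmersion m := MorphismProperty.of_isPullback h.flip inferInstance
  refine ⟨?_, fun W g hg ↦ ?_⟩
  · rw [← comap_comp, ← h.w, comap_comp]
    exact hb.isEffectiveCartier.comap_of_isOpenImmersion m
  · rw [← comap_comp] at hg
    obtain ⟨k, hk, -⟩ := hb.existsUnique_lift W (g ≫ j) hg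
    refine ⟨h.lift k g hk, h.lift_snd _ _ _, fun k' hk' ↦ h.hom_ext ?_ ?_⟩
    · refine hb.hom_ext ?_ ?_
      · rw [Category.assoc, Category.assoc, h.w, ← Category.assoc, hk', h.lift_snd_assoc]
      · rwa [Category.assoc, h.w, ← Category.assoc, hk']
    · rw [hk', h.lift_snd]

/-- The restriction of a blow-up to an open subscheme is again a blow-up, so any other blow-up of
the open subscheme is identified with it by the universal property. -/
theorem IsBlowup.isPullback {I : Z.IdealSheafData} {b : B ⟶ Z} (hb : IsBlowup I b)
    {j : O ⟶ Z} [IsOpenImmersion j] {m : B' ⟶ B} {b' : B' ⟶ O} (hb' : IsBlowup (I.comap j) b')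
    (w : m ≫ b = b' ≫ j) : IsPullback m b' b j := by
  have hp := hb.of_isPullback (IsPullback.of_hasPullback b j)
  have key : IsEffectiveCartier (I.comap (m ≫ b)) := by
    rw [w, comap_comp]; exact hb'.isEffectiveCartier
  obtain ⟨k, hk, -⟩ := hb'.existsUnique_lift _ _ hp.isEffectiveCartier
  refine .of_iso_pullback ⟨w⟩ ⟨pullback.lift m b' w, k, ?_, ?_⟩ (pullback.lift_fst _ _ _)
    (pullback.lift_snd _ _ _)
  · refine hb'.hom_ext ?_ ?_
    · rw [Category.assoc, hk, pullback.lift_snd, Category.id_comp]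
    · rw [Category.assoc, hk, pullback.lift_snd]; exact hb'.isEffectiveCartier
  · refine hp.hom_ext ?_ ?_
    · rw [Category.assoc, pullback.lift_snd, hk, Category.id_comp]
    · rw [Category.assoc, pullback.lift_snd, hk]; exact hp.isEffectiveCartier

/-- The opens over which the blow-up exists. -/
abbrev BlowupOpens (I : Z.IdealSheafData) : Type :=
  {O : Z.Opens // ∃ (B : Scheme.{0}) (b : B ⟶ O.toScheme), IsBlowup (I.comap O.ι) b}

namespace BlowupOpens

variable {I : Z.IdealSheafData}

/-- The blow-up over an open set. -/
noncomputable def obj (O : BlowupOpens I) : Scheme.{0} := O.2.choose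

/-- The structure map of the blow-up over an open set. -/
noncomputable def toOpens (O : BlowupOpens I) : O.obj ⟶ O.1.toScheme := O.2.choose_spec.choose

theorem isBlowup (O : BlowupOpens I) : IsBlowup (I.comap O.1.ι) O.toOpens :=
  O.2.choose_spec.choose_spec

theorem exists_map {O O' : BlowupOpens I} (h : O ≤ O') :
    ∃! m : O.obj ⟶ O'.obj, m ≫ O'.toOpens = O.toOpens ≫ Z.homOfLE h := by
  refine O'.isBlowup.existsUnique_lift _ _ ?_
  rw [← comap_comp, Category.assoc, Scheme.homOfLE_ι, comap_comp]
  exact O.isBlowup.isEffectiveCartier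

/-- The map between the blow-ups over two open sets. -/
noncomputable def map {O O' : BlowupOpens I} (h : O ≤ O') : O.obj ⟶ O'.obj := (exists_map h).choose

theorem map_toOpens {O O' : BlowupOpens I} (h : O ≤ O') :
    map h ≫ O'.toOpens = O.toOpens ≫ Z.homOfLE h :=
  (exists_map h).choose_spec.1

theorem isPullback_map {O O' : BlowupOpens I} (h : O ≤ O') :
    IsPullback (map h) O.toOpens O'.toOpens (Z.homOfLE h) := by
  have h3 := O.isBlowup
  rw [← Scheme.homOfLE_ι Z h, comap_comp] at h3
  exact O'.isBlowup.isPullback h3 (map_toOpens h)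

/-- Blow-ups restrict to smaller opens, so the opens admitting one form a basis as soon as they
cover. This makes the cover locally directed, as the gluing datum requires. -/
theorem isBasis (h : ∀ z : Z, ∃ O : BlowupOpens I, z ∈ O.1) :
    TopologicalSpace.Opens.IsBasis (Set.range fun O : BlowupOpens I ↦ O.1) := by
  rw [TopologicalSpace.Opens.isBasis_iff_nbhd]
  intro U z hz
  obtain ⟨O, hO⟩ := h z
  let P := O.isBlowup.of_isPullback (IsPullback.of_hasPullback O.toOpens
    (Z.homOfLE (inf_le_right : U ⊓ O.1 ≤ O.1)))
  rw [← comap_comp, Scheme.homOfLE_ι] at P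
  exact ⟨U ⊓ O.1, ⟨⟨U ⊓ O.1, _, _, P⟩, rfl⟩, ⟨hz, hO⟩, inf_le_left⟩

/-- The open cover by the opens over which the blow-up exists. -/
noncomputable def cover (h : ∀ z : Z, ∃ O : BlowupOpens I, z ∈ O.1) : Z.OpenCover where
  I₀ := BlowupOpens I
  X O := O.1
  f O := O.1.ι
  mem₀ := by
    rw [Scheme.presieve₀_mem_precoverage_iff]
    refine ⟨fun z ↦ ?_, inferInstance⟩
    obtain ⟨O, hO⟩ := h z
    exact ⟨O, ⟨z, hO⟩, rfl⟩

instance (h : ∀ z : Z, ∃ O : BlowupOpens I, z ∈ O.1) : Preorder (cover h).I₀ :=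
  inferInstanceAs (Preorder (BlowupOpens I))

theorem opensRange_cover_f (h : ∀ z : Z, ∃ O : BlowupOpens I, z ∈ O.1) (O : (cover h).I₀) :
    ((cover h).f O).opensRange = (id O : BlowupOpens I).1 :=
  Opens.opensRange_ι _

noncomputable instance (h : ∀ z : Z, ∃ O : BlowupOpens I, z ∈ O.1) : (cover h).LocallyDirected :=
  .ofIsBasisOpensRange
    (fun {i j} ↦ (congrArg₂ (· ≤ ·) (opensRange_cover_f h i) (opensRange_cover_f h j)).to_iff.symm)
    ((congrArg (fun f ↦ TopologicalSpace.Opens.IsBasis (Set.range f))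
      (funext (opensRange_cover_f h))).mpr (isBasis h))

theorem trans_eq (h : ∀ z : Z, ∃ O : BlowupOpens I, z ∈ O.1) {O O' : BlowupOpens I} (i : O ⟶ O') :
    Cover.trans (cover h) (i := O) (j := O') i = Z.homOfLE i.le :=
  (cancel_mono O'.1.ι).mp <| (Cover.trans_map (cover h) (i := O) (j := O') i).trans
    (Scheme.homOfLE_ι Z i.le).symm

/-- The gluing datum formed by the blow-ups over open sets. -/
noncomputable def gluingData (h : ∀ z : Z, ∃ O : BlowupOpens I, z ∈ O.1) :
    (cover h).RelativeGluingData where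
  functor :=
  { obj O := obj (I := I) O
    map {O O'} i := map (I := I) (O := O) (O' := O') i.le
    map_id O := (exists_map (I := I) (O := O) le_rfl).unique (map_toOpens _) (by simp)
    map_comp {O₁ O₂ O₃} i j := by
      refine (exists_map (I := I) (O := O₁) (O' := O₃) (i ≫ j).le).unique (map_toOpens _) ?_
      rw [Category.assoc, map_toOpens (I := I) (O := O₂) (O' := O₃) j.le, ← Category.assoc,
        map_toOpens (I := I) (O := O₁) (O' := O₂) i.le, Category.assoc]
      exact congrArg _ (Scheme.homOfLE_homOfLE Z _ _) }
  natTrans :=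
  { app O := toOpens (I := I) O
    naturality {O O'} i :=
      (map_toOpens (I := I) (O := O) (O' := O') i.le).trans (congrArg _ (trans_eq h i).symm) }
  equifibered {O O'} i :=
    (congrArg (IsPullback _ _ _) (trans_eq h i)).mpr
      (isPullback_map (I := I) (O := O) (O' := O') i.le)

end BlowupOpens

/-- Blow-ups over opens are unique up to unique isomorphism, so they form a gluing datum indexed by
all opens on which one exists. The glued scheme inherits the universal property because lifts can be
found locally. -/
theorem exists_isBlowup_of_local (I : Z.IdealSheafData) (h : ∀ z : Z, ∃ O : Z.Opens, z ∈ O ∧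
    ∃ (B : Scheme.{0}) (b : B ⟶ O.toScheme), IsBlowup (I.comap O.ι) b) :
    ∃ (B : Scheme.{0}) (b : B ⟶ Z), IsBlowup I b := by
  have h : ∀ z : Z, ∃ O : BlowupOpens I, z ∈ O.1 := fun z ↦ by
    obtain ⟨O, hz, hO⟩ := h z
    exact ⟨⟨O, hO⟩, hz⟩
  let d := BlowupOpens.gluingData h
  have hp : ∀ O : BlowupOpens I, ∃ m : O.obj ⟶ d.glued, IsPullback m O.toOpens d.toBase O.1.ι :=
    fun O ↦ ⟨_, (d.isPullback_natTrans_ι_toBase O).flip⟩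
  choose m hm using hp
  have hmo : ∀ O, IsOpenImmersion (m O) := fun O ↦
    MorphismProperty.of_isPullback (hm O).flip inferInstance
  refine ⟨d.glued, d.toBase, isEffectiveCartier_of_local fun z ↦ ?_, fun W g hg ↦
    existsUnique_lift_of_local _ _ (fun N f f' e e' ↦ ?_) fun w ↦ ?_⟩
  · obtain ⟨O, hO⟩ := h (d.toBase z)
    obtain ⟨y, hy, -⟩ := exists_preimage_of_isPullback (hm O) z ⟨_, hO⟩ rfl
    refine ⟨_, m O, inferInstance, ⟨y, hy⟩, ?_⟩
    rw [← comap_comp, (hm O).w, comap_comp]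
    exact O.isBlowup.isEffectiveCartier
  · refine Scheme.hom_ext_of_forall _ _ fun w ↦ ?_
    obtain ⟨O, hO⟩ := h ((N.ι ≫ g) w)
    let N' := (N.ι ≫ g) ⁻¹ᵁ O.1
    have e1 : (N'.ι ≫ f) ≫ d.toBase = ((N.ι ≫ g) ∣_ O.1) ≫ O.1.ι := by
      rw [Category.assoc, e, morphismRestrict_ι]
    have e2 : (N'.ι ≫ f') ≫ d.toBase = ((N.ι ≫ g) ∣_ O.1) ≫ O.1.ι := by
      rw [Category.assoc, e', morphismRestrict_ι]
    refine ⟨N', hO, ?_⟩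
    rw [← (hm O).lift_fst _ _ e1, ← (hm O).lift_fst _ _ e2]
    congr 1
    refine O.isBlowup.hom_ext (by rw [(hm O).lift_snd, (hm O).lift_snd]) ?_
    rw [(hm O).lift_snd, ← comap_comp, morphismRestrict_ι, ← Category.assoc, comap_comp]
    exact hg.comap_of_isOpenImmersion _
  · obtain ⟨O, hO⟩ := h (g w)
    obtain ⟨k, hk, -⟩ := O.isBlowup.existsUnique_lift _ (g ∣_ O.1) (by
      rw [← comap_comp, morphismRestrict_ι, comap_comp]
      exact hg.comap_of_isOpenImmersion _)
    refine ⟨g ⁻¹ᵁ O.1, hO, k ≫ m O, ?_⟩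
    rw [Category.assoc, (hm O).w, reassoc_of% hk, morphismRestrict_ι]

end Blowup

/-! ### Morphisms to relative spectra over affine schemes -/

section SpecOver

open Scheme

variable {Z W : Scheme.{0}} [IsAffine Z] {S : CommRingCat.{0}}

/-- The spectrum of an algebra over the ring of global functions of an affine scheme. -/
noncomputable def specOver (φ : Γ(Z, ⊤) ⟶ S) : Spec S ⟶ Z := Spec.map φ ≫ Z.isoSpec.inv

theorem specOver_appTop (φ : Γ(Z, ⊤) ⟶ S) : (specOver φ).appTop = φ ≫ (ΓSpecIso S).inv := by
  have h := congrArg Scheme.Hom.appTop Z.toSpecΓ_isoSpec_inv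
  rw [Scheme.Hom.comp_appTop, Scheme.toSpecΓ_appTop, Scheme.Hom.id_appTop, ← Iso.eq_comp_inv,
    Category.id_comp] at h
  rw [specOver, Scheme.Hom.comp_appTop, h, ΓSpecIso_inv_naturality]

theorem specOver_appTop_apply (φ : Γ(Z, ⊤) ⟶ S) (x : Γ(Z, ⊤)) :
    (specOver φ).appTop x = (ΓSpecIso S).inv (φ x) := by
  rw [specOver_appTop, CommRingCat.comp_apply]

/-- The morphism to a spectrum given by a ring homomorphism. -/
noncomputable def toSpecOfHom (ψ : S ⟶ Γ(W, ⊤)) : W ⟶ Spec S := W.toSpecΓ ≫ Spec.map ψ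

theorem toSpecOfHom_appTop (ψ : S ⟶ Γ(W, ⊤)) :
    (ΓSpecIso S).inv ≫ (toSpecOfHom ψ).appTop = ψ := by
  rw [toSpecOfHom, Scheme.Hom.comp_appTop, ← ΓSpecIso_inv_naturality_assoc, Scheme.toSpecΓ_appTop,
    Iso.inv_hom_id, Category.comp_id]

theorem toSpecOfHom_appTop_apply (ψ : S ⟶ Γ(W, ⊤)) (x : S) :
    (toSpecOfHom ψ).appTop ((ΓSpecIso S).inv x) = ψ x := by
  conv_rhs => rw [← toSpecOfHom_appTop ψ, CommRingCat.comp_apply]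

theorem hom_Spec_ext {k k' : W ⟶ Spec S}
    (h : (ΓSpecIso S).inv ≫ k.appTop = (ΓSpecIso S).inv ≫ k'.appTop) : k = k' :=
  ext_of_isAffine ((cancel_epi _).mp h)

theorem toSpecOfHom_specOver (φ : Γ(Z, ⊤) ⟶ S) (ψ : S ⟶ Γ(W, ⊤)) (h : W ⟶ Z)
    (e : φ ≫ ψ = h.appTop) : toSpecOfHom ψ ≫ specOver φ = h := by
  refine ext_of_isAffine ?_
  rw [Scheme.Hom.comp_appTop, specOver_appTop, Category.assoc, toSpecOfHom_appTop, e]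

theorem specOver_comp_hom (φ : Γ(Z, ⊤) ⟶ S) (k : W ⟶ Spec S) (h : W ⟶ Z) (e : k ≫ specOver φ = h) :
    φ ≫ (ΓSpecIso S).inv ≫ k.appTop = h.appTop := by
  rw [← e, Scheme.Hom.comp_appTop, specOver_appTop, Category.assoc]

end SpecOver

/-! ### Charts of a blow-up -/

section Chart

open Scheme IdealSheafData

variable {Z W D : Scheme.{0}}

/-- `d : D ⟶ Z` is universal among the schemes over `Z` on which `f` is regular and divides `g`. -/
structure IsChart (f g : Γ(Z, ⊤)) (d : D ⟶ Z) : Prop where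
  regular : IsRegularSection (d.appTop f)
  dvd : d.appTop f ∣ d.appTop g
  existsUnique_lift : ∀ (W : Scheme.{0}) (h : W ⟶ Z), IsRegularSection (h.appTop f) →
    h.appTop f ∣ h.appTop g → ∃! k : W ⟶ D, k ≫ d = h

theorem IsChart.hom_ext {f g : Γ(Z, ⊤)} {d : D ⟶ Z} (hd : IsChart f g d) {k k' : W ⟶ D}
    (e : k ≫ d = k' ≫ d) (hr : IsRegularSection ((k ≫ d).appTop f)) : k = k' := by
  refine (hd.existsUnique_lift W (k ≫ d) hr ?_).unique rfl e.symm
  rw [appTop_comp_apply, appTop_comp_apply]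
  exact map_dvd _ hd.dvd

theorem isChart_specOver [IsAffine Z] (f g : Γ(Z, ⊤)) :
    IsChart f g (specOver (CommRingCat.ofHom (algebraMap Γ(Z, ⊤) (ChartRing f g)))) := by
  refine ⟨isRegularSection_of_isAffine ?_, ?_, fun W h hf hg ↦ ?_⟩
  · rw [specOver_appTop_apply]
    refine mem_nonZeroDivisors_of_injective (f := (ΓSpecIso (.of (ChartRing f g))).hom.hom)
      (ΓSpecIso (.of (ChartRing f g))).commRingCatIsoToRingEquiv.injective ?_
    rw [← CommRingCat.comp_apply, Iso.inv_hom_id]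
    exact ChartRing.mem_nonZeroDivisors f g
  · rw [specOver_appTop_apply, specOver_appTop_apply]
    exact map_dvd _ ⟨_, (ChartRing.mul_frac f g).symm⟩
  · obtain ⟨ψ, hψ⟩ := ChartRing.exists_hom f g h.appTop.hom hf.mem hg
    have hψ' : CommRingCat.ofHom (algebraMap Γ(Z, ⊤) (ChartRing f g)) ≫ CommRingCat.ofHom ψ =
      h.appTop := CommRingCat.hom_ext hψ
    refine ⟨toSpecOfHom (CommRingCat.ofHom ψ), toSpecOfHom_specOver _ _ _ hψ', fun k hk ↦ ?_⟩
    refine hom_Spec_ext ?_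
    rw [toSpecOfHom_appTop]
    have h1 := specOver_comp_hom _ _ _ hk
    refine CommRingCat.hom_ext (ChartRing.hom_ext ?_ ?_)
    · exact (congrArg CommRingCat.Hom.hom h1).trans hψ.symm
    · exact (congrArg (fun m : Γ(Z, ⊤) ⟶ Γ(W, ⊤) ↦ m f ∈ nonZeroDivisors _) h1).mpr hf.mem

theorem isUnit_basicOpen_ι (x : Γ(W, ⊤)) : IsUnit ((W.basicOpen x).ι.appTop x) := by
  have h : (W.basicOpen x).topIso.hom ((W.basicOpen x).ι.appTop x) =
      W.presheaf.map (homOfLE le_top).op x :=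
    congrArg (fun f ↦ f.hom x) (ι_appTop_topIso_hom (W.basicOpen x))
  have h2 : IsUnit (W.presheaf.map (homOfLE le_top).op x : Γ(W, W.basicOpen x)) :=
    RingedSpace.isUnit_res_basicOpen _ x
  rw [← h] at h2
  exact (MulEquiv.isUnit_map (W.basicOpen x).topIso.commRingCatIsoToRingEquiv).mp h2

theorem isUnit_appTop_of_basicOpen {N : W.Opens} {x : Γ(W, ⊤)} (h : N ≤ W.basicOpen x) :
    IsUnit (N.ι.appTop x) := by
  rw [← Scheme.homOfLE_ι _ h, appTop_comp_apply]
  exact (isUnit_basicOpen_ι x).map _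

theorem mem_basicOpen_of_isUnit {j : D ⟶ W} {x : Γ(W, ⊤)} (h : IsUnit (j.appTop x)) (d : D) :
    j d ∈ W.basicOpen x := by
  have h1 : d ∈ D.basicOpen (j.appTop x) := by
    rw [Scheme.mem_basicOpen_top]; exact h.map _
  rw [← Scheme.preimage_basicOpen_top] at h1
  exact h1

theorem mem_basicOpen_or_of_add_eq_one {p q u v : Γ(W, ⊤)} (h : p * u + q * v = 1) (w : W) :
    w ∈ W.basicOpen u ∨ w ∈ W.basicOpen v := by
  have h1 := congrArg (W.presheaf.germ ⊤ w trivial) h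
  rw [map_add, map_mul, map_mul, map_one] at h1
  rw [Scheme.mem_basicOpen_top, Scheme.mem_basicOpen_top]
  exact (IsLocalRing.isUnit_or_isUnit_of_add_one h1).imp isUnit_of_mul_isUnit_right
    isUnit_of_mul_isUnit_right

theorem principal_sup_principal {f g : Γ(W, ⊤)} (h : f ∣ g) :
    principal f ⊔ principal g = principal f :=
  sup_eq_left.mpr (principal_le_principal_of_dvd h)

/-- Write `f = a u`, `g = a v` with `a` a regular local generator of `(f, g)`. Cancelling `a` gives
`p u + q v = 1`, so `u` or `v` is a unit near `w`, and then `f` or `g` alone generates the ideal. -/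
theorem exists_basicOpen_chart {f g : Γ(W, ⊤)} (h : IsEffectiveCartier (principal f ⊔ principal g))
    (w : W) : ∃ N : W.Opens, w ∈ N ∧
      ((IsRegularSection (N.ι.appTop f) ∧ N.ι.appTop f ∣ N.ι.appTop g) ∨
       (IsRegularSection (N.ι.appTop g) ∧ N.ι.appTop g ∣ N.ι.appTop f)) := by
  obtain ⟨U, hw, a, ha, e⟩ := h.exists_regular w
  have := U.2
  have e' := congrArg (fun J : IdealSheafData U.1 ↦ J.ideal ⟨⊤, isAffineOpen_top _⟩) e
  dsimp only at e'
  rw [comap_sup, principal_comap, principal_comap, ideal_sup, Pi.sup_apply, ideal_principal_top,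
    ideal_principal_top, ideal_principal_top] at e'
  obtain ⟨u, hu⟩ := Ideal.mem_span_singleton.mp
    (e'.le (Ideal.mem_sup_left (Ideal.mem_span_singleton_self (U.1.ι.appTop f))))
  obtain ⟨v, hv⟩ := Ideal.mem_span_singleton.mp
    (e'.le (Ideal.mem_sup_right (Ideal.mem_span_singleton_self (U.1.ι.appTop g))))
  have hm := e'.ge (Ideal.mem_span_singleton_self a)
  rw [← Ideal.span_insert, Ideal.mem_span_pair] at hm
  obtain ⟨p, q, hpq⟩ := hm
  have h1 : p * u + q * v = 1 := by
    refine (mul_cancel_left_mem_nonZeroDivisors ha.mem).mp ?_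
    rw [hu, hv] at hpq
    linear_combination hpq
  have key : ∀ (f g u v : Γ(U.1, ⊤)), f = a * u → g = a * v → ∀ z ∈ U.1.toScheme.basicOpen u,
      ∃ N : U.1.toScheme.Opens, z ∈ N ∧ IsRegularSection (N.ι.appTop f) ∧
        N.ι.appTop f ∣ N.ι.appTop g := by
    intro f g u v hf hg z hz
    refine ⟨_, hz, ?_, ?_⟩
    · refine isRegularSection_of_isEffectiveCartier ?_
      have : principal ((U.1.toScheme.basicOpen u).ι.appTop f) =
          principal ((U.1.toScheme.basicOpen u).ι.appTop a) := by
        have hu := isUnit_basicOpen_ι u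
        refine le_antisymm (principal_le_principal_of_dvd ?_) (principal_le_principal_of_dvd ?_)
        · rw [hf, map_mul]; exact dvd_mul_right _ _
        · rw [hf, map_mul]; exact hu.mul_right_dvd.mpr dvd_rfl
      rw [this]
      exact isEffectiveCartier_principal (ha.comap _)
    · rw [hf, hg, map_mul, map_mul]
      exact (isUnit_basicOpen_ι u).mul_right_dvd.mpr (dvd_mul_right _ _)
  have fin : ∀ N : U.1.toScheme.Opens, (⟨w, hw⟩ : U.1) ∈ N → ∀ {f g : Γ(W, ⊤)},
      IsRegularSection (N.ι.appTop (U.1.ι.appTop f)) →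
      N.ι.appTop (U.1.ι.appTop f) ∣ N.ι.appTop (U.1.ι.appTop g) →
      w ∈ U.1.ι ''ᵁ N ∧ IsRegularSection ((U.1.ι ''ᵁ N).ι.appTop f) ∧
        (U.1.ι ''ᵁ N).ι.appTop f ∣ (U.1.ι ''ᵁ N).ι.appTop g := by
    intro N hN f g h1 h2
    refine ⟨⟨_, hN, rfl⟩, ?_⟩
    let e := IsOpenImmersion.isoOfRangeEq (U.1.ι ''ᵁ N).ι (N.ι ≫ U.1.ι) (by
      rw [Scheme.Hom.comp_base, TopCat.coe_comp, Set.range_comp]; simp)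
    have he : (U.1.ι ''ᵁ N).ι = e.hom ≫ N.ι ≫ U.1.ι :=
      (IsOpenImmersion.isoOfRangeEq_hom_fac _ _ _).symm
    rw [he]
    simp only [appTop_comp_apply]
    exact ⟨h1.comap _, map_dvd _ h2⟩
  obtain hz | hz := mem_basicOpen_or_of_add_eq_one h1 ⟨w, hw⟩
  · obtain ⟨N, hN, h2, h3⟩ := key _ _ u v hu hv _ hz
    obtain ⟨h4, h5⟩ := fin N hN h2 h3
    exact ⟨_, h4, .inl h5⟩
  · obtain ⟨N, hN, h2, h3⟩ := key _ _ v u hv hu _ hz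
    obtain ⟨h4, h5⟩ := fin N hN h2 h3
    exact ⟨_, h4, .inr h5⟩

/-- Two open subschemes which are charts of a blow-up of `Z` along `f = g = 0`. -/
structure IsChartPair {B D₁ D₂ : Scheme.{0}} (f g : Γ(Z, ⊤)) (b : B ⟶ Z) (i₁ : D₁ ⟶ B)
    (i₂ : D₂ ⟶ B) : Prop where
  isOpenImmersion₁ : IsOpenImmersion i₁
  isOpenImmersion₂ : IsOpenImmersion i₂
  isChart₁ : IsChart f g (i₁ ≫ b)
  isChart₂ : IsChart g f (i₂ ≫ b)
  cover : ∀ x : B, x ∈ Set.range i₁ ∨ x ∈ Set.range i₂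
  overlap₁ : ∀ y : Γ(D₁, ⊤), (i₁ ≫ b).appTop g = (i₁ ≫ b).appTop f * y → ∀ x ∈ D₁.basicOpen y,
    i₁ x ∈ Set.range i₂
  overlap₂ : ∀ y : Γ(D₂, ⊤), (i₂ ≫ b).appTop f = (i₂ ≫ b).appTop g * y → ∀ x ∈ D₂.basicOpen y,
    i₂ x ∈ Set.range i₁

namespace IsChartPair

variable {B D₁ D₂ : Scheme.{0}} {f g : Γ(Z, ⊤)} {b : B ⟶ Z} {i₁ : D₁ ⟶ B} {i₂ : D₂ ⟶ B}

theorem symm (h : IsChartPair f g b i₁ i₂) : IsChartPair g f b i₂ i₁ :=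
  ⟨h.2, h.1, h.4, h.3, fun x ↦ (h.5 x).symm, h.7, h.6⟩

/-- Where `k` lands in the second chart, `f / g` and `g / f` both exist on the source and are
inverse to each other. Hence the image point lies where `f / g` is invertible, that is, in the
overlap. -/
theorem mem_range (h : IsChartPair f g b i₁ i₂) (k : W ⟶ B)
    (hf : IsRegularSection ((k ≫ b).appTop f)) (hg : (k ≫ b).appTop f ∣ (k ≫ b).appTop g) (w : W) :
    k w ∈ Set.range i₁ := by
  have := h.isOpenImmersion₁
  have := h.isOpenImmersion₂
  refine (h.cover (k w)).elim id fun hw ↦ ?_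
  let N := k ⁻¹ᵁ i₂.opensRange
  have hk : Set.range (N.ι ≫ k) ⊆ Set.range i₂ := by
    rintro _ ⟨n, rfl⟩
    exact n.2
  let κ : N.toScheme ⟶ D₂ := IsOpenImmersion.lift i₂ (N.ι ≫ k) hk
  have hκ : κ ≫ i₂ = N.ι ≫ k := IsOpenImmersion.lift_fac _ _ _
  obtain ⟨y, hy⟩ := h.isChart₂.dvd
  obtain ⟨x, hx⟩ := hg
  have e : ∀ z, κ.appTop ((i₂ ≫ b).appTop z) = N.ι.appTop ((k ≫ b).appTop z) := fun z ↦ by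
    rw [← appTop_comp_apply, ← appTop_comp_apply, ← Category.assoc, hκ, Category.assoc]
  have hyx : κ.appTop y * N.ι.appTop x = 1 := by
    refine (mul_cancel_left_mem_nonZeroDivisors (hf.comap N.ι).mem).mp ?_
    have h1 := congrArg κ.appTop hy
    have h2 := congrArg N.ι.appTop hx
    rw [map_mul, e, e] at h1
    rw [map_mul] at h2
    rw [mul_one]
    conv_rhs => rw [h1, h2]
    ring
  have h3 : κ ⟨w, hw⟩ ∈ D₂.basicOpen y := mem_basicOpen_of_isUnit (.of_mul_eq_one _ hyx) _
  have h4 := h.overlap₂ y hy _ h3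
  have h5 : i₂ (κ ⟨w, hw⟩) = k w := congrArg (fun f : N.toScheme ⟶ B ↦ f ⟨w, hw⟩) hκ
  rwa [h5] at h4

theorem exists_lift (h : IsChartPair f g b i₁ i₂) (k : W ⟶ B)
    (hf : IsRegularSection ((k ≫ b).appTop f)) (hg : (k ≫ b).appTop f ∣ (k ≫ b).appTop g) :
    ∃ κ : W ⟶ D₁, κ ≫ i₁ = k := by
  have := h.isOpenImmersion₁
  refine ⟨IsOpenImmersion.lift i₁ k ?_, IsOpenImmersion.lift_fac _ _ _⟩
  rintro _ ⟨w, rfl⟩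
  exact h.mem_range k hf hg w

theorem hom_ext (h : IsChartPair f g b i₁ i₂) {k k' : W ⟶ B} (e : k ≫ b = k' ≫ b)
    (hf : IsRegularSection ((k ≫ b).appTop f)) (hg : (k ≫ b).appTop f ∣ (k ≫ b).appTop g) :
    k = k' := by
  obtain ⟨κ, rfl⟩ := h.exists_lift k hf hg
  obtain ⟨κ', rfl⟩ := h.exists_lift k' (by rwa [← e]) (by rwa [← e])
  exact congrArg (· ≫ i₁) (h.isChart₁.hom_ext (by rwa [Category.assoc, Category.assoc] at e) (by
    rwa [Category.assoc] at hf))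

/-- When the ideal becomes invertible, locally one of `f`, `g` is regular and divides the other. The
universal property of the corresponding chart gives existence, and `hom_ext` for the pair gives
uniqueness. -/
theorem isBlowup (h : IsChartPair f g b i₁ i₂) : IsBlowup (principal f ⊔ principal g) b := by
  have := h.isOpenImmersion₁
  have := h.isOpenImmersion₂
  have key : ∀ {N W : Scheme.{0}} (j : N ⟶ W) (k : W ⟶ Z) (z : Γ(Z, ⊤)),
      j.appTop (k.appTop z) = (j ≫ k).appTop z := fun j k z ↦ (appTop_comp_apply j k z).symm
  refine ⟨isEffectiveCartier_of_local fun x ↦ ?_, fun W k hk ↦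
    existsUnique_lift_of_local _ _ (fun N r r' e e' ↦ ?_) fun w ↦ ?_⟩
  · obtain hx | hx := h.cover x
    · refine ⟨_, i₁, inferInstance, hx, ?_⟩
      rw [← comap_comp, comap_sup, principal_comap, principal_comap,
        principal_sup_principal h.isChart₁.dvd]
      exact isEffectiveCartier_principal h.isChart₁.regular
    · refine ⟨_, i₂, inferInstance, hx, ?_⟩
      rw [← comap_comp, comap_sup, principal_comap, principal_comap, sup_comm,
        principal_sup_principal h.isChart₂.dvd]
      exact isEffectiveCartier_principal h.isChart₂.regular
  · refine Scheme.hom_ext_of_forall _ _ fun n ↦ ?_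
    have hN := hk.comap_of_isOpenImmersion N.ι
    rw [← comap_comp, comap_sup, principal_comap, principal_comap] at hN
    obtain ⟨M, hM, ⟨h1, h2⟩ | ⟨h1, h2⟩⟩ := exists_basicOpen_chart hN n
    · refine ⟨M, hM, h.hom_ext (by simp only [Category.assoc, e, e']) ?_ ?_⟩
      · rwa [key, ← e, ← Category.assoc] at h1
      · rwa [key, key, ← e, ← Category.assoc] at h2
    · refine ⟨M, hM, h.symm.hom_ext (by simp only [Category.assoc, e, e']) ?_ ?_⟩
      · rwa [key, ← e, ← Category.assoc] at h1
      · rwa [key, key, ← e, ← Category.assoc] at h2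
  · rw [comap_sup, principal_comap, principal_comap] at hk
    obtain ⟨M, hM, ⟨h1, h2⟩ | ⟨h1, h2⟩⟩ := exists_basicOpen_chart hk w
    · rw [key] at h1
      rw [key, key] at h2
      obtain ⟨r, hr, -⟩ := h.isChart₁.existsUnique_lift _ _ h1 h2
      exact ⟨M, hM, r ≫ i₁, by rw [Category.assoc, hr]⟩
    · rw [key] at h1
      rw [key, key] at h2
      obtain ⟨r, hr, -⟩ := h.isChart₂.existsUnique_lift _ _ h1 h2
      exact ⟨M, hM, r ≫ i₂, by rw [Category.assoc, hr]⟩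

end IsChartPair

theorem specOver_comp {S S' : CommRingCat.{0}} [IsAffine Z] (φ : Γ(Z, ⊤) ⟶ S) (ψ : S ⟶ S') :
    Spec.map ψ ≫ specOver φ = specOver (φ ≫ ψ) := by
  rw [specOver, specOver, Spec.map_comp, Category.assoc]

theorem mem_range_Spec_map {S S' : Type} [CommRing S] [CommRing S'] (ψ : S →+* S') (r : S)
    (hψ : letI := ψ.toAlgebra; IsLocalization.Away r S') (x : Spec (.of S))
    (hx : x ∈ (Spec (.of S)).basicOpen ((ΓSpecIso (.of S)).inv r)) :
    x ∈ Set.range (Spec.map (CommRingCat.ofHom ψ)) := by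
  let := ψ.toAlgebra
  rw [basicOpen_eq_of_affine'] at hx
  have h := PrimeSpectrum.localization_away_comap_range S' r
  have e : (ΓSpecIso (.of S)).hom ((ΓSpecIso (.of S)).inv r) = r := by
    rw [← CommRingCat.comp_apply, Iso.inv_hom_id]; rfl
  rw [e] at hx
  exact h.ge hx

theorem isOpenImmersion_Spec_map {S S' : Type} [CommRing S] [CommRing S'] (ψ : S →+* S') (r : S)
    (hψ : letI := ψ.toAlgebra; IsLocalization.Away r S') :
    IsOpenImmersion (Spec.map (CommRingCat.ofHom ψ)) := by
  let := ψ.toAlgebra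
  exact IsOpenImmersion.of_isLocalization r

theorem isLocalization_toAlgebra {S S' : Type} [CommRing S] [CommRing S'] [Algebra S S'] (r : S)
    (h : IsLocalization.Away r S') :
    letI := (algebraMap S S').toAlgebra; IsLocalization.Away r S' := by
  convert h
  exact Algebra.algebra_ext _ _ fun _ ↦ rfl

theorem exists_range_pushout {U D₁ D₂ : Scheme.{0}} (j₁ : U ⟶ D₁) (j₂ : U ⟶ D₂)
    [IsOpenImmersion j₁] [IsOpenImmersion j₂] :
    IsOpenImmersion (pushout.inl j₁ j₂) ∧ IsOpenImmersion (pushout.inr j₁ j₂) ∧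
      (∀ z : U, pushout.inl j₁ j₂ (j₁ z) = pushout.inr j₁ j₂ (j₂ z)) ∧ ∀ x : ↑(pushout j₁ j₂),
        x ∈ Set.range (pushout.inl j₁ j₂) ∨ x ∈ Set.range (pushout.inr j₁ j₂) := by
  refine ⟨inferInstanceAs (IsOpenImmersion (colimit.ι (span j₁ j₂) _)),
    inferInstanceAs (IsOpenImmersion (colimit.ι (span j₁ j₂) _)), fun z ↦ by
      rw [← Scheme.Hom.comp_apply, ← Scheme.Hom.comp_apply, pushout.condition], fun x ↦ ?_⟩
  obtain ⟨i, y, hy⟩ := Scheme.IsLocallyDirected.ι_jointly_surjective (span j₁ j₂) x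
  match i, y, hy with
  | none, y, hy =>
    refine .inl ⟨j₁ y, ?_⟩
    rw [← hy, ← colimit.w (span j₁ j₂) WalkingSpan.Hom.fst]
    rfl
  | some .left, y, hy => exact .inl ⟨y, hy⟩
  | some .right, y, hy => exact .inr ⟨y, hy⟩

theorem eq_frac [IsAffine Z] {f g : Γ(Z, ⊤)} (y : Γ(Spec (.of (ChartRing f g)), ⊤))
    (hy : (specOver (CommRingCat.ofHom (algebraMap Γ(Z, ⊤) (ChartRing f g)))).appTop g =
      (specOver (CommRingCat.ofHom (algebraMap Γ(Z, ⊤) (ChartRing f g)))).appTop f * y) :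
    y = (ΓSpecIso (.of (ChartRing f g))).inv (ChartRing.frac f g) := by
  refine (mul_cancel_left_mem_nonZeroDivisors (isChart_specOver f g).regular.mem).mp ?_
  rw [← hy, specOver_appTop_apply, specOver_appTop_apply, ← map_mul]
  exact congrArg _ (ChartRing.mul_frac f g).symm

/-- The scheme is the pushout of the two affine charts along the spectrum of `ChartOverlap f g`,
which is open in both. -/
theorem exists_isChartPair [IsAffine Z] (f g : Γ(Z, ⊤)) :
    ∃ (B : Scheme.{0}) (b : B ⟶ Z)
      (i₁ : Spec (.of (ChartRing f g)) ⟶ B) (i₂ : Spec (.of (ChartRing g f)) ⟶ B),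
      i₁ ≫ b = specOver (CommRingCat.ofHom (algebraMap Γ(Z, ⊤) (ChartRing f g))) ∧
      i₂ ≫ b = specOver (CommRingCat.ofHom (algebraMap Γ(Z, ⊤) (ChartRing g f))) ∧
      IsChartPair f g b i₁ i₂ := by
  have l₁ := isLocalization_toAlgebra (S' := ChartOverlap f g) (ChartRing.frac f g) inferInstance
  have l₂ := ChartOverlap.isLocalization_swap f g
  have o₁ := isOpenImmersion_Spec_map _ _ l₁
  have o₂ := isOpenImmersion_Spec_map _ _ l₂
  have w : Spec.map (CommRingCat.ofHom (algebraMap (ChartRing f g) (ChartOverlap f g))) ≫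
      specOver (CommRingCat.ofHom (algebraMap Γ(Z, ⊤) (ChartRing f g))) =
      Spec.map (CommRingCat.ofHom (ChartOverlap.swap f g)) ≫
      specOver (CommRingCat.ofHom (algebraMap Γ(Z, ⊤) (ChartRing g f))) := by
    rw [specOver_comp, specOver_comp]
    exact congrArg specOver (CommRingCat.hom_ext (ChartOverlap.swap_comp f g).symm)
  obtain ⟨p₁, p₂, hc, hcov⟩ := exists_range_pushout
    (Spec.map (CommRingCat.ofHom (algebraMap (ChartRing f g) (ChartOverlap f g))))
    (Spec.map (CommRingCat.ofHom (ChartOverlap.swap f g)))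
  have e₁ := pushout.inl_desc _ _ w
  have e₂ := pushout.inr_desc _ _ w
  refine ⟨_, pushout.desc _ _ w, pushout.inl _ _, pushout.inr _ _, e₁, e₂, p₁, p₂, ?_, ?_, hcov,
    ?_, ?_⟩
  · rw [e₁]; exact isChart_specOver f g
  · rw [e₂]; exact isChart_specOver g f
  · intro y hy x hx
    rw [e₁] at hy
    rw [eq_frac y hy] at hx
    obtain ⟨z, rfl⟩ := mem_range_Spec_map _ _ l₁ x hx
    exact ⟨_, (hc z).symm⟩
  · intro y hy x hx
    rw [e₂] at hy
    rw [eq_frac y hy] at hx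
    obtain ⟨z, rfl⟩ := mem_range_Spec_map _ _ l₂ x hx
    exact ⟨_, hc z⟩

end Chart

/-! ### The deformation to the normal cone of an effective Cartier divisor -/

section Deformation

open Scheme IdealSheafData

variable {X W V B : Scheme.{0}}

theorem zeroSection_over (X : Scheme.{0}) : zeroSection X ≫ 𝔸(Fin 1; X) ↘ X = 𝟙 X :=
  AffineSpace.homOfVector_over _ _

theorem zeroSection_appTop_coord (X : Scheme.{0}) :
    (zeroSection X).appTop (AffineSpace.coord X 0) = 0 := by
  rw [zeroSection, AffineSpace.homOfVector_appTop_coord]; rfl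

theorem affineLine_hom_ext {k k' : W ⟶ 𝔸(Fin 1; X)}
    (h : k ≫ 𝔸(Fin 1; X) ↘ X = k' ≫ 𝔸(Fin 1; X) ↘ X)
    (h' : k.appTop (AffineSpace.coord X 0) = k'.appTop (AffineSpace.coord X 0)) : k = k' :=
  AffineSpace.hom_ext h fun i ↦ by obtain rfl := Subsingleton.elim i 0; exact h'

theorem le_iff_comap_subschemeι (J K : X.IdealSheafData) : K ≤ J ↔ K.comap J.subschemeι = ⊥ := by
  rw [← le_bot_iff, ← le_map_iff_comap_le, map_bot, ker_subschemeι]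

theorem principal_zero : principal (0 : Γ(X, ⊤)) = ⊥ := by
  rw [← le_bot_iff, ofIdealTop_le_iff]
  rintro _ hx
  rw [Set.singleton_zero, Ideal.span_zero, Ideal.mem_bot] at hx
  rw [hx, map_zero]

theorem appTop_subschemeι_eq_zero {t : Γ(X, ⊤)} {J : X.IdealSheafData} (h : principal t ≤ J) :
    J.subschemeι.appTop t = 0 :=
  (ofIdealTop_le_iff _ _).mp h t (Ideal.mem_span_singleton_self t)

/-- The centre of the blow-up is cut out by the equations of `Y` and by `T`. -/
theorem map_zeroSection (I : X.IdealSheafData) : I.map (zeroSection X) =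
    I.comap (𝔸(Fin 1; X) ↘ X) ⊔ principal (AffineSpace.coord X 0) := by
  refine eq_of_forall_le_iff fun K ↦ ?_
  rw [le_map_iff_comap_le]
  constructor
  · intro h
    set J := I.comap (𝔸(Fin 1; X) ↘ X) ⊔ principal (AffineSpace.coord X 0)
    -- The coordinate vanishes on the closed subscheme defined by `J`, so its inclusion factors
    -- through the zero section.
    have hj : J.subschemeι = (J.subschemeι ≫ 𝔸(Fin 1; X) ↘ X) ≫ zeroSection X := by
      refine affineLine_hom_ext ?_ ?_
      · rw [Category.assoc, zeroSection_over, Category.comp_id]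
      · rw [appTop_comp_apply _ (zeroSection X), zeroSection_appTop_coord, map_zero,
          appTop_subschemeι_eq_zero le_sup_right]
    rw [le_iff_comap_subschemeι, ← le_bot_iff]
    conv_lhs => rw [hj, comap_comp]
    refine le_trans (comap_mono (J.subschemeι ≫ 𝔸(Fin 1; X) ↘ X) h :) ?_
    change I.comap (J.subschemeι ≫ 𝔸(Fin 1; X) ↘ X) ≤ ⊥
    rw [comap_comp, le_bot_iff, ← le_iff_comap_subschemeι]
    exact le_sup_left
  · intro h
    refine (comap_mono _ h).trans ?_
    dsimp only
    rw [comap_sup, ← comap_comp, zeroSection_over, comap_id, principal_comap,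
      zeroSection_appTop_coord, principal_zero, sup_bot_eq]

/-- This is `map_zeroSection` for the zero ideal, read on global sections. -/
theorem ker_zeroSection_appTop [IsAffine X] (r : Γ(𝔸(Fin 1; X), ⊤))
    (h : (zeroSection X).appTop r = 0) : AffineSpace.coord X 0 ∣ r := by
  have h1 := map_zeroSection (⊥ : X.IdealSheafData)
  have : IsAffine 𝔸(Fin 1; X) := isAffine_of_isAffineHom (𝔸(Fin 1; X) ↘ X)
  rw [map_bot, IdealSheafData.comap_bot, bot_sup_eq] at h1
  have h2 := congrArg (fun J : IdealSheafData 𝔸(Fin 1; X) ↦ J.ideal ⟨⊤, isAffineOpen_top _⟩) h1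
  dsimp only at h2
  have : IsAffineHom (zeroSection X) := inferInstance
  rw [ideal_principal_top, Scheme.Hom.ker_apply] at h2
  exact Ideal.mem_span_singleton.mp (h2.le h)

theorem mem_range_of_surjective [IsAffine V] {S : Type} [CommRing S] (s : V ⟶ Spec (.of S))
    (hs : Function.Surjective ((ΓSpecIso (.of S)).inv ≫ s.appTop)) (z : Spec (.of S))
    (hz : ∀ c, s.appTop ((ΓSpecIso (.of S)).inv c) = 0 → c ∈ z.asIdeal) : z ∈ Set.range s := by
  have e : s = V.isoSpec.hom ≫ Spec.map ((ΓSpecIso (.of S)).inv ≫ s.appTop) := by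
    refine hom_Spec_ext ?_
    exact (toSpecOfHom_appTop ((ΓSpecIso (.of S)).inv ≫ s.appTop)).symm
  have h := range_comap_of_surjective _ ((ΓSpecIso (.of S)).inv ≫ s.appTop).hom hs
  obtain ⟨y, hy⟩ := h.ge (show z ∈ _ from fun c hc ↦ hz c hc)
  exact ⟨V.isoSpec.inv y, (congrArg (fun f : Spec Γ(V, ⊤) ⟶ _ ↦ f y)
    ((Iso.inv_comp_eq _).mpr e)).trans hy⟩

theorem specOver_frac {Z : Scheme.{0}} [IsAffine Z] (f g : Γ(Z, ⊤)) :
    (specOver (CommRingCat.ofHom (algebraMap Γ(Z, ⊤) (ChartRing f g)))).appTop g =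
      (specOver (CommRingCat.ofHom (algebraMap Γ(Z, ⊤) (ChartRing f g)))).appTop f *
        (ΓSpecIso (.of (ChartRing f g))).inv (ChartRing.frac f g) := by
  rw [specOver_appTop_apply, specOver_appTop_apply, ← map_mul]
  exact congrArg _ (ChartRing.mul_frac _ _).symm

/-- In the application `f` is the coordinate `T`, `g` the equation `a` and `ζ` the zero section.
Modulo the fraction `f / g` every element of the chart ring comes from the base ring, and elements
killed by `ζ` are multiples of `f = g · (f / g)`. So `s` identifies `V` with the closed locus `f / g
= 0`, the complement of the overlap. -/
theorem mem_range_chart_lift {Z : Scheme.{0}} [IsAffine Z] [IsAffine V] (f g : Γ(Z, ⊤)) (ζ : V ⟶ Z)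
    (hg : IsRegularSection (ζ.appTop g)) (hf : ζ.appTop f = 0)
    (hζ : Function.Surjective ζ.appTop) (hker : ∀ r, ζ.appTop r = 0 → f ∣ r)
    (s : V ⟶ Spec (.of (ChartRing g f)))
    (hs : s ≫ specOver (CommRingCat.ofHom (algebraMap Γ(Z, ⊤) (ChartRing g f))) = ζ)
    (z : Spec (.of (ChartRing g f)))
    (hz : z ∉ (Spec (.of (ChartRing g f))).basicOpen
      ((ΓSpecIso (.of (ChartRing g f))).inv (ChartRing.frac g f))) : z ∈ Set.range s := by
  let ψ : ChartRing g f →+* Γ(V, ⊤) := ((ΓSpecIso (.of (ChartRing g f))).inv ≫ s.appTop).hom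
  have hr : ∀ r, ψ (algebraMap _ _ r) = ζ.appTop r := fun r ↦
    congrArg (fun f ↦ f.hom r) (specOver_comp_hom _ _ _ hs)
  have hF : ψ (ChartRing.frac g f) = 0 := by
    refine (mul_cancel_left_mem_nonZeroDivisors hg.mem).mp ?_
    rw [mul_zero, ← hr, ← map_mul, ChartRing.mul_frac, hr, hf]
  have hFz : ChartRing.frac g f ∈ z.asIdeal := by
    by_contra hF
    refine hz ?_
    rw [basicOpen_eq_of_affine', ← CommRingCat.comp_apply, Iso.inv_hom_id]
    exact hF
  refine mem_range_of_surjective s (fun c ↦ ?_) z fun c hc ↦ ?_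
  · obtain ⟨r, rfl⟩ := hζ c
    exact ⟨algebraMap _ _ r, hr r⟩
  · obtain ⟨r, d, rfl⟩ := ChartRing.exists_eq_add _ _ c
    have hc : ψ (algebraMap _ _ r + ChartRing.frac g f * d) = 0 := hc
    rw [map_add, map_mul, hF, zero_mul, add_zero, hr] at hc
    obtain ⟨r', rfl⟩ := hker r hc
    refine Ideal.add_mem _ ?_ (Ideal.mul_mem_right _ _ hFz)
    rw [map_mul, ← ChartRing.mul_frac]
    exact Ideal.mul_mem_right _ _ (Ideal.mul_mem_left _ _ hFz)

/-- The affine line over an open subscheme, as an open subscheme of the affine line. -/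
noncomputable abbrev affineLineMap (u : V ⟶ X) : 𝔸(Fin 1; V) ⟶ 𝔸(Fin 1; X) :=
  AffineSpace.map (Fin 1) u

instance (u : V ⟶ X) [IsOpenImmersion u] : IsOpenImmersion (affineLineMap u) :=
  MorphismProperty.of_isPullback (AffineSpace.isPullback_map u).flip inferInstance

theorem zeroSection_map (u : V ⟶ X) : zeroSection V ≫ affineLineMap u = u ≫ zeroSection X := by
  refine affineLine_hom_ext ?_ ?_
  · rw [Category.assoc, Category.assoc, zeroSection_over, AffineSpace.map_over, ← Category.assoc,
      zeroSection_over, Category.id_comp, Category.comp_id]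
  · rw [appTop_comp_apply, appTop_comp_apply, zeroSection_appTop_coord, map_zero,
      AffineSpace.map_appTop_coord, zeroSection_appTop_coord]

theorem mem_range_affineLineMap (u : V ⟶ X) (z : 𝔸(Fin 1; X))
    (h : (𝔸(Fin 1; X) ↘ X) z ∈ Set.range u) : z ∈ Set.range (affineLineMap u) := by
  obtain ⟨v, hv⟩ := h
  obtain ⟨y, hy, -⟩ := exists_preimage_of_isPullback (AffineSpace.isPullback_map u) z v hv.symm
  exact ⟨y, hy⟩

theorem map_zeroSection_comap_affineLineMap (I : X.IdealSheafData) (u : V ⟶ X) {a : Γ(V, ⊤)}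
    (ha : I.comap u = principal a) : (I.map (zeroSection X)).comap (affineLineMap u) =
      principal (AffineSpace.coord V 0) ⊔ principal ((𝔸(Fin 1; V) ↘ V).appTop a) := by
  rw [map_zeroSection, comap_sup, ← comap_comp, AffineSpace.map_over, comap_comp, ha,
    principal_comap, principal_comap, AffineSpace.map_appTop_coord, sup_comm]

theorem exists_isBlowup_affineLine {I : X.IdealSheafData} (hI : IsEffectiveCartier I) :
    ∃ (B : Scheme.{0}) (b : B ⟶ 𝔸(Fin 1; X)), IsBlowup (I.map (zeroSection X)) b := by
  refine exists_isBlowup_of_local _ fun z ↦ ?_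
  obtain ⟨U, hU, a, -, ha⟩ := hI.exists_regular ((𝔸(Fin 1; X) ↘ X) z)
  have := U.2
  have : IsAffine 𝔸(Fin 1; U.1) := isAffine_of_isAffineHom (𝔸(Fin 1; U.1) ↘ U.1)
  let o := affineLineMap U.1.ι
  obtain ⟨B, b, _, _, -, -, h⟩ := exists_isChartPair (AffineSpace.coord U.1.toScheme (0 : Fin 1))
    ((𝔸(Fin 1; U.1) ↘ U.1).appTop a)
  have hb := h.isBlowup
  rw [← map_zeroSection_comap_affineLineMap I U.1.ι ha] at hb
  refine ⟨o.opensRange, mem_range_affineLineMap _ _ ⟨⟨_, hU⟩, rfl⟩, B,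
    b ≫ o.isoOpensRange.hom, ?_⟩
  have h1 := hb.of_isPullback (m := 𝟙 B) (b' := b ≫ o.isoOpensRange.hom)
    (j := o.isoOpensRange.inv) (.of_horiz_isIso ⟨by simp⟩)
  rw [← comap_comp] at h1
  rwa [show o.opensRange.ι = o.isoOpensRange.inv ≫ affineLineMap U.1.ι by simp [o]]

/-- Over an affine open `V` on which `Y` is given by `a`, the complement of the lifted zero section
in the blow-up is the chart where `T` divides `a`. The last clause places every morphism satisfying
this divisibility inside that chart. -/
theorem exists_deformation_chart {I : X.IdealSheafData} (hI : IsEffectiveCartier I)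
    {b : B ⟶ 𝔸(Fin 1; X)} (hb : IsBlowup (I.map (zeroSection X)) b) {σ : X ⟶ B}
    (hσ : σ ≫ b = zeroSection X) (x : X) :
    ∃ (V : Scheme.{0}) (u : V ⟶ X) (a : Γ(V, ⊤)) (D₁ : Scheme.{0}) (κ : D₁ ⟶ B)
      (d : D₁ ⟶ 𝔸(Fin 1; V)), IsOpenImmersion u ∧ x ∈ Set.range u ∧ I.comap u = principal a ∧
      IsOpenImmersion κ ∧ κ ≫ b = d ≫ affineLineMap u ∧
      IsChart (AffineSpace.coord V 0) ((𝔸(Fin 1; V) ↘ V).appTop a) d ∧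
      (∀ y : B, b y ∈ Set.range (affineLineMap u) → (y ∈ Set.range κ ↔ y ∉ Set.range σ)) ∧
      ∀ (W : Scheme.{0}) (h : W ⟶ B) (γ : W ⟶ 𝔸(Fin 1; V)), h ≫ b = γ ≫ affineLineMap u →
        IsRegularSection (γ.appTop (AffineSpace.coord V 0)) →
        γ.appTop (AffineSpace.coord V 0) ∣ γ.appTop ((𝔸(Fin 1; V) ↘ V).appTop a) →
        ∀ w, h w ∈ Set.range κ := by
  obtain ⟨U, hU, a, hreg, ha⟩ := hI.exists_regular x
  have := U.2
  let V := U.1.toScheme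
  let u : V ⟶ X := U.1.ι
  have : IsAffine V := U.2
  have : IsAffine 𝔸(Fin 1; V) := isAffine_of_isAffineHom (𝔸(Fin 1; V) ↘ V)
  obtain ⟨B', b', i₁, i₂, e₁, e₂, h⟩ := exists_isChartPair (AffineSpace.coord V (0 : Fin 1))
    ((𝔸(Fin 1; V) ↘ V).appTop a)
  have := h.isOpenImmersion₁
  have hb' := h.isBlowup
  rw [← map_zeroSection_comap_affineLineMap I u ha] at hb'
  obtain ⟨m, hm, -⟩ := hb.existsUnique_lift B' (b' ≫ affineLineMap u) (by
    rw [comap_comp]; exact hb'.isEffectiveCartier)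
  have hp := hb.isPullback hb' hm
  have hmo : IsOpenImmersion m := MorphismProperty.of_isPullback hp.flip inferInstance
  have hσ'' : (u ≫ σ) ≫ b = zeroSection V ≫ affineLineMap u := by
    rw [Category.assoc, hσ, zeroSection_map]
  let σ' : V ⟶ B' := hp.lift (u ≫ σ) (zeroSection V) hσ''
  have hσ'm : σ' ≫ m = u ≫ σ := hp.lift_fst _ _ _
  have hσ'b : σ' ≫ b' = zeroSection V := hp.lift_snd _ _ _
  have hza : (zeroSection V).appTop ((𝔸(Fin 1; V) ↘ V).appTop a) = a := by
    rw [← appTop_comp_apply, zeroSection_over]; simp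
  -- On the first chart `T` divides `a`, while `T` vanishes along `σ'`. So `a` would vanish on an
  -- open part of `V`, which regularity allows only if that part is empty.
  have s₁ : ∀ v, σ' v ∉ Set.range i₁ := by
    intro v hv
    let N := σ' ⁻¹ᵁ i₁.opensRange
    let κ : N.toScheme ⟶ _ := IsOpenImmersion.lift i₁ (N.ι ≫ σ') (by
      rintro _ ⟨n, rfl⟩; exact n.2)
    have hκ : κ ≫ i₁ = N.ι ≫ σ' := IsOpenImmersion.lift_fac _ _ _
    have key : ∀ z, κ.appTop ((i₁ ≫ b').appTop z) = N.ι.appTop ((zeroSection V).appTop z) :=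
      fun z ↦ by
        rw [← appTop_comp_apply, ← appTop_comp_apply, ← Category.assoc, hκ, Category.assoc, hσ'b]
    have h1 := map_dvd κ.appTop.hom h.isChart₁.dvd
    have h1 : κ.appTop _ ∣ κ.appTop _ := h1
    rw [key, key, zeroSection_appTop_coord, map_zero, hza, zero_dvd_iff] at h1
    have h2 := (hreg.comap N.ι).mem
    rw [h1] at h2
    have h3 : (1 : Γ(N, ⊤)) = 0 := (mem_nonZeroDivisors_iff_right.mp h2) 1 (by simp)
    have h4 : (⟨v, hv⟩ : N.toScheme) ∈ N.toScheme.basicOpen (1 : Γ(N, ⊤)) := by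
      rw [Scheme.basicOpen_of_isUnit _ isUnit_one]; trivial
    rw [h3, Scheme.basicOpen_zero] at h4
    exact h4
  -- Outside the first chart a point lies in the second one, with `T / a` vanishing there, and this
  -- locus is the image of the lift.
  have s₂ : ∀ y, y ∉ Set.range i₁ → y ∈ Set.range σ' := by
    intro y hy
    obtain ⟨z, rfl⟩ := (h.cover y).resolve_left hy
    obtain ⟨s, hs⟩ := h.symm.exists_lift σ' (by rw [hσ'b, hza]; exact hreg) (by
      rw [hσ'b, zeroSection_appTop_coord]; exact dvd_zero _)
    suffices z ∈ Set.range s by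
      obtain ⟨v, rfl⟩ := this
      exact ⟨v, by rw [← hs]; rfl⟩
    have hsz : s ≫ specOver (CommRingCat.ofHom (algebraMap _ (ChartRing
        ((𝔸(Fin 1; V) ↘ V).appTop a) (AffineSpace.coord V (0 : Fin 1))))) = zeroSection V := by
      rw [← e₂, ← Category.assoc, hs, hσ'b]
    refine mem_range_chart_lift _ _ (zeroSection V) (by rwa [hza]) (zeroSection_appTop_coord V)
      (fun c ↦ ⟨(𝔸(Fin 1; V) ↘ V).appTop c, ?_⟩) ker_zeroSection_appTop s hsz z fun hz ↦ ?_
    · rw [← appTop_comp_apply, zeroSection_over]; simp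
    · refine hy (h.overlap₂ _ ?_ z hz)
      rw [e₂]
      exact specOver_frac _ _
  refine ⟨V, u, a, _, i₁ ≫ m, i₁ ≫ b', inferInstance, ⟨⟨x, hU⟩, rfl⟩, ha, inferInstance,
    by rw [Category.assoc, Category.assoc, hm], h.isChart₁, fun y hy ↦ ⟨?_, fun hy' ↦ ?_⟩,
    fun W k γ hk hf hg w ↦ ?_⟩
  · rintro ⟨z, rfl⟩ ⟨x', hx'⟩
    obtain ⟨y', hy'⟩ := hy
    have h1 : (𝔸(Fin 1; X) ↘ X) (b (σ x')) = x' := by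
      have h1 : b (σ x') = zeroSection X x' := congrArg (fun f : X ⟶ _ ↦ f x') hσ
      rw [h1, ← Scheme.Hom.comp_apply, zeroSection_over]; rfl
    have h2 : u ((𝔸(Fin 1; V) ↘ V) y') = x' := by
      rw [← h1, hx', ← hy', ← Scheme.Hom.comp_apply, ← Scheme.Hom.comp_apply,
        AffineSpace.map_over]
    refine s₁ ((𝔸(Fin 1; V) ↘ V) y') ⟨z, m.isOpenEmbedding.injective ?_⟩
    rw [← Scheme.Hom.comp_apply, ← hx', ← h2]
    exact congrArg (fun f : V ⟶ _ ↦ f ((𝔸(Fin 1; V) ↘ V) y')) hσ'm.symm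
  · obtain ⟨z, hz⟩ := hy
    obtain ⟨y', rfl, -⟩ := exists_preimage_of_isPullback hp y z hz.symm
    by_cases hy1 : y' ∈ Set.range i₁
    · obtain ⟨z', rfl⟩ := hy1
      exact ⟨z', rfl⟩
    · obtain ⟨v, rfl⟩ := s₂ y' hy1
      refine (hy' ⟨u v, ?_⟩).elim
      rw [← Scheme.Hom.comp_apply, ← Scheme.Hom.comp_apply, hσ'm]
  · let k' : W ⟶ B' := hp.lift k γ hk
    have hk'm : k' ≫ m = k := hp.lift_fst _ _ _
    have hk'b : k' ≫ b' = γ := hp.lift_snd _ _ _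
    obtain ⟨z, hz⟩ := h.mem_range k' (by rwa [hk'b]) (by rwa [hk'b]) w
    exact ⟨z, by rw [Scheme.Hom.comp_apply, hz, ← Scheme.Hom.comp_apply, hk'm]⟩

theorem parameter_eq {D : Scheme.{0}} (p : D ⟶ 𝔸(Fin 1; X)) :
    parameter p = p.appTop (AffineSpace.coord X 0) := rfl

theorem IsDeformation.local_regular {I : X.IdealSheafData} (hI : IsEffectiveCartier I)
    {D : Scheme.{0}} {p : D ⟶ 𝔸(Fin 1; X)} (hp : IsDeformation I p) (d : D) :
    ∃ (N : Scheme.{0}) (j : N ⟶ D) (_ : IsOpenImmersion j), d ∈ Set.range j ∧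
      IsRegularSection (j.appTop (parameter p)) ∧
      (I.comap (p ≫ 𝔸(Fin 1; X) ↘ X)).comap j ≤ (principal (parameter p)).comap j := by
  obtain ⟨B, b, σ, j, hb, hσ, _, hj, rfl⟩ := hp
  obtain ⟨V, u, a, D₁, κ, d₁, _, hu, ha, _, hκ, hd, hr, -⟩ := exists_deformation_chart hI hb hσ
    ((𝔸(Fin 1; X) ↘ X) (b (j d)))
  have h1 : j d ∈ Set.range κ :=
    (hr _ (mem_range_affineLineMap u _ hu)).mpr (hj.le ⟨d, rfl⟩)
  let N := j ⁻¹ᵁ κ.opensRange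
  let k : N.toScheme ⟶ D₁ := IsOpenImmersion.lift κ (N.ι ≫ j) (by rintro _ ⟨n, rfl⟩; exact n.2)
  have hk : k ≫ κ = N.ι ≫ j := IsOpenImmersion.lift_fac _ _ _
  have : IsOpenImmersion (k ≫ κ) := by rw [hk]; infer_instance
  have : IsOpenImmersion k := IsOpenImmersion.of_comp k κ
  have e : N.ι ≫ j ≫ b = (k ≫ d₁) ≫ affineLineMap u := by
    rw [← Category.assoc, ← hk, Category.assoc, hκ, Category.assoc]
  have et : N.ι.appTop (parameter (j ≫ b)) = k.appTop (d₁.appTop (AffineSpace.coord V 0)) := by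
    rw [parameter_eq, ← appTop_comp_apply, e, appTop_comp_apply, AffineSpace.map_appTop_coord,
      appTop_comp_apply]
  refine ⟨N, N.ι, inferInstance, ⟨⟨d, h1⟩, rfl⟩, ?_, ?_⟩
  · rw [et]; exact hd.regular.comap k
  · rw [principal_comap, et, ← comap_comp, ← Category.assoc, e, Category.assoc,
      AffineSpace.map_over, ← Category.assoc, comap_comp, ha, principal_comap, Category.assoc,
      appTop_comp_apply, appTop_comp_apply]
    exact principal_le_principal_of_dvd (map_dvd _ hd.dvd)

theorem IsDeformation.regular {I : X.IdealSheafData} (hI : IsEffectiveCartier I)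
    {D : Scheme.{0}} {p : D ⟶ 𝔸(Fin 1; X)} (hp : IsDeformation I p) :
    IsRegularSection (parameter p) :=
  isRegularSection_of_local fun d ↦ by
    obtain ⟨N, j, hj, hd, h, -⟩ := hp.local_regular hI d
    exact ⟨N, j, hj, hd, h⟩

theorem IsDeformation.le {I : X.IdealSheafData} (hI : IsEffectiveCartier I)
    {D : Scheme.{0}} {p : D ⟶ 𝔸(Fin 1; X)} (hp : IsDeformation I p) :
    I.comap (p ≫ 𝔸(Fin 1; X) ↘ X) ≤ principal (parameter p) :=
  le_of_local fun d ↦ by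
    obtain ⟨N, j, hj, hd, -, h⟩ := hp.local_regular hI d
    exact ⟨N, j, hj, hd, h⟩

/-- The pair `(g, t)` is a morphism to `X × 𝔸¹` that pulls the centre back to `(t)`, hence it lifts
to the blow-up. Locally `t` divides the equation of `Y`, so the lift avoids the removed zero
section. -/
theorem IsDeformation.existsUnique_lift {I : X.IdealSheafData} (hI : IsEffectiveCartier I)
    {D : Scheme.{0}} {p : D ⟶ 𝔸(Fin 1; X)} (hp : IsDeformation I p) (g : W ⟶ X) (t : Γ(W, ⊤))
    (ht : IsRegularSection t) (hg : I.comap g ≤ principal t) :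
    ∃! h : W ⟶ D, h ≫ p ≫ 𝔸(Fin 1; X) ↘ X = g ∧ h.appTop (parameter p) = t := by
  obtain ⟨B, b, σ, j, hb, hσ, _, hj, rfl⟩ := hp
  let γ : W ⟶ 𝔸(Fin 1; X) := AffineSpace.homOfVector g fun _ ↦ t
  have hγg : γ ≫ 𝔸(Fin 1; X) ↘ X = g := AffineSpace.homOfVector_over _ _
  have hγt : γ.appTop (AffineSpace.coord X 0) = t := AffineSpace.homOfVector_appTop_coord _ _ _
  have hγ : (I.map (zeroSection X)).comap γ = principal t := by
    rw [map_zeroSection, comap_sup, ← comap_comp, hγg, principal_comap, hγt, sup_eq_right]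
    exact hg
  have hc : IsEffectiveCartier ((I.map (zeroSection X)).comap γ) := by
    rw [hγ]; exact isEffectiveCartier_principal ht
  obtain ⟨h, hh, -⟩ := hb.existsUnique_lift W γ hc
  have hrange : Set.range h ⊆ Set.range j := by
    rintro _ ⟨w, rfl⟩
    rw [hj]
    obtain ⟨V, u, a, D₁, κ, d₁, _, hu, ha, _, hκ, hd, hr, hl⟩ := exists_deformation_chart hI hb hσ
      ((𝔸(Fin 1; X) ↘ X) (b (h w)))
    have hm := mem_range_affineLineMap u _ hu
    let N := (h ≫ b) ⁻¹ᵁ (affineLineMap u).opensRange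
    let k : N.toScheme ⟶ 𝔸(Fin 1; V) := IsOpenImmersion.lift (affineLineMap u) (N.ι ≫ h ≫ b)
      (by rintro _ ⟨n, rfl⟩; exact n.2)
    have hk : k ≫ affineLineMap u = (N.ι ≫ h) ≫ b :=
      (IsOpenImmersion.lift_fac _ _ _).trans (Category.assoc _ _ _).symm
    have e1 : k.appTop (AffineSpace.coord V 0) = N.ι.appTop t := by
      rw [← AffineSpace.map_appTop_coord u, ← appTop_comp_apply, hk, Category.assoc, hh,
        appTop_comp_apply, hγt]
    have e2 : principal (k.appTop ((𝔸(Fin 1; V) ↘ V).appTop a)) = (I.comap g).comap N.ι := by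
      rw [← appTop_comp_apply, ← principal_comap, ← ha, ← comap_comp, Category.assoc,
        ← AffineSpace.map_over, reassoc_of% hk, reassoc_of% hh, hγg, comap_comp]
    have hN : IsRegularSection (N.ι.appTop t) := ht.comap _
    refine (hr _ hm).mp (hl N (N.ι ≫ h) k hk.symm (by rwa [e1]) ?_ ⟨w, hm⟩)
    rw [e1]
    refine hN.dvd_of_le ?_
    rw [e2, ← principal_comap]
    exact comap_mono _ hg
  let k := IsOpenImmersion.lift j h hrange
  have hk : k ≫ j = h := IsOpenImmersion.lift_fac _ _ _
  refine ⟨k, ⟨?_, ?_⟩, fun k' ⟨h1, h2⟩ ↦ ?_⟩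
  · rw [Category.assoc, reassoc_of% hk, reassoc_of% hh, hγg]
  · rw [parameter_eq, ← appTop_comp_apply, reassoc_of% hk, hh, hγt]
  · rw [← cancel_mono j, hk]
    have e : (k' ≫ j) ≫ b = γ := affineLine_hom_ext
      (by rw [hγg, ← h1]; simp only [Category.assoc])
      (by rw [hγt, ← h2, parameter_eq, ← appTop_comp_apply, Category.assoc])
    exact hb.hom_ext (by rw [e, hh]) (by rwa [e])

theorem exists_isDeformation {I : X.IdealSheafData} (hI : IsEffectiveCartier I) :
    ∃ (D : Scheme.{0}) (p : D ⟶ 𝔸(Fin 1; X)), IsDeformation I p := by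
  obtain ⟨B, b, hb⟩ := exists_isBlowup_affineLine hI
  -- The zero section pulls the centre back to `I` itself, since `T` pulls back to `0`. This is
  -- Cartier by hypothesis, so the canonical lift exists.
  obtain ⟨σ, hσ, -⟩ := hb.existsUnique_lift X (zeroSection X) (by
    rwa [map_zeroSection, comap_sup, ← comap_comp, zeroSection_over, IdealSheafData.comap_id,
      principal_comap, zeroSection_appTop_coord, principal_zero, sup_bot_eq])
  -- The complement is a union of the open charts of `exists_deformation_chart`.
  have ho : IsOpen (Set.range σ)ᶜ := by
    refine isOpen_iff_forall_mem_open.mpr fun y hy ↦ ?_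
    obtain ⟨V, u, a, D₁, κ, d₁, _, hu, ha, _, hκ, hd, hr, hl⟩ := exists_deformation_chart hI hb hσ
      ((𝔸(Fin 1; X) ↘ X) (b y))
    refine ⟨Set.range κ, ?_, κ.isOpenEmbedding.isOpen_range,
      (hr _ (mem_range_affineLineMap u _ hu)).mpr hy⟩
    rintro _ ⟨z, rfl⟩
    refine (hr _ ⟨d₁ z, ?_⟩).mp ⟨z, rfl⟩
    exact congrArg (fun f : D₁ ⟶ _ ↦ f z) hκ.symm
  let O : B.Opens := ⟨_, ho⟩
  exact ⟨O, O.ι ≫ b, B, b, σ, O.ι, hb, hσ, inferInstance, O.range_ι, rfl⟩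

end Deformation

/-! ### The extended Rees algebra of a principal ideal -/

section PrincipalRees

namespace extendedRees

variable {A : Type} [CommRing A] {a : A}

theorem piece_span_singleton (a : A) (n : Fin 1 → ℤ) :
    piece (fun _ : Fin 1 ↦ Ideal.span {a}) n = Ideal.span {a ^ negExp (n 0)} := by
  rw [piece, Fin.prod_univ_one, Ideal.span_singleton_pow]

theorem mem_map_principal_iff (J : Ideal A) (p : extendedRees fun _ : Fin 1 ↦ Ideal.span {a}) :
    p ∈ J.map (algebraMap A (extendedRees fun _ : Fin 1 ↦ Ideal.span {a})) ↔
      ∀ n, ∃ y ∈ J, p.1.coeff n = y * a ^ negExp (n 0) := by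
  rw [mem_map_iff]
  refine forall_congr' fun n ↦ ?_
  rw [piece_span_singleton, Ideal.mem_mul_span_singleton]
  exact exists_congr fun _ ↦ and_congr_right fun _ ↦ eq_comm

/-- This says that `T` is a nonzerodivisor modulo the extension of `J`. Multiplication by `T` shifts
coefficients: from a degree `n ≥ 0` the condition is unchanged, and from `n < 0` a coefficient
`a^(k+1) z = a^k y` with `y ∈ J` gives `y = a z`. This lies in `(a) ∩ J`, hence in `(a) J`. -/
theorem mem_map_of_T_mul_mem (ha : a ∈ nonZeroDivisors A) {J : Ideal A}
    (h : Ideal.span {a} ⊓ J ≤ Ideal.span {a} * J)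
    {p : extendedRees fun _ : Fin 1 ↦ Ideal.span {a}}
    (hp : T _ 0 * p ∈ J.map (algebraMap A (extendedRees fun _ : Fin 1 ↦ Ideal.span {a}))) :
    p ∈ J.map (algebraMap A (extendedRees fun _ : Fin 1 ↦ Ideal.span {a})) := by
  rw [mem_map_principal_iff] at hp ⊢
  intro n
  obtain ⟨y, hy, e⟩ := hp (n + Pi.single 0 1)
  rw [T_mul_coeff, add_sub_cancel_right] at e
  have h1 := p.2 n
  change _ ∈ piece (fun _ : Fin 1 ↦ Ideal.span {a}) n at h1
  rw [piece_span_singleton, Ideal.mem_span_singleton] at h1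
  obtain ⟨z, hz⟩ := h1
  obtain hk | hk : negExp ((n + Pi.single 0 1 : Fin 1 → ℤ) 0) = negExp (n 0) ∨
      negExp (n 0) = negExp ((n + Pi.single 0 1 : Fin 1 → ℤ) 0) + 1 := by
    simp only [Pi.add_apply, Pi.single_eq_same, negExp]; lia
  · exact ⟨y, hy, by rw [e, hk]⟩
  · have h2 : y = a * z := by
      refine (mul_cancel_left_mem_nonZeroDivisors
        (pow_mem ha (negExp ((n + Pi.single 0 1 : Fin 1 → ℤ) 0)))).mp ?_
      rw [mul_comm, ← e, hz, hk, pow_succ, mul_assoc]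
    have h3 := h ⟨Ideal.mem_span_singleton.mpr ⟨z, h2⟩, hy⟩
    rw [Ideal.mem_span_singleton_mul] at h3
    obtain ⟨y', hy', h4⟩ := h3
    exact ⟨y', hy', by rw [e, ← h4, hk, pow_succ]; ring⟩

/-- In each degree a common element is `y a^k = z a^k` with `y ∈ J` and `z ∈ K`; cancelling `a^k`
puts `y` in the intersection. So proper intersection survives the deformation. -/
theorem map_inf_map_le (ha : a ∈ nonZeroDivisors A) {J K : Ideal A} (h : J ⊓ K ≤ J * K) :
    J.map (algebraMap A (extendedRees fun _ : Fin 1 ↦ Ideal.span {a})) ⊓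
      K.map (algebraMap A (extendedRees fun _ : Fin 1 ↦ Ideal.span {a})) ≤
    J.map (algebraMap A (extendedRees fun _ : Fin 1 ↦ Ideal.span {a})) *
      K.map (algebraMap A (extendedRees fun _ : Fin 1 ↦ Ideal.span {a})) := by
  rw [← Ideal.map_mul]
  rintro p ⟨h1, h2⟩
  rw [SetLike.mem_coe, mem_map_principal_iff] at h1 h2
  rw [mem_map_principal_iff]
  intro n
  obtain ⟨y, hy, e⟩ := h1 n
  obtain ⟨z, hz, e'⟩ := h2 n
  obtain rfl := (mul_cancel_right_mem_nonZeroDivisors (pow_mem ha (negExp (n 0)))).mp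
    (e.symm.trans e')
  exact ⟨y, h ⟨hy, hz⟩, e⟩

/-- An element `x` of `I_i` is the product of `T_i` and the monomial `x T_i^{-1}`. -/
theorem map_le_span_T {l : ℕ} (I : Fin l → Ideal A) (i : Fin l) :
    (I i).map (algebraMap A (extendedRees I)) ≤ Ideal.span {T I i} := by
  rw [Ideal.map_le_iff_le_comap]
  intro x hx
  rw [Ideal.mem_comap, Ideal.mem_span_singleton]
  have hx' : x ∈ piece I (-Pi.single i 1) := by
    have : piece I (-Pi.single i 1) = I i := by
      refine (Finset.prod_eq_single i (fun j _ hj ↦ ?_) (by simp)).trans ?_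
      · simp [negExp, hj]
      · simp [negExp]
    rwa [this]
  refine ⟨single _ ⟨x, hx'⟩, ?_⟩
  rw [T_eq_single, single_mul_single, algebraMap_eq_single]
  refine Subtype.ext ?_
  simp only [single, one_mul, add_neg_cancel]

end extendedRees

end PrincipalRees

/-! ### Ideal sheaves on spectra -/

section SpecIdeal

open Scheme IdealSheafData

variable {R S : Type} [CommRing R] [CommRing S]

/-- The ideal sheaf on the spectrum of a ring given by an ideal. -/
noncomputable abbrev specIdeal (K : Ideal R) : IdealSheafData (Spec (.of R)) :=
  ofIdealTop (K.map (ΓSpecIso (.of R)).inv.hom)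

theorem specIdeal_ideal_top (K : Ideal R) : (specIdeal K).ideal ⟨⊤, isAffineOpen_top _⟩ =
    K.comap (ΓSpecIso (.of R)).hom.hom := by
  have h := Ideal.map_symm (I := K) (ΓSpecIso (.of R)).commRingCatIsoToRingEquiv
  refine Eq.trans ?_ h
  simp only [ofIdealTop_ideal]
  exact (congrArg (fun f : Γ(Spec (.of R), ⊤) ⟶ Γ(Spec (.of R), ⊤) ↦ Ideal.map f.hom _)
    ((Spec (.of R)).presheaf.map_id _)).trans (Ideal.map_id _)

theorem specIdeal_le_iff {K L : Ideal R} : specIdeal K ≤ specIdeal L ↔ K ≤ L := by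
  rw [← Ideal.comap_le_comap_iff_of_surjective (ΓSpecIso (.of R)).hom.hom
    (ΓSpecIso (.of R)).commRingCatIsoToRingEquiv.surjective, ← specIdeal_ideal_top,
    ← specIdeal_ideal_top]
  exact ⟨fun h ↦ h _, le_of_isAffine⟩

theorem specIdeal_mul (K L : Ideal R) : specIdeal (K * L) = specIdeal K * specIdeal L := by
  rw [specIdeal, Ideal.map_mul]
  exact map_mul equivOfIsAffine.symm _ _

theorem specIdeal_inf (K L : Ideal R) : specIdeal (K ⊓ L) = specIdeal K ⊓ specIdeal L := by
  refine ext_of_isAffine ?_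
  rw [ideal_inf, Pi.inf_apply, specIdeal_ideal_top, specIdeal_ideal_top, specIdeal_ideal_top]
  rfl

theorem specIdeal_span_singleton (x : R) :
    specIdeal (Ideal.span {x}) = principal ((ΓSpecIso (.of R)).inv x) := by
  rw [specIdeal, Ideal.map_span, Set.image_singleton]

theorem specIdeal_comap (φ : R →+* S) (K : Ideal R) :
    (specIdeal K).comap (Spec.map (CommRingCat.ofHom φ)) = specIdeal (K.map φ) := by
  rw [ofIdealTop_comap, Ideal.map_map, specIdeal, Ideal.map_map]
  exact congrArg (fun f : CommRingCat.of R ⟶ Γ(Spec (.of S), ⊤) ↦ ofIdealTop (K.map f.hom))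
    (ΓSpecIso_inv_naturality (CommRingCat.ofHom φ)).symm

theorem comap_fromSpec {X : Scheme.{0}} (I : X.IdealSheafData) (U : X.affineOpens) :
    I.comap U.2.fromSpec = specIdeal (I.ideal U) := by
  refine ext_of_isAffine ?_
  have h : U.2.fromSpec.appLE U.1 ⊤ U.2.fromSpec_preimage_self.ge = (ΓSpecIso Γ(X, U.1)).inv := by
    rw [Scheme.Hom.appLE, U.2.fromSpec_app_self, Category.assoc, ← Functor.map_comp]
    exact (congrArg (_ ≫ ·) ((Spec Γ(X, U.1)).presheaf.map_id _)).trans (Category.comp_id _)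
  rw [ideal_comap U.2.fromSpec I U ⟨⊤, isAffineOpen_top _⟩ U.2.fromSpec_preimage_self.ge, h]
  exact (equivOfIsAffine.apply_symm_apply _).symm

theorem isRegularSection_Spec {x : R} (hx : x ∈ nonZeroDivisors R) :
    IsRegularSection ((ΓSpecIso (.of R)).inv x) := by
  refine isRegularSection_of_isAffine (mem_nonZeroDivisors_of_injective
    (f := (ΓSpecIso (.of R)).hom.hom) (ΓSpecIso (.of R)).commRingCatIsoToRingEquiv.injective ?_)
  rwa [← CommRingCat.comp_apply, Iso.inv_hom_id]

/-- If `t` is a nonzerodivisor modulo `J`, the closed subscheme of `J` is the closure of its part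
where `t` is invertible, so inclusions into `J` may be checked there. -/
theorem le_of_comap_basicOpen_le {V : Scheme.{0}} [IsAffine V] (t : Γ(V, ⊤)) {M J : V.IdealSheafData}
    (h : M.comap (V.basicOpen t).ι ≤ J.comap (V.basicOpen t).ι)
    (ht : ∀ x, t * x ∈ J.ideal ⟨⊤, isAffineOpen_top V⟩ → x ∈ J.ideal ⟨⊤, isAffineOpen_top V⟩) :
    M ≤ J := by
  refine le_of_isAffine fun f hf ↦ ?_
  let T : V.affineOpens := ⟨⊤, isAffineOpen_top V⟩
  let U : V.affineOpens := V.affineBasicOpen (U := T) t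
  have := U.2
  let res : Γ(V, ⊤) →+* Γ(V, U.1) := (V.presheaf.map (homOfLE <| V.basicOpen_le t).op).hom
  let := res.toAlgebra
  have hloc : IsLocalization.Away t Γ(V, U.1) := (isAffineOpen_top V).isLocalization_basicOpen t
  have h1 : M.ideal U ≤ J.ideal U := by
    have h2 := h ⟨⊤, isAffineOpen_top U.1⟩
    have e : ∀ I : V.IdealSheafData, (I.comap (V.basicOpen t).ι).ideal ⟨⊤, isAffineOpen_top U.1⟩ =
      (I.ideal U).map U.1.topIso.inv.hom := fun I ↦ ideal_comap_ι_top U I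
    rw [e, e] at h2
    have h3 := Ideal.map_mono (f := U.1.topIso.hom.hom) h2
    rw [Ideal.map_map, Ideal.map_map, ← CommRingCat.hom_comp, Iso.inv_hom_id] at h3
    exact (Ideal.map_id _).ge.trans (h3.trans (Ideal.map_id _).le)
  have hfU : res f ∈ (J.ideal T).map res := by
    have h2 : res f ∈ M.ideal U := by
      rw [← M.map_ideal_basicOpen T t]
      exact Ideal.mem_map_of_mem _ hf
    have h3 := h1 h2
    rwa [← J.map_ideal_basicOpen T t] at h3
  obtain ⟨⟨⟨y, hy⟩, ⟨_, m, rfl⟩⟩, e⟩ :=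
    (IsLocalization.mem_map_algebraMap_iff (Submonoid.powers t) Γ(V, U.1)).mp hfU
  have e : algebraMap Γ(V, ⊤) Γ(V, U.1) (f * t ^ m) = algebraMap Γ(V, ⊤) Γ(V, U.1) y := by
    rw [map_mul]; exact e
  obtain ⟨⟨_, k, rfl⟩, hk⟩ := (IsLocalization.eq_iff_exists (Submonoid.powers t) Γ(V, U.1)).mp e
  have h4 : t ^ (k + m) * f ∈ J.ideal T := by
    have : t ^ (k + m) * f = t ^ k * y := by rw [← hk, pow_add]; ring
    rw [this]
    exact Ideal.mul_mem_left _ _ hy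
  have h5 : ∀ n : ℕ, t ^ n * f ∈ J.ideal T → f ∈ J.ideal T := fun n ↦ by
    induction n with
    | zero => intro hn; simpa using hn
    | succ n ih => intro hn; exact ih (ht _ (by rwa [← mul_assoc, ← pow_succ']))
  exact h5 _ h4

end SpecIdeal

/-! ### The universal property of the iterated deformation -/

section Universal

open Scheme IdealSheafData

variable {X D V W : Scheme.{0}} {l : ℕ}

/-- The functions `t_i` on `W` are regular and define closed subschemes contained in the inverse
images of the subschemes `Y_i` of `X`. -/
structure Admissible (Y : Fin l → X.IdealSheafData) (g : W ⟶ X) (t : Fin l → Γ(W, ⊤)) : Prop where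
  regular : ∀ i, IsRegularSection (t i)
  le : ∀ i, (Y i).comap g ≤ principal (t i)

/-- `q : D ⟶ X` and the functions `T_i` on `D` are universal among admissible ones. -/
structure IsUniversal (Y : Fin l → X.IdealSheafData) (q : D ⟶ X) (T : Fin l → Γ(D, ⊤)) :
    Prop where
  admissible : Admissible Y q T
  existsUnique_lift : ∀ (W : Scheme.{0}) (g : W ⟶ X) (t : Fin l → Γ(W, ⊤)), Admissible Y g t →
    ∃! h : W ⟶ D, h ≫ q = g ∧ ∀ i, h.appTop (T i) = t i

theorem Admissible.comap {Y : Fin l → X.IdealSheafData} {g : W ⟶ X} {t : Fin l → Γ(W, ⊤)}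
    (h : Admissible Y g t) (j : V ⟶ W) [IsOpenImmersion j] :
    Admissible Y (j ≫ g) (fun i ↦ j.appTop (t i)) :=
  ⟨fun i ↦ (h.regular i).comap j, fun i ↦ by
    rw [comap_comp, ← principal_comap]; exact comap_mono j (h.le i)⟩

theorem admissible_comap_iff {Y : Fin l → X.IdealSheafData} {u : V ⟶ X} {g : W ⟶ V}
    {t : Fin l → Γ(W, ⊤)} : Admissible (fun i ↦ (Y i).comap u) g t ↔ Admissible Y (g ≫ u) t := by
  constructor
  · exact fun h ↦ ⟨h.1, fun i ↦ by rw [comap_comp]; exact h.2 i⟩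
  · exact fun h ↦ ⟨h.1, fun i ↦ by rw [← comap_comp]; exact h.2 i⟩

theorem IsUniversal.hom_ext {Y : Fin l → X.IdealSheafData} {q : D ⟶ X} {T : Fin l → Γ(D, ⊤)}
    (hD : IsUniversal Y q T) {h h' : W ⟶ D} (e : h ≫ q = h' ≫ q)
    (et : ∀ i, h.appTop (T i) = h'.appTop (T i)) (hr : ∀ i, IsRegularSection (h.appTop (T i))) :
    h = h' := by
  refine (hD.existsUnique_lift W (h ≫ q) (fun i ↦ h.appTop (T i)) ⟨hr, fun i ↦ ?_⟩).unique
    ⟨rfl, fun _ ↦ rfl⟩ ⟨e.symm, fun i ↦ (et i).symm⟩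
  rw [comap_comp, ← principal_comap]
  exact comap_mono h (hD.admissible.le i)

/-- The restriction of `D` to `V` and `D'` represent the same functor, because admissibility over
`V` is admissibility over `X`. -/
theorem IsUniversal.exists_isPullback {Y : Fin l → X.IdealSheafData} {q : D ⟶ X}
    {T : Fin l → Γ(D, ⊤)} (hD : IsUniversal Y q T) {u : V ⟶ X} [IsOpenImmersion u]
    {D' : Scheme.{0}} {q' : D' ⟶ V} {T' : Fin l → Γ(D', ⊤)}
    (hD' : IsUniversal (fun i ↦ (Y i).comap u) q' T') :
    ∃ ε : D' ⟶ D, IsPullback ε q' q u ∧ ∀ i, ε.appTop (T i) = T' i := by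
  have ha := admissible_comap_iff.mp hD'.admissible
  obtain ⟨ε, ⟨hε, hεT⟩, -⟩ := hD.existsUnique_lift D' _ _ ha
  have hP : Admissible (fun i ↦ (Y i).comap u) (pullback.snd q u)
      (fun i ↦ (pullback.fst q u).appTop (T i)) := by
    rw [admissible_comap_iff, ← pullback.condition]
    exact hD.admissible.comap _
  obtain ⟨k, ⟨hk, hkT⟩, -⟩ := hD'.existsUnique_lift _ _ _ hP
  have hkε : k ≫ ε = pullback.fst q u := by
    refine hD.hom_ext ?_ (fun i ↦ ?_) fun i ↦ ?_
    · rw [Category.assoc, hε, reassoc_of% hk, pullback.condition]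
    · rw [appTop_comp_apply, hεT, hkT]
    · rw [appTop_comp_apply, hεT, hkT]; exact hP.regular i
  refine ⟨ε, .of_iso_pullback ⟨hε⟩ ⟨pullback.lift ε q' hε, k, ?_, ?_⟩ (pullback.lift_fst _ _ _)
    (pullback.lift_snd _ _ _), hεT⟩
  · refine hD'.hom_ext ?_ (fun i ↦ ?_) fun i ↦ ?_
    · rw [Category.assoc, hk, pullback.lift_snd, Category.id_comp]
    · rw [appTop_comp_apply, hkT, ← appTop_comp_apply, pullback.lift_fst, hεT]; simp
    · rw [appTop_comp_apply, hkT, ← appTop_comp_apply, pullback.lift_fst, hεT]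
      exact hD'.admissible.regular i
  · refine pullback.hom_ext ?_ ?_
    · rw [Category.assoc, pullback.lift_fst, hkε, Category.id_comp]
    · rw [Category.assoc, pullback.lift_snd, hk, Category.id_comp]

/-- This is the affine model: `extendedRees.exists_hom` and `extendedRees.hom_ext`, translated into
morphisms to a spectrum. -/
theorem isUniversal_Spec {A : Type} [CommRing A] (I : Fin l → Ideal A) :
    IsUniversal (fun i ↦ specIdeal (I i))
      (Spec.map (CommRingCat.ofHom (algebraMap A (extendedRees I))))
      (fun i ↦ (ΓSpecIso (.of (extendedRees I))).inv (extendedRees.T I i)) := by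
  refine ⟨⟨fun i ↦ isRegularSection_Spec (extendedRees.T_mem_nonZeroDivisors i), fun i ↦ ?_⟩,
    fun W g t ht ↦ ?_⟩
  · rw [specIdeal_comap, ← specIdeal_span_singleton, specIdeal_le_iff]
    exact extendedRees.map_le_span_T I i
  · have e := toSpecOfHom_appTop ((ΓSpecIso (.of A)).inv ≫ g.appTop)
    have hg : toSpecOfHom ((ΓSpecIso (.of A)).inv ≫ g.appTop) = g := hom_Spec_ext e
    let φ : A →+* Γ(W, ⊤) := ((ΓSpecIso (.of A)).inv ≫ g.appTop).hom
    obtain ⟨ψ, hψ, hψT⟩ := extendedRees.exists_hom (I := I) φ t (fun i ↦ (ht.regular i).mem)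
      (fun i ↦ by
        rw [Ideal.map_le_iff_le_comap]
        intro x hx
        rw [Ideal.mem_comap, Ideal.mem_span_singleton]
        -- Inclusion of principal ideal sheaves turns into divisibility of global sections since `t
        -- i` is regular.
        refine (ht.regular i).dvd_of_le (le_trans ?_ (ht.le i))
        change principal (g.appTop ((ΓSpecIso (.of A)).inv x)) ≤ _
        rw [← principal_comap, ← specIdeal_span_singleton]
        exact comap_mono g (specIdeal_le_iff.mpr
          ((Ideal.span_singleton_le_iff_mem _).mpr hx)))
    have key : ∀ h : W ⟶ Spec (.of (extendedRees I)),
        h ≫ Spec.map (CommRingCat.ofHom (algebraMap A (extendedRees I))) = g ↔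
          ((ΓSpecIso (.of (extendedRees I))).inv ≫ h.appTop).hom.comp (algebraMap A _) = φ := by
      intro h
      have e1 : (ΓSpecIso (.of A)).inv ≫
          (h ≫ Spec.map (CommRingCat.ofHom (algebraMap A (extendedRees I)))).appTop =
          CommRingCat.ofHom (algebraMap A (extendedRees I)) ≫
            (ΓSpecIso (.of (extendedRees I))).inv ≫ h.appTop := by
        rw [Scheme.Hom.comp_appTop, ← ΓSpecIso_inv_naturality_assoc]
      constructor
      · intro he
        rw [he] at e1
        exact (congrArg CommRingCat.Hom.hom e1).symm
      · intro he
        refine hom_Spec_ext (e1.trans ?_)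
        exact CommRingCat.hom_ext he
    have hs := toSpecOfHom_appTop (CommRingCat.ofHom ψ)
    refine ⟨toSpecOfHom (CommRingCat.ofHom ψ), ⟨(key _).mpr ?_, fun i ↦ ?_⟩, fun h ⟨h1, h2⟩ ↦ ?_⟩
    · rw [hs]; exact hψ
    · rw [toSpecOfHom_appTop_apply]; exact hψT i
    · refine hom_Spec_ext ?_
      rw [hs]
      refine CommRingCat.hom_ext (extendedRees.hom_ext ?_ (fun i ↦ ?_) fun i ↦ ?_)
      · exact ((key h).mp h1).trans hψ.symm
      · exact (h2 i).trans (hψT i).symm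
      · exact (h2 i).symm ▸ (ht.regular i).mem

theorem IsUniversal.exists_affine {Y : Fin l → X.IdealSheafData} {q : D ⟶ X}
    {T : Fin l → Γ(D, ⊤)} (hD : IsUniversal Y q T) (U : X.affineOpens) :
    ∃ ε : Spec (.of (extendedRees fun i ↦ (Y i).ideal U)) ⟶ D,
      IsPullback ε (Spec.map (CommRingCat.ofHom (algebraMap Γ(X, U.1)
        (extendedRees fun i ↦ (Y i).ideal U)))) q U.2.fromSpec ∧
      ∀ i, ε.appTop (T i) = (ΓSpecIso (.of (extendedRees fun i ↦ (Y i).ideal U))).inv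
              (extendedRees.T (fun i ↦ (Y i).ideal U) i) := by
  have := IsAffineOpen.isOpenImmersion_fromSpec U.2
  refine hD.exists_isPullback ?_
  have h := isUniversal_Spec fun i ↦ (Y i).ideal U
  have e : (fun i ↦ (Y i).comap U.2.fromSpec) = fun i ↦ specIdeal ((Y i).ideal U) :=
    funext fun i ↦ comap_fromSpec (Y i) U
  rw [e]
  exact h

theorem isOpenImmersion_of_isPullback_fromSpec {S : Scheme.{0}} {U : X.affineOpens} {ε : S ⟶ D}
    {r : S ⟶ Spec Γ(X, U.1)} {q : D ⟶ X} (h : IsPullback ε r q U.2.fromSpec) :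
    IsOpenImmersion ε ∧ Set.range ε = q ⁻¹' U.1 := by
  have := IsAffineOpen.isOpenImmersion_fromSpec U.2
  refine ⟨MorphismProperty.of_isPullback h.flip inferInstance, Set.ext fun d ↦ ⟨?_, fun hd ↦ ?_⟩⟩
  · rintro ⟨s, rfl⟩
    have e : q (ε s) = U.2.fromSpec (r s) := congrArg (fun f : S ⟶ X ↦ f s) h.w
    rw [Set.mem_preimage, e, ← U.2.range_fromSpec]
    exact ⟨_, rfl⟩
  · rw [Set.mem_preimage, ← U.2.range_fromSpec] at hd
    obtain ⟨z, hz⟩ := hd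
    obtain ⟨s, hs, -⟩ := exists_preimage_of_isPullback h d z hz.symm
    exact ⟨s, hs⟩

theorem IsUniversal.exists_iso {Y : Fin l → X.IdealSheafData} {q : D ⟶ X}
    {T : Fin l → Γ(D, ⊤)} (hD : IsUniversal Y q T) (U : X.affineOpens) :
    ∃ e : Spec (.of (extendedRees fun i ↦ (Y i).ideal U)) ≅ (q ⁻¹ᵁ U.1).toScheme,
      e.hom ≫ (q ⁻¹ᵁ U.1).ι ≫ q =
        Spec.map (CommRingCat.ofHom (algebraMap Γ(X, U.1)
          (extendedRees fun i ↦ (Y i).ideal U))) ≫ U.2.fromSpec ∧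
      ∀ i, (e.hom ≫ (q ⁻¹ᵁ U.1).ι).appTop (T i) =
        (Scheme.ΓSpecIso (.of (extendedRees fun i ↦ (Y i).ideal U))).inv
          (extendedRees.T (fun i ↦ (Y i).ideal U) i) := by
  obtain ⟨ε, h, hT⟩ := hD.exists_affine U
  obtain ⟨_, hr⟩ := isOpenImmersion_of_isPullback_fromSpec h
  refine ⟨IsOpenImmersion.isoOfRangeEq ε (q ⁻¹ᵁ U.1).ι (by rw [hr]; simp), ?_, fun i ↦ ?_⟩
  · rw [← Category.assoc, IsOpenImmersion.isoOfRangeEq_hom_fac, h.w]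
  · rw [IsOpenImmersion.isoOfRangeEq_hom_fac, hT]

end Universal

/-! ### Iterated deformations -/

section Iterated

open Scheme IdealSheafData

variable {X D V W : Scheme.{0}} {l : ℕ}

theorem IsUniversal.of_isPullback {Y : Fin l → X.IdealSheafData} {q : D ⟶ X}
    {T : Fin l → Γ(D, ⊤)} (hD : IsUniversal Y q T) {u : V ⟶ X} [IsOpenImmersion u]
    {D' : Scheme.{0}} {m : D' ⟶ D} {q' : D' ⟶ V} (h : IsPullback m q' q u) :
    IsUniversal (fun i ↦ (Y i).comap u) q' (fun i ↦ m.appTop (T i)) := by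
  have : IsOpenImmersion m := MorphismProperty.of_isPullback h.flip inferInstance
  refine ⟨?_, fun W g t ht ↦ ?_⟩
  · rw [admissible_comap_iff, ← h.w]
    exact hD.admissible.comap m
  · rw [admissible_comap_iff] at ht
    obtain ⟨k, ⟨k1, k2⟩, k3⟩ := hD.existsUnique_lift W _ t ht
    refine ⟨h.lift k g k1, ⟨h.lift_snd _ _ _, fun i ↦ ?_⟩, fun k' ⟨h1, h2⟩ ↦ h.hom_ext ?_ ?_⟩
    · rw [← appTop_comp_apply, h.lift_fst, k2]
    · rw [h.lift_fst]
      refine k3 _ ⟨?_, fun i ↦ ?_⟩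
      · rw [Category.assoc, h.w, reassoc_of% h1]
      · rw [appTop_comp_apply, h2]
    · rw [h1, h.lift_snd]

/-- Over an affine open the map is `A → extendedRees I`, and the coefficients on the right lie in
`A`, so nonzerodivisors of `A` remain nonzerodivisors. This keeps earlier parameters regular and
divisors Cartier at later stages. -/
theorem IsUniversal.isRegularSection_appTop {Y : Fin l → X.IdealSheafData} {q : D ⟶ X}
    {T : Fin l → Γ(D, ⊤)} (hD : IsUniversal Y q T) {b : Γ(X, ⊤)} (hb : IsRegularSection b) :
    IsRegularSection (q.appTop b) := by
  refine isRegularSection_of_local fun d ↦ ?_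
  obtain ⟨U, hU⟩ := TopologicalSpace.Opens.mem_iSup.mp
      ((iSup_affineOpens_eq_top X).ge (Set.mem_univ (q d)))
  obtain ⟨ε, h, -⟩ := hD.exists_affine U
  have := IsAffineOpen.isOpenImmersion_fromSpec U.2
  obtain ⟨hε, hr⟩ := isOpenImmersion_of_isPullback_fromSpec h
  refine ⟨_, ε, hε, by rw [hr]; exact hU, ?_⟩
  have h1 := (hb.comap U.2.fromSpec).mem
  have h2 : U.2.fromSpec.appTop b = (ΓSpecIso (.of Γ(X, U.1))).inv
      ((ΓSpecIso (.of Γ(X, U.1))).hom (U.2.fromSpec.appTop b)) := by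
    rw [← CommRingCat.comp_apply, Iso.hom_inv_id]; rfl
  have h3 : (ΓSpecIso (.of Γ(X, U.1))).hom (U.2.fromSpec.appTop b) ∈ nonZeroDivisors _ :=
    mem_nonZeroDivisors_of_injective (f := (ΓSpecIso (.of Γ(X, U.1))).inv.hom)
      (ΓSpecIso (.of Γ(X, U.1))).symm.commRingCatIsoToRingEquiv.injective (h2 ▸ h1)
  rw [← appTop_comp_apply, h.w, appTop_comp_apply, h2]
  have h4 := isRegularSection_Spec (extendedRees.algebraMap_mem_nonZeroDivisors
    (I := fun i ↦ (Y i).ideal U) h3)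
  have h5 := congrArg (fun f ↦ f.hom ((ΓSpecIso (.of Γ(X, U.1))).hom (U.2.fromSpec.appTop b)))
    (ΓSpecIso_inv_naturality (CommRingCat.ofHom (algebraMap Γ(X, U.1)
        (extendedRees fun i ↦ (Y i).ideal U))))
  exact (congrArg IsRegularSection h5).mp h4

theorem IsUniversal.isEffectiveCartier_comap {Y : Fin l → X.IdealSheafData} {q : D ⟶ X}
    {T : Fin l → Γ(D, ⊤)} (hD : IsUniversal Y q T) {J : X.IdealSheafData}
    (hJ : IsEffectiveCartier J) : IsEffectiveCartier (J.comap q) := by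
  refine isEffectiveCartier_of_local fun d ↦ ?_
  obtain ⟨U, hU, b, hb, e⟩ := hJ.exists_regular (q d)
  refine ⟨_, (q ⁻¹ᵁ U.1).ι, inferInstance, ⟨⟨d, hU⟩, rfl⟩, ?_⟩
  rw [← comap_comp, ← morphismRestrict_ι, comap_comp, e, principal_comap]
  exact isEffectiveCartier_principal
    ((hD.of_isPullback (isPullback_morphismRestrict q U.1).flip).isRegularSection_appTop hb)

theorem IsDeformation.isUniversal {I : X.IdealSheafData} (hI : IsEffectiveCartier I)
    {p : D ⟶ 𝔸(Fin 1; X)} (hp : IsDeformation I p) :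
    IsUniversal (fun _ : Fin 1 ↦ I) (p ≫ 𝔸(Fin 1; X) ↘ X) (fun _ ↦ parameter p) := by
  refine ⟨⟨fun _ ↦ hp.regular hI, fun _ ↦ hp.le hI⟩, fun W g t ht ↦ ?_⟩
  obtain ⟨h, ⟨h1, h2⟩, h3⟩ := hp.existsUnique_lift hI g (t 0) (ht.regular 0) (ht.le 0)
  exact ⟨h, ⟨h1, fun i ↦ by obtain rfl := Subsingleton.elim i 0; exact h2⟩,
    fun h' ⟨h1', h2'⟩ ↦ h3 h' ⟨h1', h2' 0⟩⟩

theorem IsEffectiveCartier.exists_spec {I : X.IdealSheafData} (hI : IsEffectiveCartier I) (x : X) :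
    ∃ (A : Type) (_ : CommRing A) (u : Spec (.of A) ⟶ X) (K : X.IdealSheafData → Ideal A) (a : A),
      IsOpenImmersion u ∧ x ∈ Set.range u ∧ (∀ J, J.comap u = specIdeal (K J)) ∧
      a ∈ nonZeroDivisors A ∧ K I = Ideal.span {a} := by
  obtain ⟨U, hU, a, ha, e⟩ := hI x
  exact ⟨Γ(X, U.1), inferInstance, U.2.fromSpec, fun J ↦ J.ideal U, a,
    IsAffineOpen.isOpenImmersion_fromSpec U.2, by rw [U.2.range_fromSpec]; exact hU,
    fun J ↦ comap_fromSpec J U, ha, e⟩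

theorem IsDeformation.exists_affine {I : X.IdealSheafData} (hI : IsEffectiveCartier I)
    {p : D ⟶ 𝔸(Fin 1; X)} (hp : IsDeformation I p) (d : D) :
    ∃ (A : Type) (_ : CommRing A) (u : Spec (.of A) ⟶ X) (K : X.IdealSheafData → Ideal A) (a : A)
      (ε : Spec (.of (extendedRees fun _ : Fin 1 ↦ Ideal.span {a})) ⟶ D),
      IsOpenImmersion u ∧ (∀ J, J.comap u = specIdeal (K J)) ∧
      a ∈ nonZeroDivisors A ∧ K I = Ideal.span {a} ∧
      IsOpenImmersion ε ∧ d ∈ Set.range ε ∧ (∀ J : X.IdealSheafData,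
        (J.comap (p ≫ 𝔸(Fin 1; X) ↘ X)).comap ε = specIdeal ((K J).map
          (algebraMap _ (extendedRees fun _ : Fin 1 ↦ Ideal.span {a})))) ∧
      ε.appTop (parameter p) = (ΓSpecIso (.of (extendedRees fun _ : Fin 1 ↦ Ideal.span {a}))).inv
        (extendedRees.T _ 0) := by
  obtain ⟨A, _, u, K, a, hu, hx, hK, ha, e⟩ := hI.exists_spec ((p ≫ 𝔸(Fin 1; X) ↘ X) d)
  have h0 : (fun _ : Fin 1 ↦ I.comap u) = fun _ ↦ specIdeal (Ideal.span {a}) := by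
    funext; rw [hK, e]
  have hS := isUniversal_Spec fun _ : Fin 1 ↦ Ideal.span {a}
  rw [← h0] at hS
  obtain ⟨ε, h1, h2⟩ := (hp.isUniversal hI).exists_isPullback hS
  refine ⟨A, _, u, K, a, ε, hu, hK, ha, e, MorphismProperty.of_isPullback h1.flip inferInstance, ?_,
    fun J ↦ ?_, h2 0⟩
  · obtain ⟨z, hz⟩ := hx
    obtain ⟨s, hs, -⟩ := exists_preimage_of_isPullback h1 d z hz.symm
    exact ⟨s, hs⟩
  · rw [← comap_comp, h1.w, comap_comp, hK]
    exact specIdeal_comap _ _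

theorem le_of_comap_eq_specIdeal {A : Type} [CommRing A] {u : Spec (.of A) ⟶ X} [IsOpenImmersion u]
    {K : X.IdealSheafData → Ideal A} (hK : ∀ J, J.comap u = specIdeal (K J)) {I J : X.IdealSheafData}
    (h : I ⊓ J ≤ I * J) : K I ⊓ K J ≤ K I * K J := by
  have h1 := comap_mono u h
  dsimp only at h1
  rwa [inf_comap_of_isOpenImmersion, mul_comap_of_isOpenImmersion, hK, hK, ← specIdeal_inf,
    ← specIdeal_mul, specIdeal_le_iff] at h1

/-- Effective Cartier divisors that meet properly in pairs. -/
structure IsRegularFamily (Y : Fin l → X.IdealSheafData) : Prop where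
  isEffectiveCartier : ∀ i, IsEffectiveCartier (Y i)
  inf_le : ∀ i j, i ≠ j → Y i ⊓ Y j ≤ Y i * Y j

theorem comap_basicOpen_le_comap {ε : V ⟶ D} {t : Γ(D, ⊤)} {M J : D.IdealSheafData}
    (h : M.comap (D.basicOpen t).ι ≤ J.comap (D.basicOpen t).ι) :
    (M.comap ε).comap (V.basicOpen (ε.appTop t)).ι ≤
      (J.comap ε).comap (V.basicOpen (ε.appTop t)).ι := by
  obtain ⟨r, e⟩ : ∃ r, (V.basicOpen (ε.appTop t)).ι ≫ ε = r ≫ (D.basicOpen t).ι :=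
    ⟨V.homOfLE (Scheme.preimage_basicOpen_top ε t).ge ≫ (ε ∣_ D.basicOpen t), by
      rw [Category.assoc, morphismRestrict_ι, Scheme.homOfLE_ι_assoc]⟩
  rw [← comap_comp, ← comap_comp, e, comap_comp, comap_comp]
  exact comap_mono r h

theorem comap_le_of_comap_basicOpen_le {R : Type} [CommRing R] {ε : Spec (.of R) ⟶ D}
    {t : Γ(D, ⊤)} {M J : D.IdealSheafData}
    (h : M.comap (D.basicOpen t).ι ≤ J.comap (D.basicOpen t).ι) {r : R}
    (hr : ε.appTop t = (ΓSpecIso (.of R)).inv r) {K : Ideal R} (hJ : J.comap ε = specIdeal K)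
    (hK : ∀ x, r * x ∈ K → x ∈ K) : M.comap ε ≤ J.comap ε := by
  refine le_of_comap_basicOpen_le (ε.appTop t) (comap_basicOpen_le_comap h) fun x hx ↦ ?_
  rw [hJ, specIdeal_ideal_top, Ideal.mem_comap] at hx ⊢
  refine hK _ ?_
  have e : (ΓSpecIso (.of R)).hom.hom ((ΓSpecIso (.of R)).inv r) = r :=
    congrArg (fun f ↦ f.hom r) (ΓSpecIso (.of R)).inv_hom_id
  have e' : (ΓSpecIso (.of R)).hom.hom (ε.appTop t * x) = r * (ΓSpecIso (.of R)).hom.hom x :=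
    (map_mul _ _ _).trans (congrArg (· * _) ((congrArg _ hr).trans e))
  exact e' ▸ hx

/-- Proper intersection makes `T` a nonzerodivisor modulo the inverse image of `J`, so the inverse
image is already the closure of its part over `T ≠ 0`. -/
theorem IsDeformation.strictTransform_eq {I : X.IdealSheafData} (hI : IsEffectiveCartier I)
    {p : D ⟶ 𝔸(Fin 1; X)} (hp : IsDeformation I p) {J : X.IdealSheafData} (h : I ⊓ J ≤ I * J) :
    strictTransform p J = J.comap (p ≫ 𝔸(Fin 1; X) ↘ X) := by
  rw [strictTransform, comap_comp]
  refine le_antisymm (le_of_local fun d ↦ ?_) (le_map_comap _ _)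
  obtain ⟨A, _, u, K, a, ε, hu, hK, ha, e, hε, hd, hJ, hT⟩ := hp.exists_affine hI d
  exact ⟨_, ε, hε, hd, comap_le_of_comap_basicOpen_le (comap_map_le _ _) hT (hJ J) fun x hx ↦
    extendedRees.mem_map_of_T_mul_mem ha (e ▸ le_of_comap_eq_specIdeal hK h) hx⟩

theorem IsDeformation.comap_inf_le {I : X.IdealSheafData} (hI : IsEffectiveCartier I)
    {p : D ⟶ 𝔸(Fin 1; X)} (hp : IsDeformation I p) {J L : X.IdealSheafData} (h : J ⊓ L ≤ J * L) :
    J.comap (p ≫ 𝔸(Fin 1; X) ↘ X) ⊓ L.comap (p ≫ 𝔸(Fin 1; X) ↘ X) ≤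
      J.comap (p ≫ 𝔸(Fin 1; X) ↘ X) * L.comap (p ≫ 𝔸(Fin 1; X) ↘ X) := by
  refine le_of_local fun d ↦ ?_
  obtain ⟨A, _, u, K, a, ε, hu, hK, ha, e, hε, hd, hc, hT⟩ := hp.exists_affine hI d
  refine ⟨_, ε, hε, hd, ?_⟩
  rw [inf_comap_of_isOpenImmersion, mul_comap_of_isOpenImmersion, hc, hc, ← specIdeal_inf,
    ← specIdeal_mul, specIdeal_le_iff]
  exact extendedRees.map_inf_map_le ha (le_of_comap_eq_specIdeal hK h)

theorem IsRegularFamily.comap {Y : Fin (l + 1) → X.IdealSheafData} (hY : IsRegularFamily Y)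
    {p : D ⟶ 𝔸(Fin 1; X)} (hp : IsDeformation (Y 0) p) :
    IsRegularFamily fun i ↦ strictTransform p (Y i.succ) := by
  have h0 := hY.isEffectiveCartier 0
  have e : ∀ i : Fin l, strictTransform p (Y i.succ) =
      (Y i.succ).comap (p ≫ 𝔸(Fin 1; X) ↘ X) := fun i ↦
    hp.strictTransform_eq h0 (hY.inf_le 0 i.succ (Fin.succ_ne_zero i).symm)
  simp only [e]
  exact ⟨fun i ↦ (hp.isUniversal h0).isEffectiveCartier_comap (hY.isEffectiveCartier _),
    fun i j hij ↦ hp.comap_inf_le h0 (hY.inf_le _ _ ((Fin.succ_injective l).ne hij))⟩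

theorem exists_isIteratedDeformation : ∀ (l : ℕ) (X : Scheme.{0}) (Y : Fin l → X.IdealSheafData),
    IsRegularFamily Y → ∃ (D : Scheme.{0}) (q : D ⟶ X) (T : Fin l → Γ(D, ⊤)),
      IsIteratedDeformation l X Y D q T
  | 0, X, _, _ => ⟨X, 𝟙 X, finZeroElim, (inferInstance : IsIso (𝟙 X))⟩
  | l + 1, X, Y, hY => by
    obtain ⟨X', p, hp⟩ := exists_isDeformation (hY.isEffectiveCartier 0)
    obtain ⟨D, q', T', h⟩ := exists_isIteratedDeformation l X' _ (hY.comap hp)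
    exact ⟨D, q' ≫ p ≫ 𝔸(Fin 1; X) ↘ X, Fin.cons (q'.appTop (parameter p)) T', X', p, q', hp, rfl,
      rfl, h⟩

/-- Since strict transforms are inverse images, data for the later stages over `X'` are the
remaining data over `X` together with a lift to `X'`. That lift is given by the universal property
of the first deformation. -/
theorem IsIteratedDeformation.isUniversal : ∀ {l : ℕ} {X : Scheme.{0}}
    {Y : Fin l → X.IdealSheafData} {D : Scheme.{0}} {q : D ⟶ X} {T : Fin l → Γ(D, ⊤)},
    IsRegularFamily Y → IsIteratedDeformation l X Y D q T → IsUniversal Y q T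
  | 0, X, Y, D, q, T, _, h => by
    have : IsIso q := h
    refine ⟨⟨finZeroElim, finZeroElim⟩, fun W g t _ ↦
      ⟨g ≫ inv q, ⟨by simp, finZeroElim⟩, fun h' hh ↦ ?_⟩⟩
    rw [← hh.1]; simp
  | l + 1, X, Y, D, q, T, hY, h => by
    obtain ⟨X', p, q', hp, rfl, hT, h⟩ := h
    have h0 := hY.isEffectiveCartier 0
    have hU := isUniversal (hY.comap hp) h
    have e : ∀ i : Fin l, strictTransform p (Y i.succ) =
        (Y i.succ).comap (p ≫ 𝔸(Fin 1; X) ↘ X) := fun i ↦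
      hp.strictTransform_eq h0 (hY.inf_le 0 i.succ (Fin.succ_ne_zero i).symm)
    simp only [e] at hU
    have hr : IsRegularSection (T 0) := by
      rw [← hT]; exact hU.isRegularSection_appTop (hp.regular h0)
    have hl : (Y 0).comap (q' ≫ p ≫ 𝔸(Fin 1; X) ↘ X) ≤ principal (T 0) := by
      rw [comap_comp, ← hT, ← principal_comap]; exact comap_mono _ (hp.le h0)
    have hl' (i : Fin l) : (Y i.succ).comap (q' ≫ p ≫ 𝔸(Fin 1; X) ↘ X) ≤ principal (T i.succ) := by
      rw [comap_comp]; exact hU.admissible.le i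
    refine ⟨⟨Fin.cases hr hU.admissible.regular, Fin.cases hl hl'⟩, fun W g t ht ↦ ?_⟩
    · obtain ⟨g', ⟨h1, h2⟩, h3⟩ := hp.existsUnique_lift h0 g (t 0) (ht.regular 0) (ht.le 0)
      have ha : Admissible (fun i : Fin l ↦ (Y i.succ).comap (p ≫ 𝔸(Fin 1; X) ↘ X)) g'
          (fun i ↦ t i.succ) := by
        rw [admissible_comap_iff, h1]
        exact ⟨fun i ↦ ht.regular _, fun i ↦ ht.le _⟩
      obtain ⟨k, ⟨k1, k2⟩, k3⟩ := hU.existsUnique_lift W g' _ ha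
      refine ⟨k, ⟨?_, Fin.cases ?_ k2⟩, fun k' ⟨h1', h2'⟩ ↦ k3 k' ⟨h3 _ ⟨?_, ?_⟩, fun i ↦ h2' _⟩⟩
      · rw [reassoc_of% k1, h1]
      · rw [Category.assoc, h1']
      · rw [appTop_comp_apply, hT, h2']
      · rw [← hT, ← appTop_comp_apply, k1, h2]

end Iterated

/-! ### Ideals given by monomials, flat locally -/

section FlatRings

variable {A B : Type} [CommRing A] [CommRing B]

/-- This is the equational criterion of flatness, applied to the relation `x b - ∑ y_i c_i = 0`. -/
theorem Module.Flat.exists_of_smul_eq_sum [Algebra A B] [Module.Flat A B] {n : ℕ} {x : A} {b : B}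
    {y : Fin n → A} {c : Fin n → B} (h : x • b = ∑ i, y i • c i) :
    ∃ (κ : ℕ) (a : Fin κ → A) (z : Fin κ → B), b = ∑ j, a j • z j ∧
      ∀ j, x * a j ∈ Ideal.span (Set.range y) := by
  have h1 : ∑ i : Fin (n + 1), (Fin.cons x (fun i ↦ -y i) : Fin (n + 1) → A) i •
      (Fin.cons b c : Fin (n + 1) → B) i = 0 := by
    simp only [Fin.sum_univ_succ, Fin.cons_zero, Fin.cons_succ, neg_smul, Finset.sum_neg_distrib]
    rw [h, add_neg_cancel]
  obtain ⟨κ, a, z, h2, h3⟩ := Module.Flat.isTrivialRelation_of_sum_smul_eq_zero (R := A) (M := B) h1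
  refine ⟨κ, a 0, z, h2 0, fun j ↦ ?_⟩
  have h4 := h3 j
  simp only [Fin.sum_univ_succ, Fin.cons_zero, Fin.cons_succ, neg_mul,
    Finset.sum_neg_distrib, add_neg_eq_zero] at h4
  rw [h4]
  exact Ideal.sum_mem _ fun i _ ↦ Ideal.mul_mem_right _ _ (Ideal.subset_span ⟨i, rfl⟩)

/-- Flat extension commutes with colon ideals by an element: if `K` contains `(J : x)`, its
extension contains `(J B : φ x)`. -/
theorem RingHom.Flat.mem_map_of_mul_mem {φ : A →+* B} (hφ : φ.Flat) {J K : Ideal A} {x : A}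
    (hK : ∀ a, x * a ∈ J → a ∈ K) {b : B} (hb : φ x * b ∈ J.map φ) : b ∈ K.map φ := by
  let := φ.toAlgebra
  have : Module.Flat A B := hφ
  obtain ⟨n, c, g, h⟩ := Submodule.mem_span_set'.mp hb
  choose y hy hyg using fun i ↦ (g i).2
  have h1 : x • b = ∑ i, y i • c i := by
    refine h.symm.trans (Finset.sum_congr rfl fun i _ ↦ ?_)
    rw [smul_eq_mul, mul_comm, ← hyg]; rfl
  obtain ⟨κ, a, z, h2, h3⟩ := Module.Flat.exists_of_smul_eq_sum h1
  rw [h2]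
  refine Ideal.sum_mem _ fun j _ ↦ Ideal.mul_mem_right _ _ (Ideal.mem_map_of_mem φ (hK _ ?_))
  refine Ideal.span_le.mpr ?_ (h3 j)
  rintro _ ⟨i, rfl⟩
  exact hy i

theorem RingHom.Flat.map_mem_nonZeroDivisors {φ : A →+* B} (hφ : φ.Flat) {x : A}
    (hx : x ∈ nonZeroDivisors A) : φ x ∈ nonZeroDivisors B := by
  refine mem_nonZeroDivisors_iff_right.mpr fun b hb ↦ ?_
  have h := hφ.mem_map_of_mul_mem (J := ⊥) (K := ⊥) (x := x) (b := b)
    (fun a ha ↦ ((mem_nonZeroDivisors_iff_right.mp hx) a (by rwa [mul_comm]))) (by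
      rw [mul_comm, hb]; exact Ideal.zero_mem _)
  rwa [Ideal.map_bot] at h

/-- Intersecting with a principal ideal is a colon operation, `(m) ∩ N = m (N : m)`, hence
compatible with flat extension. -/
theorem RingHom.Flat.map_span_singleton_inf_map_le {φ : A →+* B} (hφ : φ.Flat) {m : A}
    {N K : Ideal A} (h : Ideal.span {m} ⊓ N ≤ K) :
    Ideal.span {φ m} ⊓ N.map φ ≤ K.map φ := by
  rintro y ⟨h1, h2⟩
  obtain ⟨b, rfl⟩ := Ideal.mem_span_singleton.mp h1
  let K' : Ideal A := Submodule.comap (LinearMap.mulLeft A m) K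
  have h3 : b ∈ K'.map φ := hφ.mem_map_of_mul_mem (J := N) (K := K') (x := m)
    (fun a ha ↦ show m * a ∈ K from h ⟨Ideal.mem_span_singleton.mpr ⟨a, rfl⟩, ha⟩) h2
  refine Submodule.span_induction (p := fun b _ ↦ φ m * b ∈ K.map φ) ?_ ?_ ?_ ?_ h3
  · rintro _ ⟨a, ha, rfl⟩
    rw [← map_mul]
    exact Ideal.mem_map_of_mem φ ha
  · rw [mul_zero]; exact Ideal.zero_mem _
  · intro a b _ _ ha hb
    rw [mul_add]; exact Ideal.add_mem _ ha hb
  · intro c b _ hb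
    rw [smul_eq_mul, mul_left_comm]; exact Ideal.mul_mem_left _ _ hb

/-- If `φ x` lies in `J B`, the extension of `(J : x)` is all of `B`. As `B` is local, `(J : x)` is
not contained in the contracted maximal ideal. -/
theorem RingHom.Flat.exists_mul_mem [IsLocalRing B] {φ : A →+* B} (hφ : φ.Flat) {J : Ideal A}
    {x : A} (hx : φ x ∈ J.map φ) : ∃ s ∉ (IsLocalRing.maximalIdeal B).comap φ, s * x ∈ J := by
  let K : Ideal A := Submodule.comap (LinearMap.mulLeft A x) J
  have h : (1 : B) ∈ K.map φ := hφ.mem_map_of_mul_mem (J := J) (fun _ ha ↦ ha) (by rwa [mul_one])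
  by_contra! hc
  refine (Ideal.ne_top_iff_one _).mp (IsLocalRing.maximalIdeal.isMaximal B).ne_top
    (Ideal.map_le_iff_le_comap.mpr (fun s hs ↦ ?_) h)
  by_contra hn
  exact hc s hn (by rw [mul_comm]; exact hs)

theorem Ideal.exists_forall_mul_mem {I J p : Ideal A} [p.IsPrime] (hI : I.FG)
    (h : ∀ x ∈ I, ∃ s ∉ p, s * x ∈ J) : ∃ s ∉ p, ∀ x ∈ I, s * x ∈ J := by
  classical
  obtain ⟨S, rfl⟩ := hI
  choose! f hf hfJ using h
  refine ⟨∏ x ∈ S, f x, fun hm ↦ ?_, fun x hx ↦ ?_⟩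
  · obtain ⟨x, hx, hxp⟩ := (Ideal.IsPrime.prod_mem_iff).mp hm
    exact hf x (Ideal.subset_span hx) hxp
  · refine Submodule.span_induction (p := fun x _ ↦ (∏ x ∈ S, f x) * x ∈ J) (fun x hx ↦ ?_) ?_ ?_ ?_
      hx
    · rw [← Finset.prod_erase_mul _ _ hx, mul_assoc]
      exact Ideal.mul_mem_left _ _ (hfJ x (Ideal.subset_span hx))
    · rw [mul_zero]; exact Ideal.zero_mem _
    · intro a b _ _ ha hb
      rw [mul_add]; exact Ideal.add_mem _ ha hb
    · intro c b _ hb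
      rw [smul_eq_mul, mul_left_comm]; exact Ideal.mul_mem_left _ _ hb

/-- If an ideal is generated by a regular element after a flat extension to a local ring, then it
is generated by a regular element in a neighbourhood of the corresponding prime. -/
theorem RingHom.Flat.exists_isLocalization_span_singleton [IsNoetherianRing A] [IsLocalRing B]
    {φ : A →+* B} (hφ : φ.Flat) {I : Ideal A} {b : B} (hb : b ∈ nonZeroDivisors B)
    (hI : I.map φ = Ideal.span {b}) : ∃ s ∉ (IsLocalRing.maximalIdeal B).comap φ,
      ∀ (A' : Type) [CommRing A'] [Algebra A A'] [IsLocalization.Away s A'],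
        ∃ a ∈ nonZeroDivisors A', I.map (algebraMap A A') = Ideal.span {a} := by
  -- Otherwise every `φ a` is `b` times a nonunit, so `b` lies in `b` times the maximal ideal, and
  -- cancelling `b` puts `1` there.
  obtain ⟨a, haI, haB⟩ : ∃ a ∈ I, I.map φ = Ideal.span {φ a} := by
    by_contra! hc
    have h1 : ∀ a ∈ I, φ a ∈ Ideal.span {b} * IsLocalRing.maximalIdeal B := fun a ha ↦ by
      have h2 : φ a ∈ Ideal.span {b} := hI ▸ Ideal.mem_map_of_mem φ ha
      obtain ⟨d, hd⟩ := Ideal.mem_span_singleton.mp h2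
      rw [hd]
      refine Ideal.mul_mem_mul (Ideal.mem_span_singleton_self b) fun hu ↦ hc a ha ?_
      rw [hI, hd, Ideal.span_singleton_mul_right_unit hu]
    have h2 : b ∈ Ideal.span {b} * IsLocalRing.maximalIdeal B :=
      (Ideal.map_le_iff_le_comap.mpr h1) (hI ▸ Ideal.mem_span_singleton_self b)
    obtain ⟨d, hd, e⟩ := Ideal.mem_span_singleton_mul.mp h2
    have h3 : (d - 1) * b = 0 := by rw [sub_mul, one_mul, mul_comm, e, sub_self]
    have h4 := sub_eq_zero.mp ((mem_nonZeroDivisors_iff_right.mp hb) _ h3)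
    exact (Ideal.ne_top_iff_one _).mp (IsLocalRing.maximalIdeal.isMaximal B).ne_top (h4 ▸ hd)
  have haR : φ a ∈ nonZeroDivisors B := by
    obtain ⟨c, hc⟩ := Ideal.mem_span_singleton.mp (haB ▸ hI ▸ Ideal.mem_span_singleton_self b :
      b ∈ Ideal.span {φ a})
    exact ((mul_mem_nonZeroDivisors).mp (hc ▸ hb)).1
  -- Inverting `s` makes `a` generate `I`; inverting `r` below kills the annihilator of `a`. Finite
  -- generation of both ideals is where the Noetherian hypothesis enters.
  obtain ⟨s, hs, h1⟩ := Ideal.exists_forall_mul_mem (I := I) (J := Ideal.span {a})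
    (p := (IsLocalRing.maximalIdeal B).comap φ) (IsNoetherian.noetherian I) fun x hx ↦
      hφ.exists_mul_mem (by
        rw [Ideal.map_span, Set.image_singleton, ← haB]; exact Ideal.mem_map_of_mem φ hx)
  obtain ⟨r, hr, h2⟩ := Ideal.exists_forall_mul_mem
    (I := LinearMap.ker (LinearMap.mulLeft A a)) (J := ⊥)
    (p := (IsLocalRing.maximalIdeal B).comap φ) (IsNoetherian.noetherian _) fun x hx ↦
      hφ.exists_mul_mem (by
        have h3 : φ x * φ a = 0 := by
          rw [← map_mul, mul_comm]
          exact (congrArg φ hx).trans (map_zero φ)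
        rw [(mem_nonZeroDivisors_iff_right.mp haR) _ h3]
        exact Ideal.zero_mem _)
  refine ⟨s * r, fun h ↦ ((Ideal.IsPrime.mem_or_mem inferInstance h).elim hs hr), ?_⟩
  intro A' _ _ _
  have hu : IsUnit (algebraMap A A' s * algebraMap A A' r) := by
    rw [← map_mul]; exact IsLocalization.Away.algebraMap_isUnit (s * r)
  refine ⟨algebraMap A A' a, mem_nonZeroDivisors_iff_right.mpr fun y hy ↦ ?_, le_antisymm ?_ ?_⟩
  · obtain ⟨⟨z, ⟨_, n, rfl⟩⟩, hz⟩ := IsLocalization.surj (Submonoid.powers (s * r)) y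
    have h3 : algebraMap A A' (z * a) = algebraMap A A' 0 := by
      rw [map_mul, ← hz, mul_right_comm, hy, zero_mul, map_zero]
    obtain ⟨⟨_, m, rfl⟩, hm⟩ :=
      (IsLocalization.eq_iff_exists (Submonoid.powers (s * r)) A').mp h3
    have h4 : (s * r) ^ m * z ∈ LinearMap.ker (LinearMap.mulLeft A a) := by
      change a * _ = 0
      have h5 : (s * r) ^ m * (z * a) = (s * r) ^ m * 0 := hm
      rw [mul_zero] at h5
      rw [← h5]; ring
    have h6 := congrArg (algebraMap A A') ((Ideal.mem_bot).mp (h2 _ h4))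
    rw [map_mul, map_mul, map_pow, map_zero, map_mul] at h6
    have h7 : algebraMap A A' z = 0 :=
      (hu.pow m).mul_right_eq_zero.mp ((isUnit_of_mul_isUnit_right hu).mul_right_eq_zero.mp h6)
    rw [h7] at hz
    exact (IsLocalization.map_units A'
      (⟨(s * r) ^ n, n, rfl⟩ : Submonoid.powers (s * r))).mul_left_eq_zero.mp hz
  · refine Ideal.map_le_iff_le_comap.mpr fun x hx ↦ ?_
    have h3 := Ideal.mem_map_of_mem (algebraMap A A') (h1 x hx)
    rw [Ideal.map_span, Set.image_singleton, map_mul] at h3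
    exact (Ideal.unit_mul_mem_iff_mem _ (isUnit_of_mul_isUnit_left hu)).mp h3
  · exact (Ideal.span_singleton_le_iff_mem _).mpr (Ideal.mem_map_of_mem _ haI)

/-- Locally at the prime ideal `p` and up to flat extensions, the ideals `I_i` are generated by
squarefree monomials without common variables. -/
def HasMonomialChart {l : ℕ} (I : Fin l → Ideal A) (p : Ideal A) : Prop :=
  ∃ (L : Type) (_ : CommRing L) (_ : IsLocalRing L) (φ : A →+* L) (n : ℕ)
    (ψ : MvPolynomial (Fin n) ℂ →+* L) (v : Fin l → (Fin n →₀ ℕ)), φ.Flat ∧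
    (IsLocalRing.maximalIdeal L).comap φ = p ∧ ψ.Flat ∧ (∀ i c, v i c ≤ 1) ∧
    (∀ i j, i ≠ j → ∀ c, v i c = 0 ∨ v j c = 0) ∧
    ∀ i, (I i).map φ = Ideal.span {ψ (MvPolynomial.monomial (v i) 1)}

/-- For `x ∈ I` the ideal `(J : x)` would lie in a maximal ideal if `x ∉ J`; the flat local ring
over that ideal gives an element of `(J : x)` outside it. -/
theorem le_of_flat {I J : Ideal A} (h : ∀ p : Ideal A, p.IsPrime → ∃ (L : Type) (_ : CommRing L)
    (_ : IsLocalRing L) (φ : A →+* L), φ.Flat ∧ (IsLocalRing.maximalIdeal L).comap φ = p ∧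
      I.map φ ≤ J.map φ) : I ≤ J := by
  intro x hx
  by_contra hn
  let K : Ideal A := Submodule.comap (LinearMap.mulLeft A x) J
  obtain ⟨m, hm, hK⟩ := Ideal.exists_le_maximal K ((Ideal.ne_top_iff_one _).mpr fun h1 ↦
    hn (by simpa [K] using! h1))
  obtain ⟨L, _, _, φ, hφ, rfl, hIJ⟩ := h m hm.isPrime
  obtain ⟨s, hs, hsx⟩ := hφ.exists_mul_mem (hIJ (Ideal.mem_map_of_mem φ hx))
  exact hs (hK (show x * s ∈ J by rwa [mul_comm]))

/-- Membership in a monomial ideal is tested on the support, so the inclusion becomes a statement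
about exponents. -/
theorem MvPolynomial.span_monomial_inf_span_le {σ : Type} {e : σ →₀ ℕ} {S R : Set (σ →₀ ℕ)}
    (h : ∀ d, e ≤ d → (∃ s ∈ S, s ≤ d) → ∃ r ∈ R, r ≤ d) :
    Ideal.span {MvPolynomial.monomial e (1 : ℂ)} ⊓
      Ideal.span ((fun s ↦ MvPolynomial.monomial s (1 : ℂ)) '' S) ≤
      Ideal.span ((fun s ↦ MvPolynomial.monomial s (1 : ℂ)) '' R) := by
  rintro x ⟨h1, h2⟩
  have h1 : x ∈ Ideal.span ((fun s ↦ MvPolynomial.monomial s (1 : ℂ)) '' {e}) := by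
    rwa [Set.image_singleton]
  have h2 := MvPolynomial.mem_ideal_span_monomial_image.mp h2
  have h1 := MvPolynomial.mem_ideal_span_monomial_image.mp h1
  refine MvPolynomial.mem_ideal_span_monomial_image.mpr fun d hd ↦ h d ?_ (h2 d hd)
  obtain ⟨_, rfl, h3⟩ := h1 d hd
  exact h3

theorem RingHom.Flat.span_inf_span_le {n : ℕ} {ψ : MvPolynomial (Fin n) ℂ →+* B} (hψ : ψ.Flat)
    {e : Fin n →₀ ℕ} {S R : Set (Fin n →₀ ℕ)}
    (h : ∀ d, e ≤ d → (∃ s ∈ S, s ≤ d) → ∃ r ∈ R, r ≤ d) :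
    Ideal.span {ψ (MvPolynomial.monomial e 1)} ⊓
      Ideal.span ((fun s ↦ ψ (MvPolynomial.monomial s 1)) '' S) ≤
      Ideal.span ((fun s ↦ ψ (MvPolynomial.monomial s 1)) '' R) := by
  have h1 := hψ.map_span_singleton_inf_map_le (MvPolynomial.span_monomial_inf_span_le h)
  rwa [Ideal.map_span, Ideal.map_span, Set.image_image, Set.image_image] at h1

theorem inf_le_mul_of_hasMonomialChart {l : ℕ} {I : Fin l → Ideal A}
    (h : ∀ p : Ideal A, p.IsPrime → HasMonomialChart I p) {i j : Fin l} (hij : i ≠ j) :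
    I i ⊓ I j ≤ I i * I j := by
  refine le_of_flat fun p hp ↦ ?_
  obtain ⟨L, _, _, φ, n, ψ, v, hφ, hp, hψ, hv, hd, hI⟩ := h p hp
  refine ⟨L, _, _, φ, hφ, hp, (Ideal.map_inf_le φ).trans ?_⟩
  rw [Ideal.map_mul, hI, hI, Ideal.span_singleton_mul_span_singleton, ← map_mul,
    MvPolynomial.monomial_mul, one_mul]
  -- The two exponents have no variable in common, so a monomial divisible by both is divisible by
  -- their product.
  have h1 := hψ.span_inf_span_le (e := v i) (S := {v j}) (R := {v i + v j}) (by
    rintro d h1 ⟨_, rfl, h2⟩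
    refine ⟨_, rfl, fun c ↦ ?_⟩
    have h1 := h1 c
    have h2 := h2 c
    rw [Finsupp.add_apply]
    rcases hd i j hij c with h3 | h3 <;> lia)
  rwa [Set.image_singleton, Set.image_singleton] at h1

/-- The exponents other than `k`, of the same degree as `k`, that vanish outside `Θ`. -/
def sameDegree {l : ℕ} (Θ : Finset (Fin l)) (k : Fin l → ℕ) : Set (Fin l → ℕ) :=
  {k' | (∀ i ∉ Θ, k' i = 0) ∧ ∑ i, k' i = ∑ i, k i ∧ k' ≠ k}

theorem Ideal.map_prod_pow_eq {l n : ℕ} {I : Fin l → Ideal A} {φ : A →+* B}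
    {ψ : MvPolynomial (Fin n) ℂ →+* B} {v : Fin l → (Fin n →₀ ℕ)}
    (hI : ∀ i, (I i).map φ = Ideal.span {ψ (MvPolynomial.monomial (v i) 1)}) (k : Fin l → ℕ) :
    (∏ i, I i ^ k i).map φ = Ideal.span {ψ (MvPolynomial.monomial (∑ i, k i • v i) 1)} := by
  simp only [← Ideal.mapHom_apply, map_prod, map_pow]
  simp only [Ideal.mapHom_apply, hI, Ideal.span_singleton_pow, Ideal.prod_span_singleton]
  rw [MvPolynomial.monomial_sum_one, map_prod]
  simp only [MvPolynomial.monomial_pow, one_pow, ← map_pow]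

/-- This independence of the products of powers identifies the fibres with normal cones. If a
monomial is divisible by the monomials of `k` and of some `k' ≠ k` of the same degree, then `k_i <
k'_i` for some `i ∈ Θ`, and it is divisible by that of `k` with one more factor from `I_i`. -/
theorem prod_inf_iSup_le_of_hasMonomialChart {l : ℕ} {I : Fin l → Ideal A}
    (h : ∀ p : Ideal A, p.IsPrime → HasMonomialChart I p) {Θ : Finset (Fin l)} {k : Fin l → ℕ} :
    (∏ i, I i ^ k i) ⊓ ⨆ k' ∈ sameDegree Θ k, ∏ i, I i ^ k' i ≤
      (⨆ i ∈ Θ, I i) * ∏ i, I i ^ k i := by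
  refine le_of_flat fun p hp ↦ ?_
  obtain ⟨L, _, _, φ, n, ψ, v, hφ, hp, hψ, hv, hd, hI⟩ := h p hp
  refine ⟨L, _, _, φ, hφ, hp, (Ideal.map_inf_le φ).trans ?_⟩
  have h1 := hψ.span_inf_span_le (e := ∑ i, k i • v i)
    (S := (fun k' : Fin l → ℕ ↦ ∑ i, k' i • v i) '' sameDegree Θ k)
    (R := (fun i ↦ v i + ∑ i, k i • v i) '' Θ) (by
      rintro d h1 ⟨_, ⟨k', ⟨h2, h3, h4⟩, rfl⟩, h5⟩
      obtain ⟨i, hi⟩ : ∃ i, k i < k' i := by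
        by_contra! hc
        exact h4 (funext fun i ↦ ((Finset.sum_eq_sum_iff_of_le fun i _ ↦ hc i).mp h3) i
          (Finset.mem_univ i))
      have hiΘ : i ∈ Θ := by
        by_contra hn
        rw [h2 i hn] at hi
        exact absurd hi (Nat.not_lt_zero _)
      refine ⟨_, ⟨i, hiΘ, rfl⟩, fun c ↦ ?_⟩
      have h1 := h1 c
      have h5 := h5 c
      simp only [Finsupp.add_apply, Finsupp.finsetSum_apply, Finsupp.smul_apply, smul_eq_mul]
        at h1 h5 ⊢
      by_cases hc : v i c = 0
      · rwa [hc, zero_add]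
      -- A variable occurring in the `i`-th monomial occurs in no other and only once, so its
      -- exponent in the monomial of `k` is just `k i`.
      · have h6 : ∀ k : Fin l → ℕ, ∑ j, k j * v j c = k i * v i c := fun k ↦
          Finset.sum_eq_single i (fun j _ hj ↦ by
            rw [((hd j i hj c).resolve_right hc), mul_zero]) (by simp)
        rw [h6] at h5 ⊢
        have : v i c = 1 := by have := hv i c; lia
        rw [this] at h5 ⊢
        lia)
  refine le_trans (inf_le_inf ?_ ?_) (h1.trans ?_)
  · rw [Ideal.map_prod_pow_eq hI]
  · simp only [Ideal.map_iSup, iSup_le_iff, Ideal.map_prod_pow_eq hI]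
    exact fun k' hk' ↦ (Ideal.span_singleton_le_iff_mem _).mpr
      (Ideal.subset_span ⟨_, ⟨k', hk', rfl⟩, rfl⟩)
  · rw [Ideal.span_le]
    rintro _ ⟨_, ⟨i, hi, rfl⟩, rfl⟩
    have e : MvPolynomial.monomial (v i + ∑ i, k i • v i) (1 : ℂ) =
        MvPolynomial.monomial (v i) 1 * MvPolynomial.monomial (∑ i, k i • v i) 1 := by
      rw [MvPolynomial.monomial_mul, one_mul]
    simp only [e, map_mul, SetLike.mem_coe, Ideal.map_mul]
    refine Ideal.mul_mem_mul ?_ (by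
      rw [Ideal.map_prod_pow_eq hI]; exact Ideal.mem_span_singleton_self _)
    refine Ideal.map_mono (le_iSup₂ (f := fun i (_ : i ∈ Θ) ↦ I i) i hi) ?_
    rw [hI]; exact Ideal.mem_span_singleton_self _

end FlatRings

/-! ### Strict normal crossings -/

section NormalCrossing

open Scheme IdealSheafData

variable {X : Scheme.{0}} {s : X ⟶ SpecC} {l : ℕ} {Y : Fin l → X.IdealSheafData}

theorem specIdeal_injective {R : Type} [CommRing R] {K L : Ideal R}
    (h : specIdeal K = specIdeal L) : K = L :=
  le_antisymm (specIdeal_le_iff.mp h.le) (specIdeal_le_iff.mp h.ge)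

theorem SpecIso_hom_appTop_X {n : ℕ} (j : Fin n) :
    (AffineSpace.SpecIso (Fin n) (.of ℂ)).hom.appTop
      ((ΓSpecIso (.of (MvPolynomial (Fin n) ℂ))).inv (MvPolynomial.X j)) =
      AffineSpace.coord SpecC j := by
  have h := AffineSpace.SpecIso_inv_appTop_coord (n := Fin n) (.of ℂ) j
  have h1 := congrArg (AffineSpace.SpecIso (Fin n) (.of ℂ)).hom.appTop h
  rw [← appTop_comp_apply, Iso.hom_inv_id, Scheme.Hom.id_appTop] at h1
  exact h1.symm

theorem exists_hyperplane_comap {B : Type} [CommRing B] {n : ℕ}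
    (h : Spec (.of B) ⟶ 𝔸(Fin n; SpecC)) [Flat h] :
    ∃ ψ : MvPolynomial (Fin n) ℂ →+* B, ψ.Flat ∧
      ∀ j, (coordinateHyperplane n j).comap h = specIdeal (Ideal.span {ψ (MvPolynomial.X j)}) := by
  obtain ⟨ψ, hψ⟩ := Spec.map_surjective (h ≫ (AffineSpace.SpecIso (Fin n) (.of ℂ)).hom)
  have h1 : Flat (Spec.map ψ) := hψ ▸ inferInstance
  refine ⟨ψ.hom, Flat.SpecMap_iff.mp h1, fun j ↦ ?_⟩
  have h2 : coordinateHyperplane n j = (specIdeal (Ideal.span {MvPolynomial.X j})).comap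
      (AffineSpace.SpecIso (Fin n) (.of ℂ)).hom := by
    rw [specIdeal_span_singleton, principal_comap, SpecIso_hom_appTop_X]; rfl
  rw [h2, ← comap_comp, ← hψ]
  refine (specIdeal_comap ψ.hom _).trans ?_
  rw [Ideal.map_span, Set.image_singleton]

theorem mem_basicOpen_iff_notMem_primeIdealOf {U : X.Opens} (hU : IsAffineOpen U) (x : U)
    (a : Γ(X, U)) : x.1 ∈ X.basicOpen a ↔ a ∉ (hU.primeIdealOf x).asIdeal := by
  have h := congrArg (fun V : (Spec Γ(X, U)).Opens ↦ hU.primeIdealOf x ∈ V)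
    (hU.fromSpec_preimage_basicOpen a)
  rw [← hU.fromSpec_primeIdealOf x]
  exact h.to_iff

theorem exists_primeIdealOf_eq {U : X.Opens} (hU : IsAffineOpen U) (p : PrimeSpectrum Γ(X, U)) :
    ∃ x : U, hU.primeIdealOf x = p := by
  have := hU.isOpenImmersion_fromSpec
  have h : hU.fromSpec p ∈ U := by
    have h1 : hU.fromSpec p ∈ Set.range hU.fromSpec := ⟨p, rfl⟩
    rwa [hU.range_fromSpec] at h1
  exact ⟨⟨_, h⟩, hU.fromSpec.isOpenEmbedding.injective (hU.fromSpec_primeIdealOf ⟨_, h⟩)⟩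

/-- The étale chart is localized at a point above the one corresponding to `p`; the resulting local
ring is flat over `X` and over affine space. Components through the point become distinct variables,
and the others become the unit ideal, with exponent `0`. -/
theorem IsStrictNormalCrossing.hasMonomialChart (hY : IsStrictNormalCrossing s Y)
    (U : X.affineOpens) (p : Ideal Γ(X, U.1)) (hp : p.IsPrime) :
    HasMonomialChart (fun i ↦ (Y i).ideal U) p := by
  classical
  obtain ⟨x, hx⟩ := exists_primeIdealOf_eq U.2 ⟨p, hp⟩
  obtain ⟨V, n, g, h, σ, hg, hh, -, ⟨u, hu⟩, hσ, hs⟩ := hY.exists_chart x.1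
  obtain ⟨W, hW, huW, hWU⟩ := TopologicalSpace.Opens.isBasis_iff_nbhd.mp V.isBasis_affineOpens
    (U := g ⁻¹ᵁ U.1) (x := u) (by change g u ∈ U.1; rw [hu]; exact x.2)
  replace hW : IsAffineOpen W := hW
  have : IsOpenImmersion hW.fromSpec := hW.isOpenImmersion_fromSpec
  obtain ⟨ψ, hψ, hψh⟩ := exists_hyperplane_comap (B := Γ(V, W)) (hW.fromSpec ≫ h)
  have hφ : (g.appLE U.1 W hWU).hom.Flat :=
    HasRingHomProperty.appLE @Flat g inferInstance U ⟨W, hW⟩ hWU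
  let P := (hW.primeIdealOf ⟨u, huW⟩).asIdeal
  have hP : P.comap (g.appLE U.1 W hWU).hom = p := by
    have h1 := IsAffineOpen.comap_primeIdealOf_appLE U.1 U.2 W hW hWU huW
    have h2 : (⟨g u, hWU huW⟩ : U.1) = x := Subtype.ext hu
    rw [h2, hx] at h1
    exact congrArg PrimeSpectrum.asIdeal h1
  have hI (i) (hi : x.1 ∈ (Y i).support) : ((Y i).ideal U).map (g.appLE U.1 W hWU).hom =
      Ideal.span {ψ (MvPolynomial.X (σ ⟨i, hi⟩))} := by
    refine specIdeal_injective ?_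
    rw [← hψh, comap_comp, ← hs ⟨i, hi⟩, ← comap_comp, ← U.2.SpecMap_appLE_fromSpec g hW hWU,
      comap_comp, comap_fromSpec]
    exact (specIdeal_comap _ _).symm
  have hL : (algebraMap Γ(V, W) (Localization.AtPrime P)).Flat :=
    RingHom.flat_algebraMap_iff.mpr (IsLocalization.flat _ P.primeCompl)
  refine ⟨Localization.AtPrime P, inferInstance, inferInstance,
    (algebraMap _ _).comp (g.appLE U.1 W hWU).hom, n, (algebraMap _ _).comp ψ,
    fun i ↦ if hi : x.1 ∈ (Y i).support then Finsupp.single (σ ⟨i, hi⟩) 1 else 0,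
    hφ.comp hL, ?_, hψ.comp hL, fun i c ↦ ?_, fun i j hij c ↦ ?_, fun i ↦ ?_⟩
  · rw [← hP, ← Ideal.comap_comap]
    exact congrArg _ Localization.AtPrime.under_maximalIdeal
  · dsimp only
    split_ifs with hi
    · rw [Finsupp.single_apply]; split_ifs <;> simp
    · simp
  · by_cases hi : x.1 ∈ (Y i).support
    · by_cases hj : x.1 ∈ (Y j).support
      · simp only [hi, hj, dif_pos, Finsupp.single_apply]
        by_contra! hc
        simp only [ne_eq, ite_eq_right_iff, one_ne_zero, imp_false, not_not] at hc
        exact hij (congrArg Subtype.val (hσ (hc.1.trans hc.2.symm)))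
      · right; simp [hj]
    · left; simp [hi]
  · dsimp only
    split_ifs with hi
    · rw [← Ideal.map_map, hI i hi, Ideal.map_span, Set.image_singleton]
      rfl
    · have h1 : ¬ (Y i).ideal U ≤ p := by
        intro hle
        refine hi ((mem_support_iff_of_mem x.2).mpr ((X.mem_zeroLocus_iff _ _).mpr fun a ha ↦ ?_))
        rw [mem_basicOpen_iff_notMem_primeIdealOf U.2, hx, not_not]
        exact hle ha
      obtain ⟨a, ha, hap⟩ := SetLike.not_le_iff_exists.mp h1
      rw [show MvPolynomial.monomial (0 : Fin n →₀ ℕ) (1 : ℂ) = 1 from rfl, map_one,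
        Ideal.span_singleton_one]
      refine Ideal.eq_top_of_isUnit_mem _ (Ideal.mem_map_of_mem _ ha) ?_
      refine IsLocalization.map_units (Localization.AtPrime P)
        (⟨(g.appLE U.1 W hWU).hom a, fun h2 ↦ hap ?_⟩ : P.primeCompl)
      rw [← hP]; exact h2

/-- In the flat local ring the ideal is generated by the image of a nonzero monomial, which is
regular by flatness. Finite type over `ℂ` makes `X` locally Noetherian, so the generator descends to
a neighbourhood. -/
theorem IsStrictNormalCrossing.isEffectiveCartier [LocallyOfFiniteType s]
    (hY : IsStrictNormalCrossing s Y) (i : Fin l) : IsEffectiveCartier (Y i) := by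
  intro x
  obtain ⟨U, hU⟩ := TopologicalSpace.Opens.mem_iSup.mp
      ((iSup_affineOpens_eq_top X).ge (Set.mem_univ x))
  have : IsLocallyNoetherian X := LocallyOfFiniteType.isLocallyNoetherian s
  have : IsNoetherianRing Γ(X, U.1) := IsLocallyNoetherian.component_noetherian U
  obtain ⟨L, _, _, φ, n, ψ, v, hφ, hp, hψ, -, -, hI⟩ :=
    hY.hasMonomialChart U _ (U.2.primeIdealOf ⟨x, hU⟩).2
  obtain ⟨f, hf, h⟩ := hφ.exists_isLocalization_span_singleton (hψ.map_mem_nonZeroDivisors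
    (x := MvPolynomial.monomial (v i) 1) (mem_nonZeroDivisors_of_ne_zero (by simp))) (hI i)
  let := (X.presheaf.map (homOfLE (X.basicOpen_le f)).op).hom.toAlgebra
  have : IsLocalization.Away f Γ(X, X.basicOpen f) := U.2.isLocalization_basicOpen f
  obtain ⟨a, ha, e⟩ := h Γ(X, X.basicOpen f)
  refine ⟨X.affineBasicOpen f, ?_, a, ha, ?_⟩
  · rw [hp] at hf
    exact (mem_basicOpen_iff_notMem_primeIdealOf U.2 ⟨x, hU⟩ f).mpr hf
  · rw [← (Y i).map_ideal_basicOpen U f]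
    exact e

theorem IsStrictNormalCrossing.isRegularFamily [LocallyOfFiniteType s]
    (hY : IsStrictNormalCrossing s Y) : IsRegularFamily Y :=
  ⟨hY.isEffectiveCartier, fun _ _ hij U ↦
    inf_le_mul_of_hasMonomialChart (hY.hasMonomialChart U) hij⟩

end NormalCrossing

/-! ### Symbols in the associated graded ring -/

section Symbols

variable {A B : Type} [CommRing A] [CommRing B]

/-- The class in degree `d` of an element of `J ^ d`. -/
noncomputable def AssocGraded.sym (J : Ideal A) (d : ℕ) : ↥(J ^ d) →+ AssocGraded J where
  toFun a := Ideal.Quotient.mk _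
    (⟨Polynomial.monomial d a.1, reesAlgebra.monomial_mem.mpr a.2⟩ : reesAlgebra J)
  map_zero' := congrArg (Ideal.Quotient.mk _) (Subtype.ext (map_zero (Polynomial.monomial d)))
  map_add' a b := congrArg (Ideal.Quotient.mk _)
    (Subtype.ext (map_add (Polynomial.monomial d) a.1 b.1))

namespace AssocGraded

variable {J : Ideal A}

theorem sym_congr {d e : ℕ} (h : d = e) {a : ↥(J ^ d)} {b : ↥(J ^ e)} (hab : a.1 = b.1) :
    sym J d a = sym J e b := by
  subst h
  exact congrArg _ (Subtype.ext hab)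

theorem sym_mul_sym {d e : ℕ} (a : ↥(J ^ d)) (b : ↥(J ^ e)) :
    sym J d a * sym J e b =
      sym J (d + e) ⟨a.1 * b.1, by rw [pow_add]; exact Ideal.mul_mem_mul a.2 b.2⟩ :=
  congrArg (Ideal.Quotient.mk _) (Subtype.ext (Polynomial.monomial_mul_monomial d e a.1 b.1))

theorem sym_zero_eq (a : A) (ha : a ∈ J ^ 0) : sym J 0 ⟨a, ha⟩ = algebraMap A _ a := rfl

theorem sym_eq_zero {d : ℕ} (a : ↥(J ^ d)) (ha : a.1 ∈ J ^ (d + 1)) : sym J d a = 0 := by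
  obtain ⟨a, h⟩ := a
  refine Ideal.Quotient.eq_zero_iff_mem.mpr ?_
  dsimp only at ha
  rw [pow_succ'] at ha
  suffices key : ∃ h : a ∈ J ^ d, (⟨Polynomial.monomial d a, reesAlgebra.monomial_mem.mpr h⟩ :
      reesAlgebra J) ∈ J.map (algebraMap A (reesAlgebra J)) from key.2
  refine Submodule.mul_induction_on ha (fun x hx y hy ↦ ?_) (fun x y ⟨hx, hx'⟩ ⟨hy, hy'⟩ ↦ ?_)
  · refine ⟨Ideal.mul_mem_left _ _ hy, ?_⟩
    have e : (⟨Polynomial.monomial d (x * y), reesAlgebra.monomial_mem.mpr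
        (Ideal.mul_mem_left _ _ hy)⟩ : reesAlgebra J) = algebraMap A (reesAlgebra J) x *
          ⟨Polynomial.monomial d y, reesAlgebra.monomial_mem.mpr hy⟩ :=
      Subtype.ext (Polynomial.C_mul_monomial (a := x) (b := y)).symm
    rw [e]
    exact Ideal.mul_mem_right _ _ (Ideal.mem_map_of_mem _ hx)
  · refine ⟨Ideal.add_mem _ hx hy, ?_⟩
    have e : (⟨Polynomial.monomial d (x + y), reesAlgebra.monomial_mem.mpr
        (Ideal.add_mem _ hx hy)⟩ : reesAlgebra J) =
          ⟨Polynomial.monomial d x, reesAlgebra.monomial_mem.mpr hx⟩ +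
          ⟨Polynomial.monomial d y, reesAlgebra.monomial_mem.mpr hy⟩ :=
      Subtype.ext (map_add (Polynomial.monomial d) x y)
    rw [e]
    exact Ideal.add_mem _ hx' hy'

theorem coeff_mem_of_mem_map {p : reesAlgebra J} (hp : p ∈ J.map (algebraMap A (reesAlgebra J)))
    (d : ℕ) : p.1.coeff d ∈ J ^ (d + 1) := by
  refine Submodule.span_induction (p := fun p _ ↦ ∀ d, p.1.coeff d ∈ J ^ (d + 1)) ?_ ?_ ?_ ?_ hp d
  · rintro _ ⟨x, hx, rfl⟩ d
    change (Polynomial.C x).coeff d ∈ _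
    rw [Polynomial.coeff_C]
    split_ifs with h
    · subst h; simpa using hx
    · exact Ideal.zero_mem _
  · exact fun _ ↦ Ideal.zero_mem _
  · intro p q _ _ hp hq d
    exact (Polynomial.coeff_add p.1 q.1 d).symm ▸ Ideal.add_mem _ (hp d) (hq d)
  · intro c q _ hq d
    have e : (c • q).1.coeff d = (c.1 * q.1).coeff d := rfl
    rw [e, Polynomial.coeff_mul]
    refine Ideal.sum_mem _ fun ij h ↦ ?_
    rw [← Finset.HasAntidiagonal.mem_antidiagonal.mp h, add_assoc, pow_add]
    exact Ideal.mul_mem_mul (c.2 _) (hq _)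

theorem mk_eq_sum_sym (p : reesAlgebra J) :
    (Ideal.Quotient.mk _ p : AssocGraded J) =
      ∑ d ∈ p.1.support, sym J d ⟨p.1.coeff d, p.2 d⟩ := by
  refine Eq.trans ?_ (map_sum (Ideal.Quotient.mk (J.map (algebraMap A (reesAlgebra J))))
    (fun d ↦ (⟨Polynomial.monomial d (p.1.coeff d), reesAlgebra.monomial_mem.mpr (p.2 d)⟩ :
      reesAlgebra J)) p.1.support)
  refine congrArg _ (Subtype.ext ?_)
  refine p.1.as_sum_support.trans ?_
  exact (map_sum (reesAlgebra J).val (fun d ↦ (⟨Polynomial.monomial d (p.1.coeff d),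
    reesAlgebra.monomial_mem.mpr (p.2 d)⟩ : reesAlgebra J)) p.1.support).symm

theorem map_sym (φ : A →+* B) (K : Ideal B) (h : J.map φ ≤ K) {d : ℕ} (a : ↥(J ^ d)) :
    AssocGraded.map φ J K h (sym J d a) = sym K d ⟨φ a.1, Ideal.pow_right_mono h d (by
      rw [← Ideal.map_pow]; exact Ideal.mem_map_of_mem φ a.2)⟩ :=
  congrArg (Ideal.Quotient.mk _) (Subtype.ext (Polynomial.map_monomial φ))

end AssocGraded

/-! ### Specialization of the variables of the extended Rees algebra to 1 and 0. -/

section Specialization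

variable {G : Type} [CommRing G] {l : ℕ}

namespace extendedRees

/-- The weight of the monomial `T ^ n` with respect to the variables outside `Θ`. -/
def weight (Θ : Finset (Fin l)) (n : Fin l → ℤ) : ℕ := ∑ i ∈ Θᶜ, negExp (n i)

theorem piece_le_pow (I : Fin l → Ideal A) (Θ : Finset (Fin l)) (n : Fin l → ℤ) :
    piece I n ≤ (⨆ i ∈ Θᶜ, I i) ^ weight Θ n := by
  rw [piece, ← Finset.prod_mul_prod_compl Θ, weight, ← Finset.prod_pow_eq_pow_sum]
  refine Ideal.mul_le_right.trans (Finset.prod_le_prod' fun i hi ↦ Ideal.pow_right_mono ?_ _)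
  exact le_iSup₂ (f := fun i (_ : i ∈ Θᶜ) ↦ I i) i hi

open Classical in
/-- Specialization at `T_i = 1` for `i ∈ Θ` and `T_i = 0` otherwise, on the monomials `a T ^ n`. -/
noncomputable def symOfPiece (I : Fin l → Ideal A) (Θ : Finset (Fin l)) (n : Fin l → ℤ) :
    piece I n →+ AssocGraded (⨆ i ∈ Θᶜ, I i) :=
  if ∀ i ∈ Θᶜ, n i ≤ 0 then
    (AssocGraded.sym _ (weight Θ n)).comp
      (Submodule.inclusion (piece_le_pow I Θ n)).toAddMonoidHom
  else 0

variable {I : Fin l → Ideal A} {Θ : Finset (Fin l)}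

theorem symOfPiece_of_nonpos {n : Fin l → ℤ} (h : ∀ i ∈ Θᶜ, n i ≤ 0) (a : piece I n) :
    symOfPiece I Θ n a = AssocGraded.sym _ (weight Θ n) ⟨a.1, piece_le_pow I Θ n a.2⟩ := by
  rw [symOfPiece, if_pos h]; rfl

theorem symOfPiece_of_pos {n : Fin l → ℤ} {i : Fin l} (hi : i ∈ Θᶜ) (h : 0 < n i)
    (a : piece I n) : symOfPiece I Θ n a = 0 := by
  rw [symOfPiece, if_neg fun hc ↦ (hc i hi).not_gt h]; rfl

theorem mul_mem_pow_weight {n m : Fin l → ℤ} (a : piece I n) (b : piece I m) :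
    a.1 * b.1 ∈ (⨆ i ∈ Θᶜ, I i) ^ (weight Θ n + weight Θ m) := by
  rw [pow_add]
  exact Ideal.mul_mem_mul (piece_le_pow I Θ n a.2) (piece_le_pow I Θ m b.2)

theorem weight_add_lt {n m : Fin l → ℤ} (h : ∀ i ∈ Θᶜ, n i + m i ≤ 0) {i : Fin l} (hi : i ∈ Θᶜ)
    (hn : 0 < n i) : weight Θ (n + m) + 1 ≤ weight Θ n + weight Θ m := by
  rw [weight, weight, weight, ← Finset.sum_add_distrib]
  refine Nat.succ_le_of_lt (Finset.sum_lt_sum (fun i _ ↦ ?_) ⟨i, hi, ?_⟩)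
  · simp only [negExp, Pi.add_apply]; lia
  · have := h i hi
    simp only [negExp, Pi.add_apply]; lia

/-- A positive exponent outside `Θ` in one factor either survives in the product, or cancels against
a negative one. In the latter case the weight drops, so the coefficient lies in a higher power of
the ideal than the weight and its symbol is zero. -/
theorem symOfPiece_mul_of_pos {n m : Fin l → ℤ} {i : Fin l} (hi : i ∈ Θᶜ) (hn : 0 < n i)
    (a : piece I n) (b : piece I m) {c : piece I (n + m)} (hc : c.1 = a.1 * b.1) :
    symOfPiece I Θ (n + m) c = 0 := by
  by_cases h : ∀ i ∈ Θᶜ, n i + m i ≤ 0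
  · refine (symOfPiece_of_nonpos h c).trans (AssocGraded.sym_eq_zero _ ?_)
    rw [hc]
    exact Ideal.pow_le_pow_right (weight_add_lt h hi hn) (mul_mem_pow_weight a b)
  · push Not at h
    obtain ⟨j, hj, h⟩ := h
    exact symOfPiece_of_pos hj h c

theorem symOfPiece_mul {n m : Fin l → ℤ} (a : piece I n) (b : piece I m) {c : piece I (n + m)}
    (hc : c.1 = a.1 * b.1) :
    symOfPiece I Θ (n + m) c = symOfPiece I Θ n a * symOfPiece I Θ m b := by
  by_cases hn : ∀ i ∈ Θᶜ, n i ≤ 0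
  · by_cases hm : ∀ i ∈ Θᶜ, m i ≤ 0
    · refine (symOfPiece_of_nonpos (fun i hi ↦ by
          have := hn i hi; have := hm i hi; simp only [Pi.add_apply]; lia) c).trans
        ((AssocGraded.sym_congr ?_ hc).trans ((AssocGraded.sym_mul_sym _ _).symm.trans
        (congrArg₂ (· * ·) (symOfPiece_of_nonpos hn a).symm (symOfPiece_of_nonpos hm b).symm)))
      rw [weight, weight, weight, ← Finset.sum_add_distrib]
      refine Finset.sum_congr rfl fun i hi ↦ ?_
      have := hn i hi
      have := hm i hi
      simp only [negExp, Pi.add_apply]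
      lia
    · push Not at hm
      obtain ⟨i, hi, h⟩ := hm
      have hc' : symOfPiece I Θ (m + n) ⟨c.1, by rw [add_comm]; exact c.2⟩ = 0 :=
        symOfPiece_mul_of_pos hi h b a (hc.trans (mul_comm _ _))
      have e : ∀ (k : Fin l → ℤ) (hk : n + m = k) (hck : c.1 ∈ piece I k),
          symOfPiece I Θ (n + m) c = symOfPiece I Θ k ⟨c.1, hck⟩ := by
        rintro _ rfl _; rfl
      rw [symOfPiece_of_pos hi h b, mul_zero]
      exact (e _ (add_comm n m) _).trans hc'
  · push Not at hn
    obtain ⟨i, hi, h⟩ := hn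
    rw [symOfPiece_mul_of_pos hi h a b hc, symOfPiece_of_pos hi h a, zero_mul]

theorem symOfPiece_eq_algebraMap {n : Fin l → ℤ} (h : ∀ i ∈ Θᶜ, n i = 0) (a : piece I n) :
    symOfPiece I Θ n a = algebraMap A _ a.1 := by
  have hw : weight Θ n = 0 := Finset.sum_eq_zero fun j hj ↦ by rw [h j hj]; rfl
  have ha : a.1 ∈ (⨆ i ∈ Θᶜ, I i) ^ 0 := by rw [pow_zero, Ideal.one_eq_top]; trivial
  rw [symOfPiece_of_nonpos fun i hi ↦ (h i hi).le, ← AssocGraded.sym_zero_eq a.1 ha]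
  exact AssocGraded.sym_congr hw rfl

theorem symOfPiece_one (I : Fin l → Ideal A) (Θ : Finset (Fin l)) :
    symOfPiece I Θ 0 ⟨1, mem_piece le_rfl 1⟩ = 1 := by
  rw [symOfPiece_eq_algebraMap (n := 0) fun _ _ ↦ rfl, map_one]

/-- Specialization at `T_i = 1` for `i ∈ Θ` and `T_i = 0` otherwise. -/
noncomputable def toAssocGraded (I : Fin l → Ideal A) (Θ : Finset (Fin l)) :
    extendedRees I →+* AssocGraded (⨆ i ∈ Θᶜ, I i) :=
  liftRingHom (symOfPiece I Θ) (symOfPiece_one I Θ) (fun _ _ a b ↦ symOfPiece_mul a b rfl)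

theorem toAssocGraded_single (n : Fin l → ℤ) (a : piece I n) :
    toAssocGraded I Θ (single n a) = symOfPiece I Θ n a :=
  liftRingHom_single _ _ _ n a

theorem toAssocGraded_algebraMap (a : A) :
    toAssocGraded I Θ (algebraMap A _ a) = algebraMap A _ a := by
  rw [algebraMap_eq_single, toAssocGraded_single]
  exact symOfPiece_eq_algebraMap (fun _ _ ↦ rfl) _

theorem toAssocGraded_T_of_mem {i : Fin l} (hi : i ∈ Θ) : toAssocGraded I Θ (T I i) = 1 := by
  classical
  have h : ∀ j ∈ Θᶜ, (Pi.single i 1 : Fin l → ℤ) j = 0 := fun j hj ↦ by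
    have hji : j ≠ i := by rintro rfl; exact Finset.mem_compl.mp hj hi
    exact Pi.single_eq_of_ne (M := fun _ ↦ ℤ) hji 1
  rw [T_eq_single, toAssocGraded_single]
  exact (symOfPiece_eq_algebraMap h _).trans (map_one _)

theorem toAssocGraded_T_of_notMem {i : Fin l} (hi : i ∉ Θ) : toAssocGraded I Θ (T I i) = 0 := by
  classical
  rw [T_eq_single, toAssocGraded_single]
  exact symOfPiece_of_pos (Finset.mem_compl.mpr hi) (by simp) _

theorem pow_iSup_le (I : Fin l → Ideal A) (Θ : Finset (Fin l)) (d : ℕ) :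
    (⨆ i ∈ Θ, I i) ^ d ≤
      ⨆ k ∈ {k : Fin l → ℕ | (∀ i ∉ Θ, k i = 0) ∧ ∑ i, k i = d}, ∏ i, I i ^ k i := by
  classical
  rw [← Finset.sup_eq_iSup, ← Ideal.sum_eq_sup, Finset.sum_pow_eq_sum_piAntidiag,
    Ideal.sum_eq_sup, Finset.sup_le_iff]
  intro k hk
  obtain ⟨h1, h2⟩ := Finset.mem_piAntidiag.mp hk
  have h3 : ∀ i ∉ Θ, k i = 0 := fun i hi ↦ by
    by_contra hn
    exact hi (h2 i hn)
  refine Ideal.mul_le_right.trans (le_trans ?_ (le_iSup₂ k ⟨h3, ?_⟩))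
  · rw [← Finset.prod_mul_prod_compl Θ, Finset.prod_eq_one (s := Θᶜ) fun i hi ↦ by
      rw [h3 i (Finset.mem_compl.mp hi), pow_zero], mul_one]
  · rw [← h1]
    exact (Finset.sum_subset (Finset.subset_univ Θ) fun i _ hi ↦ h3 i hi).symm

/-- The power `J ^ d` is the sum of the products of the `I_i ^ k_i` of total degree `d`, and the
class of an element `x` of such a product is the image of `x T^{-k}`. -/
theorem toAssocGraded_surjective (I : Fin l → Ideal A) (Θ : Finset (Fin l)) :
    Function.Surjective (toAssocGraded I Θ) := by
  have h : ∀ d (a : ↥((⨆ i ∈ Θᶜ, I i) ^ d)),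
      AssocGraded.sym _ d a ∈ (toAssocGraded I Θ).range := by
    rintro d ⟨a, ha⟩
    suffices ∃ h, AssocGraded.sym (⨆ i ∈ Θᶜ, I i) d ⟨a, h⟩ ∈ (toAssocGraded I Θ).range from this.2
    have h1 := pow_iSup_le I Θᶜ d ha
    rw [iSup_subtype'] at h1
    refine Submodule.iSup_induction _ (motive := fun a ↦ ∃ h,
      AssocGraded.sym (⨆ i ∈ Θᶜ, I i) d ⟨a, h⟩ ∈ (toAssocGraded I Θ).range) h1 ?_ ?_ ?_
    · rintro ⟨k, hk, hkd⟩ x hx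
      let n : Fin l → ℤ := fun i ↦ -k i
      have hn : ∀ i, negExp (n i) = k i := fun i ↦ by simp [negExp, n]
      have hw : weight Θ n = d := by
        rw [weight, ← hkd]
        simp only [hn]
        exact Finset.sum_subset (Finset.subset_univ _) fun i _ hi ↦ hk i hi
      have hx' : x ∈ piece I n := by simpa only [piece, hn] using hx
      refine ⟨hw ▸ piece_le_pow I Θ n hx', single n ⟨x, hx'⟩, ?_⟩
      rw [toAssocGraded_single, symOfPiece_of_nonpos fun i _ ↦ by simp [n]]
      exact AssocGraded.sym_congr hw rfl
    · exact ⟨Ideal.zero_mem _, 0, by rw [map_zero]; exact (map_zero (AssocGraded.sym _ d)).symm⟩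
    · rintro x y ⟨hx, x', hx'⟩ ⟨hy, y', hy'⟩
      exact ⟨Ideal.add_mem _ hx hy, x' + y', by
        rw [map_add, hx', hy']; exact (map_add (AssocGraded.sym _ d) ⟨x, hx⟩ ⟨y, hy⟩).symm⟩
  intro z
  obtain ⟨p, rfl⟩ := Ideal.Quotient.mk_surjective z
  have e := AssocGraded.mk_eq_sum_sym p
  have h2 : ∑ d ∈ p.1.support, AssocGraded.sym _ d ⟨p.1.coeff d, p.2 d⟩ ∈
      (toAssocGraded I Θ).range := Subring.sum_mem _ fun d _ ↦ h d _
  exact e ▸ h2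

end extendedRees

end Specialization

end Symbols

/-! ### The fibres of the extended Rees algebra -/

section Fibres

variable {A B G : Type} [CommRing A] [CommRing B] [CommRing G] {l : ℕ}

namespace extendedRees

variable {I : Fin l → Ideal A} {Θ : Finset (Fin l)}

theorem single_congr {n m : Fin l → ℤ} (h : n = m) {a : piece I n} {b : piece I m}
    (hab : a.1 = b.1) : single n a = single m b := by
  subst h
  exact congrArg _ (Subtype.ext hab)

theorem T_mul_single {i : Fin l} {n m : Fin l → ℤ} (h : Pi.single i 1 + n = m) {a : piece I n}
    {b : piece I m} (hab : a.1 = b.1) : T I i * single n a = single m b := by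
  rw [T_eq_single, single_mul_single]
  exact single_congr h ((one_mul a.1).trans hab)

/-- Rescaling of the values at the variables `T_i` by units. -/
noncomputable def twist (w : Fin l → Gˣ) (ψ : extendedRees I →+* G) : extendedRees I →+* G :=
  liftRingHom (fun n ↦
    { toFun := fun a ↦ ψ (single n a) * ↑(∏ i, w i ^ n i)
      map_zero' := by rw [single_zero, map_zero, zero_mul]
      map_add' := fun a b ↦ by rw [single_add, map_add, add_mul] })
    (by
      have e : single 0 ⟨1, mem_piece le_rfl 1⟩ = (1 : extendedRees I) := rfl
      simp [e])
    (fun n m a b ↦ by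
      have e : ∏ i, w i ^ (n + m) i = (∏ i, w i ^ n i) * ∏ i, w i ^ m i := by
        rw [← Finset.prod_mul_distrib]
        exact Finset.prod_congr rfl fun i _ ↦ zpow_add _ _ _
      change ψ (single (n + m) ⟨a.1 * b.1, _⟩) * _ = ψ (single n a) * _ * (ψ (single m b) * _)
      rw [← single_mul_single, map_mul, e, Units.val_mul]
      ring)

theorem twist_single (w : Fin l → Gˣ) (ψ : extendedRees I →+* G) (n : Fin l → ℤ) (a : piece I n) :
    twist w ψ (single n a) = ψ (single n a) * ↑(∏ i, w i ^ n i) :=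
  liftRingHom_single _ _ _ n a

theorem twist_algebraMap (w : Fin l → Gˣ) (ψ : extendedRees I →+* G) (a : A) :
    twist w ψ (algebraMap A _ a) = ψ (algebraMap A _ a) := by
  rw [algebraMap_eq_single, twist_single]
  simp

theorem twist_T (w : Fin l → Gˣ) (ψ : extendedRees I →+* G) (i : Fin l) :
    twist w ψ (T I i) = ψ (T I i) * w i := by
  classical
  rw [T_eq_single, twist_single]
  congr 2
  refine (Finset.prod_eq_single i (fun j _ hj ↦ ?_) (by simp)).trans ?_
  · rw [Pi.single_eq_of_ne hj, zpow_zero]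
  · rw [Pi.single_eq_same, zpow_one]

theorem ringHom_ext {ψ ψ' : extendedRees I →+* G} (h : ∀ n a, ψ (single n a) = ψ' (single n a)) :
    ψ = ψ' :=
  RingHom.ext fun p ↦ DFunLike.congr_fun
    (addHom_ext (f := ψ.toAddMonoidHom) (g := ψ'.toAddMonoidHom) h) p

theorem twist_twist_inv (w : Fin l → Gˣ) (ψ : extendedRees I →+* G) :
    twist w (twist w⁻¹ ψ) = ψ := by
  refine ringHom_ext fun n a ↦ ?_
  rw [twist_single, twist_single, mul_assoc, ← Units.val_mul, ← Finset.prod_mul_distrib]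
  simp

theorem comp_twist (w : Fin l → Gˣ) (ψ : extendedRees I →+* G) (ρ : G →+* B) :
    ρ.comp (twist w ψ) = twist (fun i ↦ Units.map ρ.toMonoidHom (w i)) (ρ.comp ψ) := by
  refine ringHom_ext fun n a ↦ ?_
  rw [twist_single, RingHom.comp_apply, twist_single, map_mul, RingHom.comp_apply]
  congr 1
  simp only [Units.coe_prod, map_prod, ← map_zpow, Units.coe_map]
  rfl

theorem twist_injective (w : Fin l → Gˣ) {ψ ψ' : extendedRees I →+* G}
    (h : twist w ψ = twist w ψ') : ψ = ψ' := by
  refine ringHom_ext fun n a ↦ ?_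
  have h1 := DFunLike.congr_fun h (single n a)
  rw [twist_single, twist_single] at h1
  exact (Units.isUnit _).mul_right_cancel h1

theorem map_mem_piece {φ : A →+* B} {K : Fin l → Ideal B} (h : ∀ i, (I i).map φ ≤ K i)
    {n : Fin l → ℤ} (a : piece I n) : φ a.1 ∈ piece K n := by
  refine (?_ : (piece I n).map φ ≤ piece K n) (Ideal.mem_map_of_mem φ a.2)
  rw [piece, ← Ideal.mapHom_apply, map_prod]
  refine Finset.prod_le_prod' fun i _ ↦ ?_
  rw [map_pow]
  exact Ideal.pow_right_mono (h i) _

/-- The homomorphism of extended Rees algebras induced by a ring homomorphism. -/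
noncomputable def map (φ : A →+* B) (K : Fin l → Ideal B) (h : ∀ i, (I i).map φ ≤ K i) :
    extendedRees I →+* extendedRees K :=
  liftRingHom (fun n ↦
    { toFun := fun a ↦ single n ⟨φ a.1, map_mem_piece h a⟩
      map_zero' := (single_congr rfl (map_zero φ)).trans (single_zero n)
      map_add' := fun a b ↦ (single_congr rfl (map_add φ a.1 b.1)).trans
        (single_add n ⟨φ a.1, map_mem_piece h a⟩ ⟨φ b.1, map_mem_piece h b⟩) })
    (single_congr (n := 0) (m := 0) rfl (map_one φ) :
      single 0 ⟨φ 1, _⟩ = single 0 ⟨1, mem_piece le_rfl 1⟩)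
    (fun n m a b ↦ (single_congr rfl (map_mul φ a.1 b.1) :
      single (n + m) ⟨φ (a.1 * b.1), map_mem_piece h ⟨_, mul_mem_piece a.2 b.2⟩⟩ =
        single (n + m) ⟨φ a.1 * φ b.1,
          mul_mem_piece (map_mem_piece h a) (map_mem_piece h b)⟩).trans
      (single_mul_single ⟨φ a.1, map_mem_piece h a⟩ ⟨φ b.1, map_mem_piece h b⟩).symm)

theorem map_single (φ : A →+* B) (K : Fin l → Ideal B) (h : ∀ i, (I i).map φ ≤ K i)
    (n : Fin l → ℤ) (a : piece I n) :
    map φ K h (single n a) = single n ⟨φ a.1, map_mem_piece h a⟩ :=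
  liftRingHom_single _ _ _ n a

theorem map_algebraMap (φ : A →+* B) (K : Fin l → Ideal B) (h : ∀ i, (I i).map φ ≤ K i) (a : A) :
    map φ K h (algebraMap A _ a) = algebraMap B _ (φ a) := by
  rw [algebraMap_eq_single]
  exact map_single φ K h 0 ⟨a, _⟩

theorem map_T (φ : A →+* B) (K : Fin l → Ideal B) (h : ∀ i, (I i).map φ ≤ K i) (i : Fin l) :
    map φ K h (T I i) = T K i := by
  rw [T_eq_single]
  rw [map_single, T_eq_single]
  exact single_congr rfl (map_one φ)

theorem toAssocGraded_map (φ : A →+* B) (K : Fin l → Ideal B) (h : ∀ i, (I i).map φ ≤ K i)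
    (Θ : Finset (Fin l)) (hJ : (⨆ i ∈ Θᶜ, I i).map φ ≤ ⨆ i ∈ Θᶜ, K i) :
    (toAssocGraded K Θ).comp (map φ K h) =
      (AssocGraded.map φ _ _ hJ).comp (toAssocGraded I Θ) := by
  refine ringHom_ext fun n a ↦ ?_
  rw [RingHom.comp_apply, RingHom.comp_apply, map_single, toAssocGraded_single, toAssocGraded_single]
  by_cases hn : ∀ i ∈ Θᶜ, n i ≤ 0
  · rw [symOfPiece_of_nonpos hn, symOfPiece_of_nonpos hn, AssocGraded.map_sym]
  · push Not at hn
    obtain ⟨i, hi, hn⟩ := hn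
    rw [symOfPiece_of_pos hi hn, symOfPiece_of_pos hi hn, map_zero]

theorem eq_sum_single (p : extendedRees I) :
    p = ∑ n ∈ p.1.coeff.support, single n ⟨p.1.coeff n, p.2 n⟩ := by
  refine Subtype.ext ?_
  rw [AddSubmonoidClass.coe_finsetSum]
  exact (AddMonoidAlgebra.sum_coeff_single p.1).symm

/-- Where `T_i = 1` the exponent of `T_i` can be dropped, and where `T_i = 0` monomials with
positive exponent vanish. The representative `q` serves all targets at once, so that an arbitrary
`ψ` can be compared with `toAssocGraded`. -/
theorem exists_normalForm (Θ : Finset (Fin l)) (p : extendedRees I) :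
    ∃ q : extendedRees I, (∀ n, q.1.coeff n ≠ 0 → (∀ i ∈ Θ, n i = 0) ∧ ∀ i ∈ Θᶜ, n i ≤ 0) ∧
      ∀ (G : Type) [CommRing G] (ψ : extendedRees I →+* G), (∀ i ∈ Θ, ψ (T I i) = 1) →
        (∀ i ∉ Θ, ψ (T I i) = 0) → ψ p = ψ q := by
  classical
  refine induction (P := fun p ↦ ∃ q : extendedRees I,
    (∀ n, q.1.coeff n ≠ 0 → (∀ i ∈ Θ, n i = 0) ∧ ∀ i ∈ Θᶜ, n i ≤ 0) ∧
      ∀ (G : Type) [CommRing G] (ψ : extendedRees I →+* G), (∀ i ∈ Θ, ψ (T I i) = 1) →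
        (∀ i ∉ Θ, ψ (T I i) = 0) → ψ p = ψ q) ?_ ?_ (fun n a ↦ ?_) p
  · exact ⟨0, fun n hn ↦ absurd rfl hn, fun _ _ _ _ _ ↦ rfl⟩
  · rintro p p' ⟨q, hq, h⟩ ⟨q', hq', h'⟩
    refine ⟨q + q', fun n hn ↦ ?_, fun G _ ψ h1 h0 ↦ by
      rw [map_add, map_add, h G ψ h1 h0, h' G ψ h1 h0]⟩
    by_cases hz : q.1.coeff n = 0
    · refine hq' n fun hz' ↦ hn ?_
      have e : (q + q').1.coeff n = q.1.coeff n + q'.1.coeff n := rfl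
      rw [e, hz, hz', add_zero]
    · exact hq n hz
  · by_cases hn : ∀ i ∈ Θᶜ, n i ≤ 0
    · let m : Fin l → ℤ := fun i ↦ if i ∈ Θ then 0 else n i
      let u : Fin l → ℕ := fun i ↦ if i ∈ Θ then negExp (n i) else 0
      let v : Fin l → ℕ := fun i ↦ if i ∈ Θ then (n i).toNat else 0
      have ham : a.1 ∈ piece I m := by
        refine (?_ : piece I n ≤ piece I m) a.2
        refine Finset.prod_le_prod' fun i _ ↦ Ideal.pow_le_pow_right ?_
        simp only [m]
        split_ifs
        · simp [negExp]
        · rfl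
      refine ⟨single m ⟨a.1, ham⟩, fun k hk ↦ ?_, fun G _ ψ h1 h0 ↦ ?_⟩
      · have hk : k = m := by
          by_contra hne
          exact hk (Finsupp.single_eq_of_ne hne)
        subst hk
        refine ⟨fun i hi ↦ if_pos hi, fun i hi ↦ ?_⟩
        simp only [m, if_neg (Finset.mem_compl.mp hi)]
        exact hn i hi
      · have e : (∏ i, T I i ^ u i) * single n a = (∏ i, T I i ^ v i) * single m ⟨a.1, ham⟩ := by
          rw [prod_T_pow, prod_T_pow, single_mul_single, single_mul_single]
          refine single_congr (funext fun i ↦ ?_) rfl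
          simp only [Pi.add_apply, u, v, m]
          split_ifs
          · simp only [negExp]; lia
          · simp
        have h2 : ∀ k : Fin l → ℕ, (∀ i ∉ Θ, k i = 0) → ψ (∏ i, T I i ^ k i) = 1 := fun k hk ↦ by
          rw [map_prod]
          refine Finset.prod_eq_one fun i _ ↦ ?_
          rw [map_pow]
          by_cases hi : i ∈ Θ
          · rw [h1 i hi, one_pow]
          · rw [hk i hi, pow_zero]
        have e' := congrArg ψ e
        rwa [map_mul, map_mul, h2 u fun i hi ↦ if_neg hi, h2 v fun i hi ↦ if_neg hi, one_mul,
          one_mul] at e'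
    · push Not at hn
      obtain ⟨i, hi, hn⟩ := hn
      refine ⟨0, fun n hn ↦ absurd rfl hn, fun G _ ψ h1 h0 ↦ ?_⟩
      -- As `n i > 0`, lowering this exponent by one does not change its negative part, so the
      -- monomial is a multiple of `T_i`.
      have ha : a.1 ∈ piece I (n - Pi.single i 1) := by
        refine (?_ : piece I n ≤ _) a.2
        refine Finset.prod_le_prod' fun j _ ↦ Ideal.pow_le_pow_right ?_
        by_cases hj : j = i
        · subst hj; simp [negExp]; lia
        · simp [negExp, Pi.single_eq_of_ne hj]
      rw [← T_mul_single (a := ⟨a.1, ha⟩) (add_sub_cancel _ _) rfl, map_mul,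
        h0 i (Finset.mem_compl.mp hi), zero_mul, map_zero]

theorem apply_eq_zero_of_mem_map {ψ : extendedRees I →+* G} (h0 : ∀ i ∉ Θ, ψ (T I i) = 0)
    {p : extendedRees I} (hp : p ∈ (⨆ i ∈ Θᶜ, I i).map (algebraMap A (extendedRees I))) :
    ψ p = 0 := by
  refine (?_ : (⨆ i ∈ Θᶜ, I i).map (algebraMap A (extendedRees I)) ≤ RingHom.ker ψ) hp
  simp only [Ideal.map_iSup, iSup_le_iff]
  refine fun i hi ↦ (map_le_span_T I i).trans ((Ideal.span_singleton_le_iff_mem _).mpr ?_)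
  exact h0 i (Finset.mem_compl.mp hi)

/-- In `J · J ^ d`, with `J ^ d` expanded into products, the product of `k` keeps its factor `J`,
while the others are only kept as products of the same degree. -/
theorem pow_succ_le (I : Fin l → Ideal A) {Θ : Finset (Fin l)} (k : Fin l → ℕ) :
    (⨆ i ∈ Θ, I i) ^ (∑ i, k i + 1) ≤
      (⨆ i ∈ Θ, I i) * (∏ i, I i ^ k i) ⊔ ⨆ k' ∈ sameDegree Θ k, ∏ i, I i ^ k' i := by
  rw [pow_succ']
  refine (Ideal.mul_mono_right (pow_iSup_le I Θ _)).trans ?_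
  simp only [Ideal.mul_iSup, iSup_le_iff]
  rintro k' ⟨h1, h2⟩
  by_cases hk : k' = k
  · rw [hk]; exact le_sup_left
  · exact Ideal.mul_le_right.trans (le_trans (le_iSup₂ (f := fun k' (_ : k' ∈ sameDegree Θ k) ↦
      ∏ i, I i ^ k' i) k' ⟨h1, h2, hk⟩) le_sup_right)

/-- Vanishing of the class says only that the sum of all coefficients of one weight lies in the next
power of `J`. By `pow_succ_le`, the coefficient at `n` is then, modulo `J * piece I n`, a
combination of elements from the other products of the same degree, and `hQ` puts it in `J * piece I
n`. -/
theorem mem_map_of_toAssocGraded_eq_zero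
    (hQ : ∀ k : Fin l → ℕ, (∏ i, I i ^ k i) ⊓ ⨆ k' ∈ sameDegree Θᶜ k, ∏ i, I i ^ k' i ≤
      (⨆ i ∈ Θᶜ, I i) * ∏ i, I i ^ k i) {q : extendedRees I}
    (hq : ∀ n, q.1.coeff n ≠ 0 → (∀ i ∈ Θ, n i = 0) ∧ ∀ i ∈ Θᶜ, n i ≤ 0)
    (h : toAssocGraded I Θ q = 0) :
    q ∈ (⨆ i ∈ Θᶜ, I i).map (algebraMap A (extendedRees I)) := by
  classical
  refine (mem_map_iff _ q).mpr fun n ↦ ?_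
  by_cases hn : q.1.coeff n = 0
  · rw [hn]; exact Ideal.zero_mem _
  have hw : ∀ m, q.1.coeff m ≠ 0 → weight Θ m = ∑ i, negExp (m i) := fun m hm ↦
    Finset.sum_subset (Finset.subset_univ _) fun i _ hi ↦ by
      rw [(hq m hm).1 i (by simpa using hi)]; rfl
  -- The image of `q` lifts to the Rees algebra with exactly this sum as its coefficient in degree
  -- `weight Θ n`.
  have h1 : ∑ m ∈ q.1.coeff.support with weight Θ m = weight Θ n, q.1.coeff m ∈
      (⨆ i ∈ Θᶜ, I i) ^ (weight Θ n + 1) := by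
    let r : (Fin l → ℤ) → reesAlgebra (⨆ i ∈ Θᶜ, I i) := fun m ↦
      ⟨Polynomial.monomial (weight Θ m) (q.1.coeff m),
        reesAlgebra.monomial_mem.mpr (piece_le_pow I Θ m (q.2 m))⟩
    have e : (Ideal.Quotient.mk _ (∑ m ∈ q.1.coeff.support, r m) :
        AssocGraded (⨆ i ∈ Θᶜ, I i)) = toAssocGraded I Θ q := by
      conv_rhs => rw [eq_sum_single q, map_sum]
      refine (map_sum (Ideal.Quotient.mk _) r _).trans (Finset.sum_congr rfl fun m hm ↦ ?_)
      rw [toAssocGraded_single, symOfPiece_of_nonpos (hq m (Finsupp.mem_support_iff.mp hm)).2]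
      rfl
    have h2 := AssocGraded.coeff_mem_of_mem_map (Ideal.Quotient.eq_zero_iff_mem.mp (e.trans h))
      (weight Θ n)
    have e2 : (∑ m ∈ q.1.coeff.support, r m).1 = ∑ m ∈ q.1.coeff.support, (r m).1 :=
      map_sum (reesAlgebra (⨆ i ∈ Θᶜ, I i)).val r _
    rw [e2, Polynomial.finsetSum_coeff] at h2
    rw [Finset.sum_filter]
    refine (congrArg (· ∈ _) (Finset.sum_congr rfl fun m _ ↦ ?_)).mp h2
    exact Polynomial.coeff_monomial
  rw [hw n hn] at h1
  obtain ⟨z, hz, z', hz', e⟩ := Submodule.mem_sup.mp (pow_succ_le I (fun i ↦ negExp (n i)) h1)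
  rw [← Finset.sum_erase_add _ _ (Finset.mem_filter.mpr ⟨Finsupp.mem_support_iff.mpr hn, hw n hn⟩)]
    at e
  have h3 : q.1.coeff n - z ∈ ⨆ k' ∈ sameDegree Θᶜ fun i ↦ negExp (n i), ∏ i, I i ^ k' i := by
    rw [sub_eq_iff_eq_add'.mpr (eq_sub_iff_add_eq'.mpr e.symm |>.trans (add_sub_assoc _ _ _))]
    refine Ideal.sub_mem _ hz' (Ideal.sum_mem _ fun m hm ↦ ?_)
    obtain ⟨hmn, hm⟩ := Finset.mem_erase.mp hm
    obtain ⟨hm, hmw⟩ := Finset.mem_filter.mp hm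
    have hm := Finsupp.mem_support_iff.mp hm
    refine le_iSup₂ (f := fun k' (_ : k' ∈ sameDegree Θᶜ fun i ↦ negExp (n i)) ↦
      ∏ i, I i ^ k' i) (fun i ↦ negExp (m i)) ⟨fun i hi ↦ ?_, ?_, fun hc ↦ hmn (funext fun i ↦ ?_)⟩
      (q.2 m)
    · have h5 := (hq m hm).1 i (by simpa using hi)
      simp only [h5, negExp]; rfl
    · rw [← hw m hm, hmw]
    · have h5 := congrFun hc i
      have h6 : ∀ m, q.1.coeff m ≠ 0 → m i ≤ 0 := fun m hm ↦ by
        by_cases hi : i ∈ Θ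
        · rw [(hq m hm).1 i hi]
        · exact (hq m hm).2 i (Finset.mem_compl.mpr hi)
      have := h6 m hm
      have := h6 n hn
      simp only [negExp] at h5
      lia
  have h4 := hQ (fun i ↦ negExp (n i)) ⟨Ideal.sub_mem _ (q.2 n) (Ideal.mul_le_right hz), h3⟩
  exact (Submodule.sub_mem_iff_left _ hz).mp h4

theorem apply_eq_zero_of_toAssocGraded_eq_zero
    (hQ : ∀ k : Fin l → ℕ, (∏ i, I i ^ k i) ⊓ ⨆ k' ∈ sameDegree Θᶜ k, ∏ i, I i ^ k' i ≤
      (⨆ i ∈ Θᶜ, I i) * ∏ i, I i ^ k i) {ψ : extendedRees I →+* G}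
    (h1 : ∀ i ∈ Θ, ψ (T I i) = 1) (h0 : ∀ i ∉ Θ, ψ (T I i) = 0) {p : extendedRees I}
    (hp : toAssocGraded I Θ p = 0) : ψ p = 0 := by
  obtain ⟨q, hq, h⟩ := exists_normalForm Θ p
  rw [h _ (toAssocGraded I Θ) (fun _ ↦ toAssocGraded_T_of_mem)
    fun _ ↦ toAssocGraded_T_of_notMem] at hp
  rw [h G ψ h1 h0]
  exact apply_eq_zero_of_mem_map h0 (mem_map_of_toAssocGraded_eq_zero hQ hq hp)

/-- Rescaling by the inverse units reduces to the values `1` and `0`, for which `ψ` kills the kernel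
of the surjection `toAssocGraded`. -/
theorem exists_eq_twist
    (hQ : ∀ k : Fin l → ℕ, (∏ i, I i ^ k i) ⊓ ⨆ k' ∈ sameDegree Θᶜ k, ∏ i, I i ^ k' i ≤
      (⨆ i ∈ Θᶜ, I i) * ∏ i, I i ^ k i) {ψ : extendedRees I →+* G} {w : Fin l → Gˣ}
    (h1 : ∀ i ∈ Θ, ψ (T I i) = w i) (h0 : ∀ i ∉ Θ, ψ (T I i) = 0) :
    ∃ χ : AssocGraded (⨆ i ∈ Θᶜ, I i) →+* G, ψ = twist w (χ.comp (toAssocGraded I Θ)) := by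
  have h2 : ∀ p, toAssocGraded I Θ p = 0 → twist w⁻¹ ψ p = 0 := fun p hp ↦
    apply_eq_zero_of_toAssocGraded_eq_zero hQ
      (fun i hi ↦ by rw [twist_T, h1 i hi]; simp) (fun i hi ↦ by rw [twist_T, h0 i hi, zero_mul]) hp
  refine ⟨(toAssocGraded I Θ).liftOfSurjective (toAssocGraded_surjective I Θ)
    ⟨twist w⁻¹ ψ, h2⟩, ?_⟩
  rw [RingHom.liftOfSurjective_comp, twist_twist_inv]

theorem twist_comp_injective {w : Fin l → Gˣ} {χ χ' : AssocGraded (⨆ i ∈ Θᶜ, I i) →+* G}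
    (h : twist w (χ.comp (toAssocGraded I Θ)) = twist w (χ'.comp (toAssocGraded I Θ))) :
    χ = χ' := by
  refine RingHom.ext fun z ↦ ?_
  obtain ⟨p, rfl⟩ := toAssocGraded_surjective I Θ z
  exact DFunLike.congr_fun (twist_injective w h) p

end extendedRees

end Fibres

/-! ### The fibres of the extended Rees algebra, geometrically -/

section FibreRings

variable {A B G : Type} [CommRing A] [CommRing B] [CommRing G] {l : ℕ} {I : Fin l → Ideal A}
  {Θ : Finset (Fin l)} {J : Ideal A}

namespace extendedRees

/-- The homomorphism `toAssocGraded` for an ideal `J` known to be the sum of the `I i`, `i ∉ Θ`. -/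
noncomputable def toAssocGradedOfEq (hJ : ⨆ i ∈ Θᶜ, I i = J) :
    extendedRees I →+* AssocGraded J :=
  (AssocGraded.map (RingHom.id A) _ J ((Ideal.map_id _).le.trans hJ.le)).comp (toAssocGraded I Θ)

theorem toAssocGradedOfEq_rfl : toAssocGradedOfEq (I := I) (Θ := Θ) rfl = toAssocGraded I Θ := by
  rw [toAssocGradedOfEq, AssocGraded.map_id, RingHom.id_comp]

theorem toAssocGradedOfEq_algebraMap (hJ : ⨆ i ∈ Θᶜ, I i = J) (a : A) :
    toAssocGradedOfEq hJ (algebraMap A _ a) = algebraMap A _ a := by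
  subst hJ; rw [toAssocGradedOfEq_rfl, toAssocGraded_algebraMap]

theorem toAssocGradedOfEq_T_of_mem (hJ : ⨆ i ∈ Θᶜ, I i = J) {i : Fin l} (hi : i ∈ Θ) :
    toAssocGradedOfEq hJ (T I i) = 1 := by
  subst hJ; rw [toAssocGradedOfEq_rfl, toAssocGraded_T_of_mem hi]

theorem toAssocGradedOfEq_T_of_notMem (hJ : ⨆ i ∈ Θᶜ, I i = J) {i : Fin l} (hi : i ∉ Θ) :
    toAssocGradedOfEq hJ (T I i) = 0 := by
  subst hJ; rw [toAssocGradedOfEq_rfl, toAssocGraded_T_of_notMem hi]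

theorem toAssocGradedOfEq_map (hJ : ⨆ i ∈ Θᶜ, I i = J) (φ : A →+* B) {K : Fin l → Ideal B}
    {L : Ideal B} (hL : ⨆ i ∈ Θᶜ, K i = L) (h : ∀ i, (I i).map φ ≤ K i) (h' : J.map φ ≤ L) :
    (toAssocGradedOfEq hL).comp (map φ K h) =
      (AssocGraded.map φ J L h').comp (toAssocGradedOfEq hJ) := by
  subst hJ hL
  rw [toAssocGradedOfEq_rfl, toAssocGradedOfEq_rfl, toAssocGraded_map]

theorem exists_eq_twist_of_eq (hJ : ⨆ i ∈ Θᶜ, I i = J)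
    (hQ : ∀ k : Fin l → ℕ, (∏ i, I i ^ k i) ⊓ ⨆ k' ∈ sameDegree Θᶜ k, ∏ i, I i ^ k' i ≤
      (⨆ i ∈ Θᶜ, I i) * ∏ i, I i ^ k i) {ψ : extendedRees I →+* G} {w : Fin l → Gˣ}
    (h1 : ∀ i ∈ Θ, ψ (T I i) = w i) (h0 : ∀ i ∉ Θ, ψ (T I i) = 0) :
    ∃ χ : AssocGraded J →+* G, ψ = twist w (χ.comp (toAssocGradedOfEq hJ)) := by
  subst hJ; rw [toAssocGradedOfEq_rfl]; exact exists_eq_twist hQ h1 h0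

theorem twist_comp_toAssocGradedOfEq_injective (hJ : ⨆ i ∈ Θᶜ, I i = J) {w : Fin l → Gˣ}
    {χ χ' : AssocGraded J →+* G}
    (h : twist w (χ.comp (toAssocGradedOfEq hJ)) = twist w (χ'.comp (toAssocGradedOfEq hJ))) :
    χ = χ' := by
  subst hJ; rw [toAssocGradedOfEq_rfl] at h; exact twist_comp_injective h

theorem twist_comp_ringHom (w : Fin l → Gˣ) (ψ : extendedRees I →+* G) {K : Fin l → Ideal B}
    (φ : B →+* A) (h : ∀ i, (K i).map φ ≤ I i) :
    (twist w ψ).comp (map φ I h) = twist w (ψ.comp (map φ I h)) := by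
  refine ringHom_ext fun n a ↦ ?_
  rw [twist_single, RingHom.comp_apply, RingHom.comp_apply, map_single, twist_single]

end extendedRees

end FibreRings

/-! ### Scheme-valued points of the fibres over an affine base. -/

section FibreHom

open Scheme

variable {A B : Type} [CommRing A] [CommRing B] {l : ℕ} {I : Fin l → Ideal A}
  {Θ : Finset (Fin l)} {J : Ideal A} {V W : Scheme.{0}}

/-- The ring homomorphism corresponding to a morphism to a spectrum. -/
noncomputable def homOfToSpec {S : Type} [CommRing S] (k : W ⟶ Spec (.of S)) : S →+* Γ(W, ⊤) :=
  ((ΓSpecIso (.of S)).inv ≫ k.appTop).hom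

theorem homOfToSpec_apply {S : Type} [CommRing S] (k : W ⟶ Spec (.of S)) (x : S) :
    homOfToSpec k x = k.appTop ((ΓSpecIso (.of S)).inv x) := rfl

theorem homOfToSpec_toSpecOfHom {S : Type} [CommRing S] (ψ : S →+* Γ(W, ⊤)) :
    homOfToSpec (toSpecOfHom (CommRingCat.ofHom ψ)) = ψ :=
  congrArg CommRingCat.Hom.hom (toSpecOfHom_appTop (CommRingCat.ofHom ψ))

theorem homOfToSpec_injective {S : Type} [CommRing S] {k k' : W ⟶ Spec (.of S)}
    (h : homOfToSpec k = homOfToSpec k') : k = k' :=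
  hom_Spec_ext (CommRingCat.hom_ext h)

theorem homOfToSpec_comp {S : Type} [CommRing S] (j : V ⟶ W) (k : W ⟶ Spec (.of S)) :
    homOfToSpec (j ≫ k) = j.appTop.hom.comp (homOfToSpec k) := by
  refine congrArg CommRingCat.Hom.hom (?_ : _ = ((ΓSpecIso (.of S)).inv ≫ k.appTop) ≫ j.appTop)
  rw [Scheme.Hom.comp_appTop, Category.assoc]

theorem homOfToSpec_comp_map {S S' : Type} [CommRing S] [CommRing S'] (k : W ⟶ Spec (.of S'))
    (φ : S →+* S') :
    homOfToSpec (k ≫ Spec.map (CommRingCat.ofHom φ)) = (homOfToSpec k).comp φ := by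
  refine congrArg CommRingCat.Hom.hom (?_ : _ = CommRingCat.ofHom φ ≫
    (ΓSpecIso (.of S')).inv ≫ k.appTop)
  rw [Scheme.Hom.comp_appTop, ← ΓSpecIso_inv_naturality_assoc]

/-- The pull-backs of invertible functions along a morphism. -/
noncomputable def pullbackUnits (j : V ⟶ W) (w : Fin l → Γ(W, ⊤)ˣ) : Fin l → Γ(V, ⊤)ˣ :=
  fun i ↦ Units.map j.appTop.hom.toMonoidHom (w i)

theorem pullbackUnits_val (j : V ⟶ W) (w : Fin l → Γ(W, ⊤)ˣ) (i : Fin l) :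
    (pullbackUnits j w i : Γ(V, ⊤)) = j.appTop (w i : Γ(W, ⊤)) := rfl

theorem pullbackUnits_comp {V' : Scheme.{0}} (j' : V' ⟶ V) (j : V ⟶ W) (w : Fin l → Γ(W, ⊤)ˣ) :
    pullbackUnits j' (pullbackUnits j w) = pullbackUnits (j' ≫ j) w :=
  funext fun _ ↦ Units.ext (appTop_comp_apply _ _ _).symm

open extendedRees

/-- The point of the spectrum of the extended Rees algebra given by a point of the normal cone
and values of the variables `T_i`, `i ∈ Θ`. -/
noncomputable def fibreHom (hJ : ⨆ i ∈ Θᶜ, I i = J) (w : Fin l → Γ(W, ⊤)ˣ)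
    (k : W ⟶ Spec (.of (AssocGraded J))) : W ⟶ Spec (.of (extendedRees I)) :=
  toSpecOfHom (CommRingCat.ofHom (twist w ((homOfToSpec k).comp (toAssocGradedOfEq hJ))))

theorem homOfToSpec_fibreHom (hJ : ⨆ i ∈ Θᶜ, I i = J) (w : Fin l → Γ(W, ⊤)ˣ)
    (k : W ⟶ Spec (.of (AssocGraded J))) : homOfToSpec (fibreHom hJ w k) =
      twist w ((homOfToSpec k).comp (toAssocGradedOfEq hJ)) :=
  homOfToSpec_toSpecOfHom _

theorem comp_fibreHom (hJ : ⨆ i ∈ Θᶜ, I i = J) (w : Fin l → Γ(W, ⊤)ˣ)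
    (k : W ⟶ Spec (.of (AssocGraded J))) (j : V ⟶ W) :
    j ≫ fibreHom hJ w k = fibreHom hJ (pullbackUnits j w) (j ≫ k) := by
  refine homOfToSpec_injective ?_
  rw [homOfToSpec_comp, homOfToSpec_fibreHom, homOfToSpec_fibreHom, homOfToSpec_comp, comp_twist]
  rfl

theorem fibreHom_comp_map (hJ : ⨆ i ∈ Θᶜ, I i = J) (w : Fin l → Γ(W, ⊤)ˣ)
    (k : W ⟶ Spec (.of (AssocGraded J))) :
    fibreHom hJ w k ≫ Spec.map (CommRingCat.ofHom (algebraMap A (extendedRees I))) =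
      k ≫ Spec.map (CommRingCat.ofHom (algebraMap A (AssocGraded J))) := by
  refine homOfToSpec_injective ?_
  rw [homOfToSpec_comp_map, homOfToSpec_comp_map, homOfToSpec_fibreHom]
  refine RingHom.ext fun a ↦ ?_
  rw [RingHom.comp_apply, twist_algebraMap, RingHom.comp_apply, toAssocGradedOfEq_algebraMap]
  rfl

theorem fibreHom_T_of_mem (hJ : ⨆ i ∈ Θᶜ, I i = J) (w : Fin l → Γ(W, ⊤)ˣ)
    (k : W ⟶ Spec (.of (AssocGraded J))) {i : Fin l} (hi : i ∈ Θ) :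
    homOfToSpec (fibreHom hJ w k) (T I i) = w i := by
  rw [homOfToSpec_fibreHom, twist_T, RingHom.comp_apply, toAssocGradedOfEq_T_of_mem hJ hi, map_one,
    one_mul]

theorem fibreHom_T_of_notMem (hJ : ⨆ i ∈ Θᶜ, I i = J) (w : Fin l → Γ(W, ⊤)ˣ)
    (k : W ⟶ Spec (.of (AssocGraded J))) {i : Fin l} (hi : i ∉ Θ) :
    homOfToSpec (fibreHom hJ w k) (T I i) = 0 := by
  rw [homOfToSpec_fibreHom, twist_T, RingHom.comp_apply, toAssocGradedOfEq_T_of_notMem hJ hi,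
    map_zero, zero_mul]

theorem fibreHom_injective (hJ : ⨆ i ∈ Θᶜ, I i = J) {w : Fin l → Γ(W, ⊤)ˣ}
    {k k' : W ⟶ Spec (.of (AssocGraded J))} (h : fibreHom hJ w k = fibreHom hJ w k') : k = k' := by
  refine homOfToSpec_injective (twist_comp_toAssocGradedOfEq_injective hJ (w := w) ?_)
  rw [← homOfToSpec_fibreHom, h, homOfToSpec_fibreHom]

theorem exists_fibreHom_eq (hJ : ⨆ i ∈ Θᶜ, I i = J)
    (hQ : ∀ k : Fin l → ℕ, (∏ i, I i ^ k i) ⊓ ⨆ k' ∈ sameDegree Θᶜ k, ∏ i, I i ^ k' i ≤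
      (⨆ i ∈ Θᶜ, I i) * ∏ i, I i ^ k i) {w : Fin l → Γ(W, ⊤)ˣ}
    {h : W ⟶ Spec (.of (extendedRees I))} (h1 : ∀ i ∈ Θ, homOfToSpec h (T I i) = w i)
    (h0 : ∀ i ∉ Θ, homOfToSpec h (T I i) = 0) : ∃ k, fibreHom hJ w k = h := by
  obtain ⟨χ, hχ⟩ := exists_eq_twist_of_eq hJ hQ h1 h0
  refine ⟨toSpecOfHom (CommRingCat.ofHom χ), homOfToSpec_injective ?_⟩
  rw [homOfToSpec_fibreHom, homOfToSpec_toSpecOfHom, hχ]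

theorem fibreHom_naturality (hJ : ⨆ i ∈ Θᶜ, I i = J) (φ : A →+* B) {K : Fin l → Ideal B}
    {L : Ideal B} (hL : ⨆ i ∈ Θᶜ, K i = L) (h : ∀ i, (I i).map φ ≤ K i) (h' : J.map φ ≤ L)
    (w : Fin l → Γ(W, ⊤)ˣ) (k : W ⟶ Spec (.of (AssocGraded L))) :
    fibreHom hJ w (k ≫ Spec.map (CommRingCat.ofHom (AssocGraded.map φ J L h'))) =
      fibreHom hL w k ≫ Spec.map (CommRingCat.ofHom (extendedRees.map φ K h)) := by
  refine homOfToSpec_injective ?_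
  rw [homOfToSpec_fibreHom, homOfToSpec_comp_map, homOfToSpec_comp_map, homOfToSpec_fibreHom,
    twist_comp_ringHom, RingHom.comp_assoc, RingHom.comp_assoc, toAssocGradedOfEq_map hJ φ hL h h']

end FibreHom

/-! ### Charts of the normal cone -/

section ConeCharts

open Scheme AffineZariskiSite

namespace AlgebraicGeometry.Scheme.Cover.RelativeGluingData

variable {S : Scheme.{0}} {𝒰 : S.OpenCover} [Category 𝒰.I₀] [𝒰.LocallyDirected]
  (d : RelativeGluingData 𝒰) [Small.{0} 𝒰.I₀] [Quiver.IsThin 𝒰.I₀]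

/-- The charts of the glued scheme. -/
noncomputable def chart (i : 𝒰.I₀) : d.functor.obj i ⟶ d.glued := colimit.ι d.functor i

theorem isOpenImmersion_chart (i : 𝒰.I₀) : IsOpenImmersion (d.chart i) :=
  inferInstanceAs (IsOpenImmersion (colimit.ι d.functor i))

theorem chart_toBase (i : 𝒰.I₀) : d.chart i ≫ d.toBase = d.natTrans.app i ≫ 𝒰.f i := d.ι_toBase i

theorem range_chart (i : 𝒰.I₀) : Set.range (d.chart i) = d.toBase ⁻¹' (Set.range (𝒰.f i)) :=
  (d.preimage_toBase_eq_range_ι i).symm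

theorem map_chart {i j : 𝒰.I₀} (h : i ⟶ j) : d.functor.map h ≫ d.chart j = d.chart i :=
  colimit.w d.functor h

end AlgebraicGeometry.Scheme.Cover.RelativeGluingData

variable {X : Scheme.{0}} (I : X.IdealSheafData)

/-- The chart of the normal cone over an affine open subscheme. -/
noncomputable def coneChart (U : X.AffineZariskiSite) :
    Spec (.of (AssocGraded (I.ideal U))) ⟶ normalCone I :=
  (relativeGluingData (coequifibered_normalConeAlgebraMap I)).chart U

instance (U : X.AffineZariskiSite) : IsOpenImmersion (coneChart I U) :=
  (relativeGluingData (coequifibered_normalConeAlgebraMap I)).isOpenImmersion_chart U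

theorem coneChart_toBase (U : X.AffineZariskiSite) : coneChart I U ≫ normalConeToBase I =
    Spec.map (CommRingCat.ofHom (algebraMap Γ(X, U.toOpens) (AssocGraded (I.ideal U)))) ≫
      U.2.fromSpec := by
  refine ((relativeGluingData (coequifibered_normalConeAlgebraMap I)).chart_toBase U).trans ?_
  rw [← U.2.isoSpec_inv_ι]
  exact Category.assoc _ _ _

theorem range_coneChart (U : X.AffineZariskiSite) :
    Set.range (coneChart I U) = normalConeToBase I ⁻¹' U.toOpens := by
  refine ((relativeGluingData (coequifibered_normalConeAlgebraMap I)).range_chart U).trans ?_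
  exact congrArg (normalConeToBase I ⁻¹' ·) (Opens.range_ι U.toOpens)

theorem map_coneChart {U V : X.AffineZariskiSite} (h : V ≤ U) :
    Spec.map (CommRingCat.ofHom (AssocGraded.map
      (X.presheaf.map (homOfLE (toOpens_mono h)).op).hom
      (I.ideal U) (I.ideal V) (IdealSheaf_map_le I h))) ≫ coneChart I U = coneChart I V :=
  (relativeGluingData (coequifibered_normalConeAlgebraMap I)).map_chart (homOfLE h)

end ConeCharts

/-! ### Correspondence between points of the normal cone and of the iterated deformation -/

section Correspondence

open Scheme AffineZariskiSite

theorem intersection_ideal {X : Scheme.{0}} {l : ℕ} (Y : Fin l → X.IdealSheafData)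
    (Θ : Finset (Fin l)) (U : X.affineOpens) :
    ⨆ i ∈ Θ, (Y i).ideal U = (intersection Y Θ).ideal U := by
  rw [intersection, IdealSheafData.ideal_iSup, iSup_apply]
  refine iSup_congr fun i ↦ ?_
  by_cases hi : i ∈ Θ <;> simp [hi]

theorem homOfToSpec_map {S S' : Type} [CommRing S] [CommRing S'] (φ : S →+* S') (x : S) :
    homOfToSpec (Spec.map (CommRingCat.ofHom φ)) x = (ΓSpecIso (.of S')).inv (φ x) :=
  (congrArg (fun f : CommRingCat.of S ⟶ Γ(Spec (.of S'), ⊤) ↦ f x)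
    (ΓSpecIso_inv_naturality (CommRingCat.ofHom φ))).symm

theorem specMap_extendedRees_map {A B : Type} [CommRing A] [CommRing B] {l : ℕ}
    {I : Fin l → Ideal A} {K : Fin l → Ideal B} (φ : A →+* B) (h : ∀ i, (I i).map φ ≤ K i) :
    Spec.map (CommRingCat.ofHom (extendedRees.map φ K h)) ≫
        Spec.map (CommRingCat.ofHom (algebraMap A (extendedRees I))) =
      Spec.map (CommRingCat.ofHom (algebraMap B (extendedRees K))) ≫
        Spec.map (CommRingCat.ofHom φ) := by
  rw [← Spec.map_comp, ← Spec.map_comp, ← CommRingCat.ofHom_comp, ← CommRingCat.ofHom_comp]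
  exact congrArg (fun f ↦ Spec.map (CommRingCat.ofHom f))
    (RingHom.ext (extendedRees.map_algebraMap φ K h))

variable {X D V W : Scheme.{0}} {l : ℕ} {Y : Fin l → X.IdealSheafData} {q : D ⟶ X}
  {T : Fin l → Γ(D, ⊤)} (hD : IsUniversal Y q T)

/-- The chart of the iterated deformation over an affine open subscheme. -/
noncomputable def IsUniversal.chart (U : X.AffineZariskiSite) :
    Spec (.of (extendedRees fun i ↦ (Y i).ideal U)) ⟶ D :=
  (hD.exists_affine U).choose

theorem IsUniversal.isPullback_chart (U : X.AffineZariskiSite) :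
    IsPullback (hD.chart U) (Spec.map (CommRingCat.ofHom (algebraMap Γ(X, U.toOpens)
      (extendedRees fun i ↦ (Y i).ideal U)))) q U.2.fromSpec :=
  (hD.exists_affine U).choose_spec.1

theorem IsUniversal.chart_appTop (U : X.AffineZariskiSite) (i : Fin l) :
    (hD.chart U).appTop (T i) = (ΓSpecIso (.of (extendedRees fun i ↦ (Y i).ideal U))).inv
      (extendedRees.T (fun i ↦ (Y i).ideal U) i) :=
  (hD.exists_affine U).choose_spec.2 i

instance (U : X.AffineZariskiSite) : IsOpenImmersion (hD.chart U) :=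
  (isOpenImmersion_of_isPullback_fromSpec (U := U) (hD.isPullback_chart U)).1

theorem IsUniversal.range_chart (U : X.AffineZariskiSite) :
    Set.range (hD.chart U) = q ⁻¹' U.toOpens :=
  (isOpenImmersion_of_isPullback_fromSpec (U := U) (hD.isPullback_chart U)).2

theorem IsUniversal.comp_chart_appTop {U : X.AffineZariskiSite}
    (h : W ⟶ Spec (.of (extendedRees fun i ↦ (Y i).ideal U))) (i : Fin l) :
    (h ≫ hD.chart U).appTop (T i) = homOfToSpec h (extendedRees.T (fun i ↦ (Y i).ideal U) i) := by
  rw [appTop_comp_apply, hD.chart_appTop, homOfToSpec_apply]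

theorem IsUniversal.map_chart {U U' : X.AffineZariskiSite} (h : U' ≤ U) :
    Spec.map (CommRingCat.ofHom (extendedRees.map (I := fun i ↦ (Y i).ideal U)
      (X.presheaf.map (homOfLE (toOpens_mono h)).op).hom (fun i ↦ (Y i).ideal U')
      fun i ↦ IdealSheaf_map_le (Y i) h)) ≫ hD.chart U = hD.chart U' := by
  have e : ∀ i, (Spec.map (CommRingCat.ofHom (extendedRees.map (I := fun i ↦ (Y i).ideal U)
      (X.presheaf.map (homOfLE (toOpens_mono h)).op).hom (fun i ↦ (Y i).ideal U')
      fun i ↦ IdealSheaf_map_le (Y i) h)) ≫ hD.chart U).appTop (T i) =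
      (ΓSpecIso (.of (extendedRees fun i ↦ (Y i).ideal U'))).inv
        (extendedRees.T (fun i ↦ (Y i).ideal U') i) := fun i ↦
    (hD.comp_chart_appTop _ i).trans ((homOfToSpec_map _ _).trans
      (congrArg _ (extendedRees.map_T _ _ _ i)))
  refine hD.hom_ext ?_ (fun i ↦ (e i).trans (hD.chart_appTop U' i).symm) fun i ↦ ?_
  · refine (Category.assoc _ _ _).trans ((congrArg _ (hD.isPullback_chart U).w).trans ?_)
    refine ((Category.assoc _ _ _).symm.trans (congrArg (· ≫ U.2.fromSpec)
      (specMap_extendedRees_map _ _))).trans ?_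
    refine ((Category.assoc _ _ _).trans (congrArg _ ?_)).trans (hD.isPullback_chart U').w.symm
    exact U.2.map_fromSpec U'.2 (homOfLE (toOpens_mono h)).op
  · rw [e]
    exact isRegularSection_Spec (extendedRees.T_mem_nonZeroDivisors i)

variable {Θ : Finset (Fin l)}

theorem exists_lift_coneChart (I : X.IdealSheafData) (a : W ⟶ normalCone I) {U : X.AffineZariskiSite}
    {N : W.Opens} (h : ∀ w ∈ N, (a ≫ normalConeToBase I) w ∈ U.toOpens) :
    ∃ k, k ≫ coneChart I U = N.ι ≫ a := by
  refine ⟨IsOpenImmersion.lift (coneChart I U) (N.ι ≫ a) ?_, IsOpenImmersion.lift_fac _ _ _⟩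
  rw [range_coneChart]
  rintro _ ⟨w, rfl⟩
  exact h w.1 w.2

theorem IsUniversal.exists_lift_chart (b : W ⟶ D) {U : X.AffineZariskiSite}
    {N : W.Opens} (h : ∀ w ∈ N, (b ≫ q) w ∈ U.toOpens) :
    ∃ k, k ≫ hD.chart U = N.ι ≫ b := by
  refine ⟨IsOpenImmersion.lift (hD.chart U) (N.ι ≫ b) ?_, IsOpenImmersion.lift_fac _ _ _⟩
  rw [hD.range_chart]
  rintro _ ⟨w, rfl⟩
  exact h w.1 w.2

theorem exists_affineZariskiSite_mem (x : X) : ∃ U : X.AffineZariskiSite, x ∈ U.toOpens := by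
  obtain ⟨U, hU⟩ := TopologicalSpace.Opens.mem_iSup.mp
    ((iSup_affineOpens_eq_top X).ge (Set.mem_univ x))
  exact ⟨U, hU⟩

theorem exists_affineZariskiSite_le_le {U U' : X.AffineZariskiSite} {x : X} (h : x ∈ U.toOpens)
    (h' : x ∈ U'.toOpens) : ∃ V ≤ U, V ≤ U' ∧ x ∈ V.toOpens := by
  obtain ⟨f, g, e, hx⟩ := exists_basicOpen_le_affine_inter U.2 U'.2 x ⟨h, h'⟩
  exact ⟨U.basicOpen f, U.basicOpen_le f, ⟨g, e.symm⟩, hx⟩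

/-- The point of the iterated deformation given by a point of a chart of the normal cone and
values of the parameters `T_i`, `i ∈ Θ`. -/
noncomputable def IsUniversal.fibreChart {U : X.AffineZariskiSite} (w : Fin l → Γ(W, ⊤)ˣ)
    (k : W ⟶ Spec (.of (AssocGraded ((intersection Y Θᶜ).ideal U)))) : W ⟶ D :=
  fibreHom (intersection_ideal Y Θᶜ U) w k ≫ hD.chart U

theorem IsUniversal.comp_fibreChart {U : X.AffineZariskiSite} (w : Fin l → Γ(W, ⊤)ˣ)
    (k : W ⟶ Spec (.of (AssocGraded ((intersection Y Θᶜ).ideal U)))) (j : V ⟶ W) :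
    j ≫ hD.fibreChart w k = hD.fibreChart (pullbackUnits j w) (j ≫ k) := by
  rw [fibreChart, fibreChart, ← comp_fibreHom, Category.assoc]

theorem IsUniversal.fibreChart_comp {U : X.AffineZariskiSite} (w : Fin l → Γ(W, ⊤)ˣ)
    (k : W ⟶ Spec (.of (AssocGraded ((intersection Y Θᶜ).ideal U)))) :
    hD.fibreChart w k ≫ q = (k ≫ coneChart _ U) ≫ normalConeToBase _ := by
  rw [fibreChart, Category.assoc, Category.assoc, (hD.isPullback_chart U).w, coneChart_toBase,
    ← Category.assoc, ← Category.assoc, fibreHom_comp_map]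

theorem IsUniversal.fibreChart_map {U U' : X.AffineZariskiSite} (h : U' ≤ U)
    (w : Fin l → Γ(W, ⊤)ˣ)
    (k : W ⟶ Spec (.of (AssocGraded ((intersection Y Θᶜ).ideal U')))) :
    hD.fibreChart w (k ≫ Spec.map (CommRingCat.ofHom (AssocGraded.map
      (X.presheaf.map (homOfLE (toOpens_mono h)).op).hom _ _ (IdealSheaf_map_le _ h)))) =
      hD.fibreChart w k := by
  rw [fibreChart, fibreChart, ← hD.map_chart h, ← Category.assoc]
  exact congrArg (· ≫ hD.chart U) (fibreHom_naturality (intersection_ideal Y Θᶜ U) _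
    (intersection_ideal Y Θᶜ U') (fun i ↦ IdealSheaf_map_le (Y i) h) _ w k)

/-- Near each point of `W` both charts can be replaced by one over a smaller affine open `V`, and
the construction is compatible with this restriction. -/
theorem IsUniversal.fibreChart_eq_fibreChart {U U' : X.AffineZariskiSite} (w : Fin l → Γ(W, ⊤)ˣ)
    {k : W ⟶ Spec (.of (AssocGraded ((intersection Y Θᶜ).ideal U)))}
    {k' : W ⟶ Spec (.of (AssocGraded ((intersection Y Θᶜ).ideal U')))}
    (h : k ≫ coneChart _ U = k' ≫ coneChart _ U') :
    hD.fibreChart w k = hD.fibreChart w k' := by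
  refine Scheme.hom_ext_of_forall _ _ fun v ↦ ?_
  have hx : (k ≫ coneChart (intersection Y Θᶜ) U ≫ normalConeToBase _) v ∈ U.toOpens :=
    (range_coneChart (intersection Y Θᶜ) U).le ⟨k v, rfl⟩
  have hx' : (k ≫ coneChart (intersection Y Θᶜ) U ≫ normalConeToBase _) v ∈ U'.toOpens := by
    rw [reassoc_of% h]
    exact (range_coneChart (intersection Y Θᶜ) U').le ⟨k' v, rfl⟩
  obtain ⟨V, hV, hV', hx⟩ := exists_affineZariskiSite_le_le hx hx'
  let N : W.Opens := (k ≫ coneChart (intersection Y Θᶜ) U ≫ normalConeToBase _) ⁻¹ᵁ V.toOpens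
  obtain ⟨k₁, hk₁⟩ := exists_lift_coneChart _ (k ≫ coneChart (intersection Y Θᶜ) U) (U := V)
    (N := N) fun w hw ↦ by rw [Category.assoc]; exact hw
  refine ⟨N, hx, ?_⟩
  have e : k₁ ≫ Spec.map (CommRingCat.ofHom (AssocGraded.map
      (X.presheaf.map (homOfLE (toOpens_mono hV)).op).hom _ _ (IdealSheaf_map_le _ hV))) =
      N.ι ≫ k := by
    rw [← cancel_mono (coneChart (intersection Y Θᶜ) U), Category.assoc, Category.assoc,
      map_coneChart _ hV, hk₁]
  have e' : k₁ ≫ Spec.map (CommRingCat.ofHom (AssocGraded.map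
      (X.presheaf.map (homOfLE (toOpens_mono hV')).op).hom _ _ (IdealSheaf_map_le _ hV'))) =
      N.ι ≫ k' := by
    rw [← cancel_mono (coneChart (intersection Y Θᶜ) U'), Category.assoc, Category.assoc,
      map_coneChart _ hV', hk₁, h]
  rw [hD.comp_fibreChart, hD.comp_fibreChart, ← e, ← e', hD.fibreChart_map hV, hD.fibreChart_map hV']

/-- The point `b` of the iterated deformation is the one given by the point `a` of the normal cone
and the values `w` of the parameters `T_i`, `i ∈ Θ`. -/
def IsUniversal.Corresponds (w : Fin l → Γ(W, ⊤)ˣ) (a : W ⟶ normalCone (intersection Y Θᶜ))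
    (b : W ⟶ D) : Prop :=
  ∀ (V : Scheme.{0}) (j : V ⟶ W) (U : X.AffineZariskiSite)
    (k : V ⟶ Spec (.of (AssocGraded ((intersection Y Θᶜ).ideal U)))),
    k ≫ coneChart _ U = j ≫ a → hD.fibreChart (pullbackUnits j w) k = j ≫ b

variable {hD} {w : Fin l → Γ(W, ⊤)ˣ} {a a' : W ⟶ normalCone (intersection Y Θᶜ)} {b b' : W ⟶ D}

theorem IsUniversal.Corresponds.comp (h : hD.Corresponds w a b) (j : V ⟶ W) :
    hD.Corresponds (pullbackUnits j w) (j ≫ a) (j ≫ b) := fun V' j' U k hk ↦ by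
  rw [pullbackUnits_comp, h V' (j' ≫ j) U k (by rw [hk, Category.assoc]), Category.assoc]

theorem IsUniversal.corresponds_fibreChart {U : X.AffineZariskiSite} (w : Fin l → Γ(W, ⊤)ˣ)
    (k : W ⟶ Spec (.of (AssocGraded ((intersection Y Θᶜ).ideal U)))) :
    hD.Corresponds w (k ≫ coneChart _ U) (hD.fibreChart w k) := fun V j U' k' hk' ↦ by
  rw [hD.comp_fibreChart]
  exact hD.fibreChart_eq_fibreChart _ (by rw [hk', Category.assoc])

theorem IsUniversal.corresponds_of_local
    (h : ∀ x : W, ∃ N : W.Opens, x ∈ N ∧ hD.Corresponds (pullbackUnits N.ι w) (N.ι ≫ a) (N.ι ≫ b)) :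
    hD.Corresponds w a b := fun V j U k hk ↦ by
  refine Scheme.hom_ext_of_forall _ _ fun v ↦ ?_
  obtain ⟨N, hN, h⟩ := h (j v)
  refine ⟨j ⁻¹ᵁ N, hN, ?_⟩
  rw [hD.comp_fibreChart, pullbackUnits_comp, ← morphismRestrict_ι_assoc, ← h _ (j ∣_ N) U
    ((j ⁻¹ᵁ N).ι ≫ k) (by rw [Category.assoc, hk, morphismRestrict_ι_assoc]), pullbackUnits_comp,
    morphismRestrict_ι]

theorem IsUniversal.exists_chart_cone (a : W ⟶ normalCone (intersection Y Θᶜ)) (x : W) :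
    ∃ N : W.Opens, x ∈ N ∧ ∃ U, ∃ k, k ≫ coneChart (intersection Y Θᶜ) U = N.ι ≫ a := by
  obtain ⟨U, hU⟩ := exists_affineZariskiSite_mem ((a ≫ normalConeToBase _) x)
  exact ⟨(a ≫ normalConeToBase _) ⁻¹ᵁ U.toOpens, hU, U,
    exists_lift_coneChart _ a fun _ h ↦ h⟩

theorem IsUniversal.Corresponds.unique_right (h : hD.Corresponds w a b)
    (h' : hD.Corresponds w a b') : b = b' := by
  refine Scheme.hom_ext_of_forall _ _ fun x ↦ ?_
  obtain ⟨N, hx, U, k, hk⟩ := IsUniversal.exists_chart_cone a x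
  exact ⟨N, hx, (h _ _ U k hk).symm.trans (h' _ _ U k hk)⟩

theorem IsUniversal.Corresponds.comp_eq (h : hD.Corresponds w a b) :
    b ≫ q = a ≫ normalConeToBase _ := by
  refine Scheme.hom_ext_of_forall _ _ fun x ↦ ?_
  obtain ⟨N, hx, U, k, hk⟩ := IsUniversal.exists_chart_cone a x
  refine ⟨N, hx, ?_⟩
  rw [← Category.assoc, ← h _ _ U k hk, hD.fibreChart_comp, hk, Category.assoc]

/-- Both `a` and `a'` lie over the same point `b ≫ q` of `X`, so they are seen in the same affine
chart, where `fibreHom` is injective. -/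
theorem IsUniversal.Corresponds.unique_left (h : hD.Corresponds w a b)
    (h' : hD.Corresponds w a' b) : a = a' := by
  refine Scheme.hom_ext_of_forall _ _ fun x ↦ ?_
  obtain ⟨U, hU⟩ := exists_affineZariskiSite_mem ((b ≫ q) x)
  obtain ⟨k, hk⟩ := exists_lift_coneChart _ a (U := U) (N := (b ≫ q) ⁻¹ᵁ U.toOpens) fun _ hw ↦ by
    rw [← h.comp_eq]; exact hw
  obtain ⟨k', hk'⟩ := exists_lift_coneChart _ a' (U := U) (N := (b ≫ q) ⁻¹ᵁ U.toOpens) fun _ hw ↦ by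
    rw [← h'.comp_eq]; exact hw
  refine ⟨(b ≫ q) ⁻¹ᵁ U.toOpens, hU, ?_⟩
  have e := (h _ _ U k hk).trans (h' _ _ U k' hk').symm
  rw [fibreChart, fibreChart, cancel_mono] at e
  rw [← hk, ← hk', fibreHom_injective _ e]

theorem IsUniversal.Corresponds.appTop_of_mem (h : hD.Corresponds w a b) {i : Fin l} (hi : i ∈ Θ) :
    b.appTop (T i) = w i := by
  refine section_eq_of_local fun x ↦ ?_
  obtain ⟨N, hx, U, k, hk⟩ := IsUniversal.exists_chart_cone a x
  refine ⟨N, N.ι, inferInstance, ⟨⟨x, hx⟩, rfl⟩, ?_⟩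
  rw [← appTop_comp_apply, ← h _ _ U k hk, fibreChart, hD.comp_chart_appTop,
    fibreHom_T_of_mem _ _ _ hi, pullbackUnits_val]

theorem IsUniversal.Corresponds.appTop_of_notMem (h : hD.Corresponds w a b) {i : Fin l}
    (hi : i ∉ Θ) : b.appTop (T i) = 0 := by
  refine section_eq_of_local fun x ↦ ?_
  obtain ⟨N, hx, U, k, hk⟩ := IsUniversal.exists_chart_cone a x
  refine ⟨N, N.ι, inferInstance, ⟨⟨x, hx⟩, rfl⟩, ?_⟩
  rw [← appTop_comp_apply, ← h _ _ U k hk, fibreChart, hD.comp_chart_appTop,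
    fibreHom_T_of_notMem _ _ _ hi, map_zero]

variable (hD) in
theorem IsUniversal.exists_corresponds_right (w : Fin l → Γ(W, ⊤)ˣ)
    (a : W ⟶ normalCone (intersection Y Θᶜ)) : ∃ b, hD.Corresponds w a b := by
  obtain ⟨b, -, hb⟩ := exists_hom_of_local
    (fun N b ↦ hD.Corresponds (pullbackUnits N.ι w) (N.ι ≫ a) b)
    (fun {N N'} h b hb ↦ by
      have := hb.comp (W.homOfLE h)
      rwa [pullbackUnits_comp, ← Category.assoc, Scheme.homOfLE_ι] at this)
    (fun N b b' hb hb' ↦ hb.unique_right hb') (fun x ↦ by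
      obtain ⟨N, hx, U, k, hk⟩ := IsUniversal.exists_chart_cone a x
      exact ⟨N, hx, _, hk ▸ hD.corresponds_fibreChart _ k⟩)
  exact ⟨b, corresponds_of_local hb⟩

variable (hD) in
-- This is the direction that needs `hQ`: locally, a point with the prescribed parameters factors
-- through the associated graded ring. Uniqueness glues the local factorizations.
theorem IsUniversal.exists_corresponds_left
    (hQ : ∀ (U : X.AffineZariskiSite) (k : Fin l → ℕ), (∏ i, (Y i).ideal U ^ k i) ⊓
      ⨆ k' ∈ sameDegree Θᶜ k, ∏ i, (Y i).ideal U ^ k' i ≤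
      (⨆ i ∈ Θᶜ, (Y i).ideal U) * ∏ i, (Y i).ideal U ^ k i)
    {w : Fin l → Γ(W, ⊤)ˣ} {b : W ⟶ D} (h1 : ∀ i ∈ Θ, b.appTop (T i) = w i)
    (h0 : ∀ i ∉ Θ, b.appTop (T i) = 0) :
    ∃ a : W ⟶ normalCone (intersection Y Θᶜ), hD.Corresponds w a b := by
  obtain ⟨a, -, ha⟩ := exists_hom_of_local
    (fun N a ↦ hD.Corresponds (Θ := Θ) (pullbackUnits N.ι w) a (N.ι ≫ b))
    (fun {N N'} h a ha ↦ by
      have := ha.comp (W.homOfLE h)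
      rwa [pullbackUnits_comp, ← Category.assoc _ _ b, Scheme.homOfLE_ι] at this)
    (fun N a a' ha ha' ↦ ha.unique_left ha') (fun x ↦ by
      obtain ⟨U, hU⟩ := exists_affineZariskiSite_mem ((b ≫ q) x)
      obtain ⟨h, hh⟩ := hD.exists_lift_chart b (U := U) (N := (b ≫ q) ⁻¹ᵁ U.toOpens) fun _ hw ↦ hw
      refine ⟨(b ≫ q) ⁻¹ᵁ U.toOpens, hU, ?_⟩
      obtain ⟨k, hk⟩ := exists_fibreHom_eq (intersection_ideal Y Θᶜ U) (hQ U)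
        (w := pullbackUnits ((b ≫ q) ⁻¹ᵁ U.toOpens).ι w) (h := h)
        (fun i hi ↦ by
          rw [← hD.comp_chart_appTop, hh, appTop_comp_apply, h1 i hi, pullbackUnits_val])
        (fun i hi ↦ by rw [← hD.comp_chart_appTop, hh, appTop_comp_apply, h0 i hi, map_zero])
      refine ⟨k ≫ coneChart _ U, ?_⟩
      have := hD.corresponds_fibreChart (pullbackUnits ((b ≫ q) ⁻¹ᵁ U.toOpens).ι w) k
      rwa [fibreChart, hk, hh] at this)
  exact ⟨a, corresponds_of_local ha⟩

end Correspondence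

/-! ### The strata of the iterated deformation -/

section Strata

open Scheme

variable {X D W : Scheme.{0}} {l : ℕ} {Y : Fin l → X.IdealSheafData} {q : D ⟶ X}
  {T : Fin l → Γ(D, ⊤)}

theorem isUnit_torus_coord {Θ : Finset (Fin l)} (i : Θ) :
    IsUnit ((torus Θ).ι.appTop (AffineSpace.coord SpecC i)) :=
  isUnit_appTop_of_basicOpen (iInf_le _ i)

open Classical in
/-- The coordinates on the torus `(ℂˣ)^Θ`, extended by `1`. -/
noncomputable def torusUnits (Θ : Finset (Fin l)) : Fin l → Γ((torus Θ).toScheme, ⊤)ˣ :=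
  fun i ↦ if h : i ∈ Θ then (isUnit_torus_coord ⟨i, h⟩).unit else 1

theorem torusUnits_of_mem {Θ : Finset (Fin l)} {i : Fin l} (hi : i ∈ Θ) :
    (torusUnits Θ i).1 = (torus Θ).ι.appTop (AffineSpace.coord SpecC ⟨i, hi⟩) := by
  rw [torusUnits, dif_pos hi, IsUnit.unit_spec]

theorem comp_familyMap_eq_iff (s : X ⟶ SpecC) (q : D ⟶ X) (T : Fin l → Γ(D, ⊤))
    {Θ : Finset (Fin l)} (b : W ⟶ D) (t : W ⟶ (torus Θ).toScheme) :
    b ≫ familyMap s q T = t ≫ stratum Θ ↔ b ≫ q ≫ s = t ≫ torusToSpecC Θ ∧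
      (∀ i ∈ Θ, b.appTop (T i) = (pullbackUnits t (torusUnits Θ) i).1) ∧
      ∀ i ∉ Θ, b.appTop (T i) = 0 := by
  have e1 : familyMap s q T ≫ 𝔸(Fin l; SpecC) ↘ SpecC = q ≫ s := AffineSpace.homOfVector_over _ _
  have e2 : stratum Θ ≫ 𝔸(Fin l; SpecC) ↘ SpecC = torusToSpecC Θ :=
    AffineSpace.homOfVector_over _ _
  have e3 : ∀ i, (familyMap s q T).appTop (AffineSpace.coord _ i) = T i := fun i ↦
    AffineSpace.homOfVector_appTop_coord _ _ _
  have e4 : ∀ i ∈ Θ, (stratum Θ).appTop (AffineSpace.coord _ i) = (torusUnits Θ i).1 :=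
    fun i hi ↦ (AffineSpace.homOfVector_appTop_coord _ _ _).trans
      ((dif_pos hi).trans (torusUnits_of_mem hi).symm)
  have e5 : ∀ i ∉ Θ, (stratum Θ).appTop (AffineSpace.coord _ i) = 0 :=
    fun i hi ↦ (AffineSpace.homOfVector_appTop_coord _ _ _).trans (dif_neg hi)
  constructor
  · intro h
    have h' : ∀ i, b.appTop (T i) = t.appTop ((stratum Θ).appTop (AffineSpace.coord _ i)) :=
      fun i ↦ by rw [← appTop_comp_apply, ← h, appTop_comp_apply, e3]
    refine ⟨?_, fun i hi ↦ ?_, fun i hi ↦ ?_⟩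
    · rw [← e1, ← e2, reassoc_of% h]
    · rw [h', e4 i hi, pullbackUnits_val]
    · rw [h', e5 i hi, map_zero]
  · rintro ⟨h, h1, h0⟩
    refine AffineSpace.hom_ext (by rw [Category.assoc, Category.assoc, e1, e2, h]) fun i ↦ ?_
    rw [appTop_comp_apply, appTop_comp_apply, e3]
    by_cases hi : i ∈ Θ
    · rw [h1 i hi, e4 i hi, pullbackUnits_val]
    · rw [h0 i hi, e5 i hi, map_zero]

/-- Both fibre products are described by a point of the torus together with a corresponding point of
`D` or of the normal cone. Applying the correspondence to the universal points gives the two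
morphisms, and its uniqueness on either side makes them inverse to each other. -/
theorem IsUniversal.exists_stratum_iso (hD : IsUniversal Y q T) (s : X ⟶ SpecC)
    (Θ : Finset (Fin l))
    (hQ : ∀ (U : X.AffineZariskiSite) (k : Fin l → ℕ), (∏ i, (Y i).ideal U ^ k i) ⊓
      ⨆ k' ∈ sameDegree Θᶜ k, ∏ i, (Y i).ideal U ^ k' i ≤
      (⨆ i ∈ Θᶜ, (Y i).ideal U) * ∏ i, (Y i).ideal U ^ k i) :
    ∃ e : pullback (familyMap s q T) (stratum Θ) ≅
        pullback (normalConeToBase (intersection Y Θᶜ) ≫ s) (torusToSpecC Θ),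
      e.hom ≫ pullback.fst _ _ ≫ normalConeToBase (intersection Y Θᶜ) =
        pullback.fst _ _ ≫ q ∧
      e.hom ≫ pullback.snd _ _ = pullback.snd _ _ := by
  obtain ⟨h0, h1, h2⟩ := (comp_familyMap_eq_iff s q T _ _).mp
    (pullback.condition (f := familyMap s q T) (g := stratum Θ))
  obtain ⟨a, ha⟩ := hD.exists_corresponds_left hQ h1 h2
  obtain ⟨b, hb⟩ := hD.exists_corresponds_right (pullbackUnits (pullback.snd
    (normalConeToBase (intersection Y Θᶜ) ≫ s) (torusToSpecC Θ)) (torusUnits Θ)) (pullback.fst _ _)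
  have ca : a ≫ normalConeToBase (intersection Y Θᶜ) ≫ s = pullback.snd _ _ ≫ torusToSpecC Θ := by
    rw [← h0, ← reassoc_of% ha.comp_eq]
  have cb : b ≫ familyMap s q T = pullback.snd _ _ ≫ stratum Θ := by
    refine (comp_familyMap_eq_iff s q T _ _).mpr
      ⟨?_, fun i hi ↦ hb.appTop_of_mem hi, fun i hi ↦ hb.appTop_of_notMem hi⟩
    rw [reassoc_of% hb.comp_eq, pullback.condition]
  refine ⟨⟨pullback.lift a (pullback.snd _ _) ca, pullback.lift b (pullback.snd _ _) cb, ?_, ?_⟩,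
    ?_, ?_⟩
  · refine pullback.hom_ext ?_ (by
      rw [Category.assoc, pullback.lift_snd, pullback.lift_snd, Category.id_comp])
    have := hb.comp (pullback.lift a (pullback.snd _ _) ca)
    rw [pullback.lift_fst, pullbackUnits_comp, pullback.lift_snd] at this
    rw [Category.assoc, pullback.lift_fst, Category.id_comp]
    exact this.unique_right ha
  · refine pullback.hom_ext ?_ (by
      rw [Category.assoc, pullback.lift_snd, pullback.lift_snd, Category.id_comp])
    have := ha.comp (pullback.lift b (pullback.snd _ _) cb)
    rw [pullback.lift_fst, pullbackUnits_comp, pullback.lift_snd] at this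
    rw [Category.assoc, pullback.lift_fst, Category.id_comp]
    exact this.unique_left hb
  · rw [pullback.lift_fst_assoc, ha.comp_eq]
  · exact pullback.lift_snd _ _ _

end Strata

theorem mainTheorem8 {X : Scheme.{0}} (s : X ⟶ SpecC) [Smooth s] [QuasiCompact s] {l : ℕ}
    (Y : Fin l → X.IdealSheafData) (hY : IsStrictNormalCrossing s Y) :
    (∃ (D : Scheme.{0}) (q : D ⟶ X) (T : Fin l → Γ(D, ⊤)), IsIteratedDeformation l X Y D q T) ∧
    ∀ (D : Scheme.{0}) (q : D ⟶ X) (T : Fin l → Γ(D, ⊤)), IsIteratedDeformation l X Y D q T →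
      (∀ U : X.affineOpens,
        ∃ e : Spec (.of (extendedRees fun i ↦ (Y i).ideal U)) ≅ (q ⁻¹ᵁ U.1).toScheme,
          e.hom ≫ (q ⁻¹ᵁ U.1).ι ≫ q =
            Spec.map (CommRingCat.ofHom (algebraMap Γ(X, U.1)
              (extendedRees fun i ↦ (Y i).ideal U))) ≫ U.2.fromSpec ∧
          ∀ i, (e.hom ≫ (q ⁻¹ᵁ U.1).ι).appTop (T i) =
            (Scheme.ΓSpecIso (.of (extendedRees fun i ↦ (Y i).ideal U))).inv
              (extendedRees.T (fun i ↦ (Y i).ideal U) i)) ∧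
      ∀ Θ : Finset (Fin l),
        ∃ e : pullback (familyMap s q T) (stratum Θ) ≅
            pullback (normalConeToBase (intersection Y Θᶜ) ≫ s) (torusToSpecC Θ),
          e.hom ≫ pullback.fst _ _ ≫ normalConeToBase (intersection Y Θᶜ) =
            pullback.fst _ _ ≫ q ∧
          e.hom ≫ pullback.snd _ _ = pullback.snd _ _ := by
  refine ⟨exists_isIteratedDeformation l X Y hY.isRegularFamily, fun D q T h ↦ ?_⟩
  have hD : IsUniversal Y q T := h.isUniversal hY.isRegularFamily
  exact ⟨hD.exists_iso, fun Θ ↦ hD.exists_stratum_iso s Θ fun U _ ↦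
    prod_inf_iSup_le_of_hasMonomialChart (hY.hasMonomialChart U)⟩
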